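/- Let $V$ be a finite-dimensional complex vector space with a linear (algebraic) action of $\mathbb{C}^*_G=\mathbb{C}^*$ through $SL(V)$, and let a second torus $\mathbb{C}^*_R=\mathbb{C}^*$ act linearly on $V$, commuting with $\mathbb{C}^*_G$; choose a basis of simultaneous eigenvectors, so that $V=\mathbb{C}^n$ with $\mathbb{C}^*_G$-weights $a_1,\dots,a_n\in\mathbb{Z}$, $\sum_i a_i=0$, and $\mathbb{C}^*_R$-weights $r_1,\dots,r_n\in\mathbb{Z}$. Let $d=\sum_{a_i>0}a_i$, let $V^{ss}_+\subset V$ be the open locus of points that are semistable for the character $+1$ of $\mathbb{C}^*_G$, and let $X_+=[V^{ss}_+/\mathbb{C}^*_G]$ be the quotient stack, with its induced action of $\mathbb{C}^*_R$. For $k\in\mathbb{Z}$ let $\mathcal{O}(k)$ be the $\mathbb{C}^*_R$-equivariant line bundle on $X_+$ whose sections are the functions on $V^{ss}_+$ of $\mathbb{C}^*_G$-degree $k$, and for a $\mathbb{C}^*_R$-equivariant vector bundle $F$ on $X_+$ and $j\in\mathbb{Z}$ let $F[j]$ be the tensor product of $F$ with the character of weight $j$ of $\mathbb{C}^*_R$.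 Then for every $t\in\mathbb{Z}$, every $\mathbb{C}^*_R$-equivariant vector bundle $E$ of finite rank on $X_+$ has a finite $\mathbb{C}^*_R$-equivariant resolution by finite direct sums of shifts of the line bundles $\mathcal{O}(t),\dots,\mathcal{O}(t+d-1)$, in the following sense: there is a bounded cochain complex $(C^i)_{i\in\mathbb{Z}}$ of $\mathbb{C}^*_R$-equivariant vector bundles on $X_+$, with equivariant differentials, such that every $C^i$ is isomorphic to a finite direct sum of bundles $\mathcal{O}(k)[j]$ with $t\le k\le t+d-1$ and $j\in\mathbb{Z}$, such that the complex is exact in every degree $i\neq 0$, and such that its cohomology in degree $0$ is equivariantly isomorphic to $E$. (The complex may have non-zero terms both in negative and in positive degrees.) -/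

import Mathlib

namespace GaugedQuotient

open CategoryTheory

/-- The action of `(l, s) ∈ C*_G × C*_R`, with values in a commutative ring `R`, on an `R`-point
of `V = ℂⁿ`, in coordinates of `C*_G`-weights `a` and `C*_R`-weights `r`. -/
def act {n : ℕ} (a r : Fin n → ℤ) {R : Type} [CommRing R] (l s : Rˣ) (v : Fin n → R) :
    Fin n → R :=
  fun i => ((l ^ a i * s ^ r i : Rˣ) : R) * v i

/-- An `R`-point of `V` is semistable for the character `+1` of `C*_G` if it lies in the open
subscheme of `V` where some function `f` with `f(l • v) = l ^ m * f(v)`, `m > 0`, is non-zero, that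
is, if the values at the point of all these functions generate the unit ideal of `R`. -/
def IsSemistable {n : ℕ} (a : Fin n → ℤ) {R : Type} [CommRing R] [Algebra ℂ R]
    (v : Fin n → R) : Prop :=
  Ideal.span {b : R | ∃ m : ℕ, 0 < m ∧ ∃ f : MvPolynomial (Fin n) ℂ,
    MvPolynomial.IsWeightedHomogeneous a f (m : ℤ) ∧ MvPolynomial.aeval v f = b} = ⊤

/-- The points of the semistable locus with values in arbitrary commutative `ℂ`-algebras. -/
structure Pt {n : ℕ} (a : Fin n → ℤ) : Type 1 where
  R : Type
  [commRing : CommRing R]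
  [algebra : Algebra ℂ R]
  v : Fin n → R
  semistable : IsSemistable a v

attribute [instance] Pt.commRing Pt.algebra

variable {n : ℕ} {a r : Fin n → ℤ}

/-- A morphism `p ⟶ q` of points of the quotient `[V^ss / C*_G × C*_R]`: a change of rings `φ`
and an element `(l, s)` of `(C*_G × C*_R)(q.R)` that carries the image of `p` under `φ` to `q`. -/
@[ext]
structure PtHom (r : Fin n → ℤ) (p q : Pt a) where
  φ : p.R →ₐ[ℂ] q.R
  l : q.Rˣ
  s : q.Rˣ
  act_eq : act a r l s (fun i => φ (p.v i)) = q.v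

theorem val_map_zpow {R S : Type} [CommRing R] [CommRing S] [Algebra ℂ R] [Algebra ℂ S]
    (φ : R →ₐ[ℂ] S) (u : Rˣ) (z : ℤ) :
    ((Units.map (φ : R →* S) u ^ z : Sˣ) : S) = φ ((u ^ z : Rˣ) : R) := by
  rw [← map_zpow]
  rfl

namespace PtHom

def id (r : Fin n → ℤ) (p : Pt a) : PtHom r p p where
  φ := AlgHom.id ℂ p.R
  l := 1
  s := 1
  act_eq := by funext i; simp [act]

def comp {p q w : Pt a} (h : PtHom r p q) (k : PtHom r q w) : PtHom r p w where
  φ := k.φ.comp h.φ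
  l := k.l * Units.map (k.φ : q.R →* w.R) h.l
  s := k.s * Units.map (k.φ : q.R →* w.R) h.s
  act_eq := by
    rw [← k.act_eq, ← h.act_eq]
    funext i
    simp only [act, mul_zpow, Units.val_mul, val_map_zpow, AlgHom.comp_apply, map_mul]
    ring

end PtHom

/-- A semilinear map `f : M → N` over `φ : R → S` is a base change if it identifies `N` with
`S ⊗_R M`, expressed by the universal property of the latter. -/
def IsSemilinearBaseChange {R S M N : Type} [CommRing R] [CommRing S] {φ : R →+* S}
    [AddCommGroup M] [Module R M] [AddCommGroup N] [Module S N] (f : M →ₛₗ[φ] N) : Prop :=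
  ∀ (Q : Type) [AddCommGroup Q] [Module S Q] (g : M →ₛₗ[φ] Q),
    ∃! g' : N →ₗ[S] Q, ∀ m, g' (f m) = g m

/-- A `C*_R`-equivariant vector bundle of finite rank on the stack `X₊ = [V^ss / C*_G]`,
equivalently a vector bundle on the stack `[V^ss / C*_G × C*_R]`: a finite projective `R`-module
for every `R`-point, with functorial transition maps along morphisms of points which are base
changes (so, isomorphisms along the elements of the group `(C*_G × C*_R)(R)`). -/
structure EqBundle (a r : Fin n → ℤ) : Type 1 where
  M : Pt a → Type
  [addCommGroup : ∀ p, AddCommGroup (M p)]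
  [module : ∀ p, Module p.R (M p)]
  [finite : ∀ p, Module.Finite p.R (M p)]
  [projective : ∀ p, Module.Projective p.R (M p)]
  map : ∀ {p q : Pt a} (h : PtHom r p q), M p →ₛₗ[(h.φ : p.R →+* q.R)] M q
  map_id : ∀ (p : Pt a) (m : M p), map (PtHom.id r p) m = m
  map_comp : ∀ {p q w : Pt a} (h : PtHom r p q) (k : PtHom r q w) (m : M p),
    map (h.comp k) m = map k (map h m)
  isBaseChange : ∀ {p q : Pt a} (h : PtHom r p q), IsSemilinearBaseChange (map h)

namespace EqBundle

attribute [instance] EqBundle.addCommGroup EqBundle.module EqBundle.finite EqBundle.projective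

/-- Morphisms of equivariant vector bundles. -/
@[ext]
structure Hom (E F : EqBundle a r) where
  app : ∀ p : Pt a, E.M p →ₗ[p.R] F.M p
  naturality : ∀ {p q : Pt a} (h : PtHom r p q) (m : E.M p),
    app q (E.map h m) = F.map h (app p m)

instance : Category (EqBundle a r) where
  Hom E F := Hom E F
  id E := { app := fun _ => LinearMap.id, naturality := fun _ _ => rfl }
  comp f g :=
    { app := fun p => (g.app p).comp (f.app p)
      naturality := fun h m => by simp [f.naturality, g.naturality] }

instance : Limits.HasZeroMorphisms (EqBundle a r) where
  zero E F := ⟨{ app := fun _ => 0, naturality := fun h m => by simp }⟩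
  comp_zero f G := by
    apply Hom.ext
    funext p
    exact LinearMap.zero_comp _
  zero_comp E F G f := by
    apply Hom.ext
    funext p
    exact LinearMap.comp_zero _

/-- The linear map that a morphism of equivariant bundles induces on the fibres over a point. -/
def fibre {E F : EqBundle a r} (f : E ⟶ F) (p : Pt a) : E.M p →ₗ[p.R] F.M p :=
  Hom.app f p

/-- The line bundle `O(k)`: its global sections on `X₊` are the functions `f` on `V^ss` with
`f(l • v) = l ^ k * f(v)` for `l ∈ C*_G`; the action of `C*_R` is the standard one. -/
def lineBundle (a r : Fin n → ℤ) (k : ℤ) : EqBundle a r where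
  M p := p.R
  map {p q} h :=
    { toFun := fun b => ((h.l ^ k : q.Rˣ) : q.R) * h.φ b
      map_add' := fun x y => by rw [map_add, mul_add]
      map_smul' := fun c x => by
        simp only [smul_eq_mul, map_mul, RingHom.coe_coe]
        ring }
  map_id p m := by
    change ((1 ^ k : p.Rˣ) : p.R) * m = m
    simp
  map_comp {p q w} h g m := by
    change (((g.l * Units.map (g.φ : q.R →* w.R) h.l) ^ k : w.Rˣ) : w.R) * g.φ (h.φ m) =
      ((g.l ^ k : w.Rˣ) : w.R) * g.φ (((h.l ^ k : q.Rˣ) : q.R) * h.φ m)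
    rw [mul_zpow, Units.val_mul, val_map_zpow, map_mul, mul_assoc]
  isBaseChange {p q} h := by
    intro Q _ _ g
    refine ⟨LinearMap.toSpanSingleton q.R Q (((h.l ^ (-k) : q.Rˣ) : q.R) • g 1), ?_, ?_⟩
    · intro m
      have e : g m = h.φ m • g 1 := by
        have := g.map_smulₛₗ m 1
        simpa using this
      rw [e, LinearMap.toSpanSingleton_apply]
      simp only [LinearMap.coe_mk, AddHom.coe_mk]
      rw [smul_smul]
      congr 1
      rw [mul_right_comm, ← Units.val_mul, ← zpow_add]
      simp
    · intro g' hg'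
      apply LinearMap.ext_ring
      rw [LinearMap.toSpanSingleton_apply, one_smul, ← hg' 1, ← map_smul]
      congr 1
      simp only [LinearMap.coe_mk, AddHom.coe_mk, map_one, mul_one, smul_eq_mul]
      rw [← Units.val_mul, ← zpow_add]
      simp

/-- The shift `E[j]`: the tensor product of `E` with the character of `C*_R` of weight `j`, so that
the sections of R-charge `c` of `E[j]` are the sections of R-charge `c + j` of `E`. -/
def shift (E : EqBundle a r) (j : ℤ) : EqBundle a r where
  M := E.M
  map {p q} h :=
    { toFun := fun m => ((h.s ^ j : q.Rˣ) : q.R) • E.map h m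
      map_add' := fun x y => by rw [map_add, smul_add]
      map_smul' := fun c x => by
        rw [(E.map h).map_smulₛₗ, smul_comm] }
  map_id p m := by
    change ((1 ^ j : p.Rˣ) : p.R) • E.map (PtHom.id r p) m = m
    rw [E.map_id, one_zpow, Units.val_one, one_smul]
  map_comp {p q w} h g m := by
    change (((g.s * Units.map (g.φ : q.R →* w.R) h.s) ^ j : w.Rˣ) : w.R) • E.map (h.comp g) m =
      ((g.s ^ j : w.Rˣ) : w.R) • E.map g (((h.s ^ j : q.Rˣ) : q.R) • E.map h m)
    rw [E.map_comp, (E.map g).map_smulₛₗ, smul_smul, mul_zpow, Units.val_mul, val_map_zpow]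
    rfl
  isBaseChange {p q} h := by
    intro Q _ _ g
    obtain ⟨g', hg', huniq⟩ := E.isBaseChange h Q g
    refine ⟨((h.s ^ (-j) : q.Rˣ) : q.R) • g', ?_, ?_⟩
    · intro m
      simp only [LinearMap.coe_mk, AddHom.coe_mk, LinearMap.smul_apply, map_smul]
      rw [smul_smul, ← Units.val_mul, ← zpow_add, hg']
      simp
    · intro k hk
      have := huniq (((h.s ^ j : q.Rˣ) : q.R) • k) (fun m => by
        rw [LinearMap.smul_apply, ← map_smul]
        exact hk m)
      rw [← this, smul_smul, ← Units.val_mul, ← zpow_add]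
      simp

/-- Finite direct sums. -/
def directSum {m : ℕ} (F : Fin m → EqBundle a r) : EqBundle a r where
  M p := ∀ j, (F j).M p
  projective p := Module.Projective.of_equiv
    (DFinsupp.linearEquivFunOnFintype (R := p.R) (M := fun j => (F j).M p))
  map h :=
    { toFun := fun x j => (F j).map h (x j)
      map_add' := fun x y => by funext j; simp
      map_smul' := fun c x => by funext j; simp [LinearMap.map_smulₛₗ] }
  map_id p x := by funext j; exact (F j).map_id p (x j)
  map_comp h k x := by funext j; exact (F j).map_comp h k (x j)
  isBaseChange {p q} h := by
    intro Q _ _ g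
    choose g' hg' huniq using fun j => (F j).isBaseChange h Q
      (g.comp (LinearMap.single p.R (fun j => (F j).M p) j))
    refine ⟨∑ j, (g' j).comp (LinearMap.proj j), ?_, ?_⟩
    · intro x
      rw [LinearMap.sum_apply]
      change ∑ j, g' j ((F j).map h (x j)) = g x
      have hx : x = ∑ j, Pi.single j (x j) := (Finset.univ_sum_single x).symm
      conv_rhs => rw [hx, map_sum]
      exact Finset.sum_congr rfl fun j _ => hg' j (x j)
    · intro k hk
      have hj : ∀ j, k.comp (LinearMap.single q.R (fun j => (F j).M q) j) = g' j := by
        intro j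
        refine huniq j _ fun x => ?_
        rw [LinearMap.comp_apply, LinearMap.comp_apply, ← hk]
        congr 1
        funext i
        change (Pi.single j ((F j).map h x) : ∀ i, (F i).M q) i = (F i).map h ((Pi.single j x : ∀ i, (F i).M p) i)
        exact (Pi.apply_single (fun i => (F i).map h) (fun i => map_zero _) j x i).symm
      apply LinearMap.ext
      intro y
      rw [LinearMap.sum_apply]
      have hy : y = ∑ j, Pi.single j (y j) := (Finset.univ_sum_single y).symm
      conv_lhs => rw [hy, map_sum]
      refine Finset.sum_congr rfl fun j _ => ?_
      rw [← hj]
      rfl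

/-- `E` is a finite direct sum of shifts `O(k)[j]` with `t ≤ k ≤ t + d - 1`. -/
def IsWindowSum (t d : ℤ) (E : EqBundle a r) : Prop :=
  ∃ (m : ℕ) (k j : Fin m → ℤ), (∀ i, t ≤ k i ∧ k i ≤ t + d - 1) ∧
    Nonempty (E ≅ directSum fun i => (lineBundle a r (k i)).shift (j i))

/-- `C` is a finite resolution of `E`, in the sense of the derived category: it is a bounded
complex, it is exact in all degrees except `0`, and its cohomology in degree `0` is equivariantly
isomorphic to `E`. The isomorphism is given by maps `π` from the cocycles onto the fibres of `E`
whose kernels are the coboundaries. -/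
structure Resolves (C : CochainComplex (EqBundle a r) ℤ) (E : EqBundle a r) : Prop where
  bounded : ∃ N : ℤ, ∀ i : ℤ, N < |i| → ∀ p, Subsingleton ((C.X i).M p)
  exact : ∀ i : ℤ, i ≠ 0 → ∀ p,
    Function.Exact (fibre (C.d (i - 1) i) p) (fibre (C.d i (i + 1)) p)
  augmentation : ∃ π : ∀ p : Pt a, LinearMap.ker (fibre (C.d 0 1) p) →ₗ[p.R] E.M p,
    (∀ (p q : Pt a) (h : PtHom r p q) (z : LinearMap.ker (fibre (C.d 0 1) p))
      (z' : LinearMap.ker (fibre (C.d 0 1) q)),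
      (z' : (C.X 0).M q) = (C.X 0).map h z → π q z' = E.map h (π p z)) ∧
    ∀ p, Function.Surjective (π p) ∧
      ∀ z, π p z = 0 ↔ (z : (C.X 0).M p) ∈ LinearMap.range (fibre (C.d (-1) 0) p)

end EqBundle

end GaugedQuotient

/-! Let `S` be the polynomial ring on `V`, graded by `ℤ × ℤ` through the weights of both tori, and
let `d` be the sum of the positive `a i`. A twist of `S` by `(k, j)` gives the line bundle
`O(k)[j]`, and morphisms of twists are homogeneous polynomials. The argument takes place in the
homotopy category `HoTwist` of complexes of finite sums of twists. A complex there is called torsion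
(`torsionComplexes`) if it is exact wherever some coordinate of positive weight is invertible. At a
semistable point these coordinates generate the unit ideal (`isSemistable_iff`), so a torsion
complex is exact there (`acyclicAt_of_torsionComplexes`).

Some finite resolution by twists exists (`exists_hasResolution`). Over the chart where a positive
coordinate `x_i` is invertible, the torus coaction writes every section of `E` as a sum of
homogeneous ones, and a homogeneous section extends to the semistable locus after multiplication by
a power of `x_i`. Hence finitely many homogeneous global sections generate `E`. They span a finitely
generated graded `S`-module, which has a finite graded free resolution by Hilbert's syzygy theorem
(`exists_hasRes_mvPolynomial`). Since `E` is locally projective, the presentation splits on each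
chart up to a power of `x_i`. Therefore the resolution stays exact after evaluation at semistable
points with values in arbitrary rings.

The weights of such a resolution can be moved into the window. The Koszul complex `K` on all
variables of positive weight is torsion. It is built from one twist of highest weight `h`, one twist
of lowest weight `h - d`, and twists strictly between them. So, modulo torsion, the highest twist is
built from twists of weights `h - d, …, h - 1`, and dually for the lowest one. To make these
replacements inside a complex, and not only for a single twist, orthogonality is used. The morphisms
from twists to `K`, and from `K` to twists, are the graded components of `S` modulo the positive
variables. These vanish in positive weight, because a monomial of positive weight contains a
variable of positive weight. For triangulated classes `P` and `Q` without non-zero morphisms from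
`P` to `Q`, the extensions of `Q` by `P` again form a triangulated class
(`isTriangulated_extensionProduct`), so it suffices to treat the twists themselves. This gives
`lower_window` and `raise_window`, which shrink an interval of more than `d` weights by one.

Being a resolution of `E` is insensitive to torsion cones (`hasResolution_iff_of_distTriang`), so
the shrinking may be iterated until exactly the weights `t, …, t + d - 1` remain. The result lies in
the triangulated hull of these twists, hence is homotopy equivalent to a bounded complex whose terms
are sums of them (`triangulatedHull_linesIn_le`). Evaluation turns that complex into the required
complex of bundles. -/

namespace GradedResolution

/-! ### Graded modules and finite graded free resolutions -/

open Finset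

variable {G : Type} [AddCommGroup G]

/-- `ℳ` is a grading of the module `M` by the group `G`, compatible with the family `𝒜` of
subgroups of the ring. -/
structure IsGr {A : Type} [CommRing A] (𝒜 : G → AddSubgroup A) {M : Type} [AddCommGroup M]
    [Module A M] (ℳ : G → AddSubgroup M) : Prop where
  smul_mem : ∀ {g h : G} {a : A} {m : M}, a ∈ 𝒜 g → m ∈ ℳ h → a • m ∈ ℳ (g + h)
  iSup_eq_top : ⨆ g, ℳ g = ⊤
  indep : ∀ (s : Finset G) (f : G → M), (∀ g, f g ∈ ℳ g) → ∑ g ∈ s, f g = 0 → ∀ g ∈ s, f g = 0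

section sums

variable {M : Type} [AddCommGroup M] {ℳ : G → AddSubgroup M}

omit [AddCommGroup G] in
theorem exists_sum_of_mem_iSup {m : M} (h : m ∈ ⨆ g, ℳ g) :
    ∃ (s : Finset G) (f : G → M), (∀ g, f g ∈ ℳ g) ∧ (∀ g ∉ s, f g = 0) ∧ ∑ g ∈ s, f g = m := by
  classical
  induction h using AddSubgroup.iSup_induction' with
  | hp g x hx =>
    refine ⟨{g}, Pi.single g x, fun h => ?_, fun h hh => ?_, by simp⟩
    · rcases eq_or_ne h g with rfl | hne
      · simpa using hx
      · simp [hne, zero_mem]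
    · simp at hh; simp [hh]
  | h1 => exact ⟨∅, 0, fun g => zero_mem _, fun _ _ => rfl, by simp⟩
  | hadd x y _ _ hx hy =>
    obtain ⟨s, f, hf, hf0, rfl⟩ := hx
    obtain ⟨t, f', hf', hf0', rfl⟩ := hy
    refine ⟨s ∪ t, f + f', fun g => add_mem (hf g) (hf' g), fun g hg => ?_, ?_⟩
    · simp only [mem_union, not_or] at hg
      simp [hf0 g hg.1, hf0' g hg.2]
    · simp only [Pi.add_apply, sum_add_distrib]
      congr 1
      · exact (sum_subset subset_union_left fun g _ hg => hf0 g hg).symm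
      · exact (sum_subset subset_union_right fun g _ hg => hf0' g hg).symm

end sums

variable {A : Type} [CommRing A] {𝒜 : G → AddSubgroup A}
variable {M : Type} [AddCommGroup M] [Module A M] {ℳ : G → AddSubgroup M}
variable {N : Type} [AddCommGroup N] [Module A N] {𝒩 : G → AddSubgroup N}

namespace IsGr

theorem exists_sum (hM : IsGr 𝒜 ℳ) (m : M) :
    ∃ (s : Finset G) (f : G → M), (∀ g, f g ∈ ℳ g) ∧ (∀ g ∉ s, f g = 0) ∧ ∑ g ∈ s, f g = m :=
  exists_sum_of_mem_iSup (by rw [hM.iSup_eq_top]; trivial)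

/-- A sum of homogeneous elements that is homogeneous is equal to its component. -/
theorem eq_of_sum_mem (hM : IsGr 𝒜 ℳ) {s : Finset G} {f : G → M} (hf : ∀ g, f g ∈ ℳ g)
    (hf0 : ∀ g ∉ s, f g = 0) {h : G} (hs : ∑ g ∈ s, f g ∈ ℳ h) : ∑ g ∈ s, f g = f h := by
  classical
  set y := ∑ g ∈ s, f g with hy
  have e : ∑ g ∈ insert h s, f g = y :=
    (sum_subset (subset_insert h s) fun g _ hg => hf0 g hg).symm
  -- Subtracting the whole sum in degree `h` gives a family of homogeneous elements with sum zero,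
  -- and independence applies in degree `h`.
  have := hM.indep (insert h s) (f - Pi.single h y) (fun g => sub_mem (hf g) (by
    rcases eq_or_ne g h with rfl | hne
    · simpa using hs
    · simp [hne, zero_mem])) (by simp [e]) h (by simp)
  simpa [sub_eq_zero, eq_comm] using this

/-- Homogeneous elements of the image of a graded map lift to homogeneous elements. -/
theorem exists_lift (hM : IsGr 𝒜 ℳ) (hN : IsGr 𝒜 𝒩) (φ : M →+ N)
    (hφ : ∀ g, ∀ m ∈ ℳ g, φ m ∈ 𝒩 g) {g : G} {m : M} (hm : φ m ∈ 𝒩 g) :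
    ∃ m' ∈ ℳ g, φ m' = φ m := by
  obtain ⟨s, f, hf, hf0, rfl⟩ := hM.exists_sum m
  refine ⟨f g, hf g, ?_⟩
  rw [map_sum] at hm ⊢
  exact (hN.eq_of_sum_mem (f := fun g => φ (f g)) (fun g => hφ g _ (hf g))
    (fun g hg => by rw [hf0 g hg, map_zero]) hm).symm

/-- The condition `hK` says that `K` contains the homogeneous components of its elements, which is
what makes the induced pieces span. -/
theorem comap_subtype (hM : IsGr 𝒜 ℳ) (K : Submodule A M)
    (hK : ∀ (s : Finset G) (f : G → M), (∀ g, f g ∈ ℳ g) → (∀ g ∉ s, f g = 0) →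
      ∑ g ∈ s, f g ∈ K → ∀ g, f g ∈ K) :
    IsGr 𝒜 (fun g => (ℳ g).comap K.toAddSubgroup.subtype : G → AddSubgroup K) where
  smul_mem {g h a m} ha hm := hM.smul_mem (m := (m : M)) ha hm
  iSup_eq_top := by
    rw [eq_top_iff]
    rintro ⟨m, hm⟩ -
    obtain ⟨s, f, hf, hf0, rfl⟩ := hM.exists_sum m
    have h := hK s f hf hf0 hm
    have e : (⟨∑ g ∈ s, f g, hm⟩ : K) = ∑ g ∈ s, ⟨f g, h g⟩ := by
      apply Subtype.ext
      simp
    rw [e]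
    exact sum_mem fun g _ => AddSubgroup.mem_iSup_of_mem g (hf g)
  indep s f hf h g hg := by
    have := hM.indep s (fun g => (f g : M)) hf (by
      simpa using congrArg (Subtype.val) h) g hg
    exact Subtype.ext this

theorem ker (hM : IsGr 𝒜 ℳ) (hN : IsGr 𝒜 𝒩) (φ : M →ₗ[A] N)
    (hφ : ∀ g, ∀ m ∈ ℳ g, φ m ∈ 𝒩 g) :
    IsGr 𝒜 (fun g => (ℳ g).comap (LinearMap.ker φ).toAddSubgroup.subtype :
      G → AddSubgroup (LinearMap.ker φ)) :=
  hM.comap_subtype _ fun s f hf hf0 h g => by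
    rw [LinearMap.mem_ker, map_sum] at h
    by_cases hg : g ∈ s
    · exact hN.indep s (fun g => φ (f g)) (fun g => hφ g _ (hf g)) h g hg
    · rw [hf0 g hg]; exact zero_mem _

end IsGr

section free

variable {ι : Type} [Fintype ι]

/-- The grading of a free module with basis vectors in the degrees `d`. -/
def freeGr (𝒜 : G → AddSubgroup A) (d : ι → G) (g : G) : AddSubgroup (ι → A) where
  carrier := {f | ∀ i, f i ∈ 𝒜 (g - d i)}
  zero_mem' _ := zero_mem _
  add_mem' h h' i := add_mem (h i) (h' i)
  neg_mem' h i := neg_mem (h i)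

theorem isGr_freeGr (hA : IsGr 𝒜 𝒜) (d : ι → G) : IsGr 𝒜 (freeGr 𝒜 d) where
  smul_mem {g h a m} ha hm i := by
    rw [add_sub_assoc]
    exact hA.smul_mem ha (hm i)
  iSup_eq_top := by
    classical
    rw [eq_top_iff]
    intro f _
    rw [← Finset.univ_sum_single f]
    refine sum_mem fun i _ => ?_
    obtain ⟨s, u, hu, -, e⟩ := hA.exists_sum (f i)
    rw [← e, ← AddMonoidHom.single_apply, map_sum]
    refine sum_mem fun g _ => AddSubgroup.mem_iSup_of_mem (g + d i) ?_
    intro j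
    rcases eq_or_ne j i with rfl | hne
    · simpa using hu g
    · simp [hne, zero_mem]
  indep s f hf h g hg := by
    classical
    funext i
    have := hA.indep (s.map (Equiv.subRight (d i)).toEmbedding) (fun g => f (g + d i) i)
      (fun g => by simpa using hf (g + d i) i) (by
        simpa using congrFun h i) (g - d i) (by simpa using hg)
    simpa using this

theorem linearCombination_mem (hM : IsGr 𝒜 ℳ) {d : ι → G} {x : ι → M} (hx : ∀ i, x i ∈ ℳ (d i))
    (g : G) (f : ι → A) (hf : f ∈ freeGr 𝒜 d g) : Fintype.linearCombination A x f ∈ ℳ g := by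
  rw [Fintype.linearCombination_apply]
  refine sum_mem fun i _ => ?_
  simpa using hM.smul_mem (hf i) (hx i)

end free

/-- `M` has a resolution of length at most `k` by graded free modules of finite rank, where the
zero module counts as the one of length `0`. -/
def HasRes (𝒜 : G → AddSubgroup A) :
    ℕ → ∀ (M : Type) [AddCommGroup M] [Module A M], (G → AddSubgroup M) → Prop
  | 0, M, _, _, _ => Subsingleton M
  | k + 1, _, _, _, ℳ => ∃ (ι : Type) (_ : Fintype ι) (d : ι → G) (x : ι → _), (∀ i, x i ∈ ℳ (d i)) ∧
      Function.Surjective (Fintype.linearCombination A x) ∧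
      HasRes 𝒜 k (LinearMap.ker (Fintype.linearCombination A x))
        fun g => (freeGr 𝒜 d g).comap (LinearMap.ker _).toAddSubgroup.subtype

namespace HasRes

/-- Having a finite graded free resolution is invariant under isomorphisms, also of the rings. -/
theorem congr {B : Type} [CommRing B] {ℬ : G → AddSubgroup B} (e : A ≃+* B)
    (he : ∀ g a, a ∈ 𝒜 g ↔ e a ∈ ℬ g) (k : ℕ) :
    ∀ {M : Type} [AddCommGroup M] [Module A M] {ℳ : G → AddSubgroup M}
      {N : Type} [AddCommGroup N] [Module B N] {𝒩 : G → AddSubgroup N}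
      (f : M ≃+ N), (∀ a m, f (a • m) = e a • f m) → (∀ g m, m ∈ ℳ g ↔ f m ∈ 𝒩 g) →
      HasRes 𝒜 k M ℳ → HasRes ℬ k N 𝒩 := by
  induction k with
  | zero =>
    intro M _ _ ℳ N _ _ 𝒩 f _ _ h
    have : Subsingleton M := h
    exact f.symm.injective.subsingleton
  | succ k ih =>
    rintro M _ _ ℳ N _ _ 𝒩 f hf hg ⟨ι, _, d, x, hx, hs, hk⟩
    have key : ∀ u : ι → A, Fintype.linearCombination B (fun i => f (x i)) (fun i => e (u i)) =
        f (Fintype.linearCombination A x u) := by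
      intro u
      simp [Fintype.linearCombination_apply, hf]
    refine ⟨ι, inferInstance, d, fun i => f (x i), fun i => (hg _ _).1 (hx i), fun n => ?_, ?_⟩
    · obtain ⟨u, hu⟩ := hs (f.symm n)
      exact ⟨fun i => e (u i), by rw [key, hu, f.apply_symm_apply]⟩
    · let F : LinearMap.ker (Fintype.linearCombination A x) ≃+
          LinearMap.ker (Fintype.linearCombination B fun i => f (x i)) :=
        { toFun := fun u => ⟨fun i => e (u.1 i), by
            rw [LinearMap.mem_ker, key, u.2, map_zero]⟩
          invFun := fun u => ⟨fun i => e.symm (u.1 i), by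
            rw [LinearMap.mem_ker]
            apply f.injective
            rw [← key, map_zero]
            simp⟩
          left_inv := fun u => by ext; simp
          right_inv := fun u => by ext; simp
          map_add' := fun u v => by ext; simp }
      refine ih F (fun a u => ?_) (fun g u => ?_) hk
      · ext; simp [F]
      · exact forall_congr' fun i => he _ _

/-- A resolution is padded at its end: the zero module is covered by the free module on the empty
type, with zero kernel. -/
theorem succ (k : ℕ) : ∀ {M : Type} [AddCommGroup M] [Module A M] {ℳ : G → AddSubgroup M},
    HasRes 𝒜 k M ℳ → HasRes 𝒜 (k + 1) M ℳ := by
  induction k with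
  | zero =>
    intro M _ _ ℳ h
    have : Subsingleton M := h
    refine ⟨Empty, inferInstance, nofun, nofun, nofun, fun m => ⟨0, Subsingleton.elim _ _⟩, ?_⟩
    change Subsingleton _
    infer_instance
  | succ k ih =>
    rintro M _ _ ℳ ⟨ι, _, d, x, hx, hs, hk⟩
    exact ⟨ι, inferInstance, d, x, hx, hs, ih hk⟩

theorem mono {k l : ℕ} (h : k ≤ l) (hM : HasRes 𝒜 k M ℳ) : HasRes 𝒜 l M ℳ := by
  induction h with
  | refl => exact hM
  | step _ ih => exact ih.succ

/-- Extensions of modules with finite graded free resolutions. -/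
theorem extension (hA : IsGr 𝒜 𝒜) (k : ℕ) : ∀ {K L N : Type} [AddCommGroup K] [Module A K]
    [AddCommGroup L] [Module A L] [AddCommGroup N] [Module A N]
    {𝒦 : G → AddSubgroup K} {ℒ : G → AddSubgroup L} {𝒩 : G → AddSubgroup N},
    IsGr 𝒜 𝒦 → IsGr 𝒜 ℒ → IsGr 𝒜 𝒩 → ∀ (i : K →ₗ[A] L) (p : L →ₗ[A] N),
    Function.Injective i → Function.Exact i p → Function.Surjective p →
    (∀ g, ∀ m ∈ 𝒦 g, i m ∈ ℒ g) → (∀ g, ∀ m ∈ ℒ g, p m ∈ 𝒩 g) →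
    HasRes 𝒜 k K 𝒦 → HasRes 𝒜 k N 𝒩 → HasRes 𝒜 k L ℒ := by
  induction k with
  | zero =>
    intro K L N _ _ _ _ _ _ 𝒦 ℒ 𝒩 _ _ _ i p hi hip hp _ _ hk hn
    have : Subsingleton K := hk
    have : Subsingleton N := hn
    refine ⟨fun a b => ?_⟩
    have h : ∀ a : L, a = 0 := fun a => by
      obtain ⟨c, rfl⟩ := (hip a).1 (Subsingleton.elim _ _)
      rw [Subsingleton.elim c 0, map_zero]
    rw [h a, h b]
  | succ k ih =>
    rintro K L N _ _ _ _ _ _ 𝒦 ℒ 𝒩 gK gL gN i p hi hip hp hig hpg ⟨ι, _, d, x, hx, hs, hk⟩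
      ⟨ι', _, d', x', hx', hs', hk'⟩
    -- Horseshoe lemma: the generators of `N` lift to homogeneous elements of `L`, and together with
    -- the images of the generators of `K` they generate `L`.
    have hl : ∀ j, ∃ l ∈ ℒ (d' j), p l = x' j := fun j => by
      obtain ⟨l, hl⟩ := hp (x' j)
      obtain ⟨l', h, h'⟩ := gL.exists_lift gN p.toAddMonoidHom hpg (m := l)
        (by simpa [hl] using hx' j)
      exact ⟨l', h, h'.trans hl⟩
    choose l hlm hl using hl
    set X : ι ⊕ ι' → L := Sum.elim (fun j => i (x j)) l with hX
    have hXm : ∀ j, X j ∈ ℒ (Sum.elim d d' j) := by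
      rintro (j | j)
      · exact hig _ _ (hx j)
      · exact hlm j
    have key : ∀ u : ι ⊕ ι' → A, Fintype.linearCombination A X u =
        i (Fintype.linearCombination A x fun j => u (Sum.inl j)) +
          Fintype.linearCombination A l fun j => u (Sum.inr j) := by
      intro u
      simp [Fintype.linearCombination_apply, hX]
    have keyp : ∀ u : ι' → A, p (Fintype.linearCombination A l u) =
        Fintype.linearCombination A x' u := by
      intro u
      simp [Fintype.linearCombination_apply, hl]
    have pi : ∀ m, p (i m) = 0 := fun m => (hip _).2 ⟨m, rfl⟩
    refine ⟨ι ⊕ ι', inferInstance, Sum.elim d d', X, hXm, fun y => ?_, ?_⟩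
    · obtain ⟨v, hv⟩ := hs' (p y)
      obtain ⟨z, hz⟩ := (hip (y - Fintype.linearCombination A l v)).1 (by
        rw [map_sub, keyp, hv, sub_self])
      obtain ⟨u, hu⟩ := hs z
      exact ⟨Sum.elim u v, by rw [key]; simp [hu, hz]⟩
    -- The kernels of the three free covers form again a short exact sequence of graded modules, to
    -- which the induction hypothesis applies.
    · let I : LinearMap.ker (Fintype.linearCombination A x) →ₗ[A]
          LinearMap.ker (Fintype.linearCombination A X) :=
        { toFun := fun u => ⟨Sum.elim u.1 0, by
            rw [LinearMap.mem_ker, key]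
            have : Fintype.linearCombination A x u.1 = 0 := u.2
            change i (Fintype.linearCombination A x u.1) + Fintype.linearCombination A l 0 = 0
            rw [this, map_zero, map_zero, add_zero]⟩
          map_add' := fun u v => by ext (j | j) <;> simp
          map_smul' := fun u v => by ext (j | j) <;> simp }
      let P : LinearMap.ker (Fintype.linearCombination A X) →ₗ[A]
          LinearMap.ker (Fintype.linearCombination A x') :=
        { toFun := fun u => ⟨fun j => u.1 (Sum.inr j), by
            rw [LinearMap.mem_ker, ← keyp]
            have := congrArg p (u.2 : Fintype.linearCombination A X u.1 = 0)
            rwa [key, map_add, pi, zero_add, map_zero] at this⟩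
          map_add' := fun u v => rfl
          map_smul' := fun u v => rfl }
      refine ih ((isGr_freeGr hA d).ker gK _ (linearCombination_mem gK hx))
        ((isGr_freeGr hA (Sum.elim d d')).ker gL _ (linearCombination_mem gL hXm))
        ((isGr_freeGr hA d').ker gN _ (linearCombination_mem gN hx')) I P ?_ ?_ ?_ ?_ ?_ hk hk'
      · intro u v h
        ext j
        exact congrFun (congrArg Subtype.val h) (Sum.inl j)
      · intro u
        constructor
        · intro h
          have h' : ∀ j, u.1 (Sum.inr j) = 0 := fun j => congrFun (congrArg Subtype.val h) j
          refine ⟨⟨fun j => u.1 (Sum.inl j), ?_⟩, ?_⟩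
          · rw [LinearMap.mem_ker]
            apply hi
            have : Fintype.linearCombination A X u.1 = 0 := u.2
            rw [key, show (fun j => u.1 (Sum.inr j)) = 0 from funext h', map_zero, add_zero] at this
            rw [this, map_zero]
          · ext (j | j)
            · rfl
            · exact (h' j).symm
        · rintro ⟨v, rfl⟩
          rfl
      · intro v
        have hv : Fintype.linearCombination A x' v.1 = 0 := v.2
        obtain ⟨z, hz⟩ := (hip (Fintype.linearCombination A l v.1)).1 (by rw [keyp, hv])
        obtain ⟨u, hu⟩ := hs z
        refine ⟨⟨Sum.elim (-u) v.1, ?_⟩, ?_⟩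
        · rw [LinearMap.mem_ker, key]
          change i (Fintype.linearCombination A x (-u)) + Fintype.linearCombination A l v.1 = 0
          rw [map_neg, hu, map_neg, hz, neg_add_cancel]
        · rfl
      · rintro g u hu (j | j)
        · exact hu j
        · exact zero_mem _
      · intro g u hu j
        exact hu (Sum.inr j)

/-- The cokernel of an injective map of modules with finite graded free resolutions. -/
theorem cokernel (hA : IsGr 𝒜 𝒜) {k : ℕ} {K L N : Type} [AddCommGroup K] [Module A K]
    [AddCommGroup L] [Module A L] [AddCommGroup N] [Module A N]
    {𝒦 : G → AddSubgroup K} {ℒ : G → AddSubgroup L} {𝒩 : G → AddSubgroup N}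
    (gK : IsGr 𝒜 𝒦) (gL : IsGr 𝒜 ℒ) (gN : IsGr 𝒜 𝒩) (i : K →ₗ[A] L) (p : L →ₗ[A] N)
    (hi : Function.Injective i) (hip : Function.Exact i p) (hp : Function.Surjective p)
    (hig : ∀ g, ∀ m ∈ 𝒦 g, i m ∈ ℒ g) (hpg : ∀ g, ∀ m ∈ ℒ g, p m ∈ 𝒩 g)
    (hK : HasRes 𝒜 k K 𝒦) (hL : HasRes 𝒜 k L ℒ) : HasRes 𝒜 (k + 1) N 𝒩 := by
  cases k with
  | zero =>
    have : Subsingleton L := hL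
    exact HasRes.succ 0 (M := N) (ℳ := 𝒩) hp.subsingleton
  | succ k =>
    obtain ⟨ι, _, d, x, hx, hs, hk⟩ := hL
    have key : ∀ u, Fintype.linearCombination A (fun j => p (x j)) u =
        p (Fintype.linearCombination A x u) := by
      intro u
      simp [Fintype.linearCombination_apply]
    have hx' : ∀ j, p (x j) ∈ 𝒩 (d j) := fun j => hpg _ _ (hx j)
    refine ⟨ι, inferInstance, d, fun j => p (x j), hx', fun y => ?_, ?_⟩
    · obtain ⟨y, rfl⟩ := hp y
      obtain ⟨u, rfl⟩ := hs y
      exact ⟨u, key u⟩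
    -- The cover of `L` composed with `p` covers `N`. A relation `u` for `N` takes a value in `L`
    -- that comes from a unique element of `K`; so the relations for `N` are an extension of `K` by
    -- the relations for `L`.
    · have hq : ∀ u : LinearMap.ker (Fintype.linearCombination A fun j => p (x j)),
          ∃ z, i z = Fintype.linearCombination A x u.1 := fun u =>
        (hip _).1 (by rw [← key]; exact u.2)
      choose q hq using hq
      let Q : LinearMap.ker (Fintype.linearCombination A fun j => p (x j)) →ₗ[A] K :=
        { toFun := q
          map_add' := fun u v => hi (by rw [hq, map_add, hq, hq]; exact map_add _ _ _)
          map_smul' := fun a u => hi (by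
            rw [hq, RingHom.id_apply, map_smul, hq]; exact map_smul _ _ _) }
      let I : LinearMap.ker (Fintype.linearCombination A x) →ₗ[A]
          LinearMap.ker (Fintype.linearCombination A fun j => p (x j)) :=
        Submodule.inclusion fun u hu => by
          rw [LinearMap.mem_ker, key, hu, map_zero]
      refine extension hA (k + 1) ((isGr_freeGr hA d).ker gL _ (linearCombination_mem gL hx))
        ((isGr_freeGr hA d).ker gN _ (linearCombination_mem gN hx')) gK I Q
        (Submodule.inclusion_injective _) ?_ ?_ (fun g u hu => hu) ?_ hk.succ hK
      · intro u
        constructor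
        · intro h
          refine ⟨⟨u.1, ?_⟩, rfl⟩
          rw [LinearMap.mem_ker, ← hq, show q u = 0 from h, map_zero]
        · rintro ⟨v, rfl⟩
          apply hi
          change i (q (I v)) = i 0
          rw [hq, map_zero]
          exact v.2
      · intro z
        obtain ⟨u, hu⟩ := hs (i z)
        refine ⟨⟨u, ?_⟩, hi ?_⟩
        · rw [LinearMap.mem_ker, key, hu]
          exact (hip _).2 ⟨z, rfl⟩
        · change i (q _) = _
          rw [hq, hu]
      · intro g u hu
        have : i (q u) ∈ ℒ g := by
          rw [hq]
          exact linearCombination_mem gL hx g _ hu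
        obtain ⟨z, hz, hz'⟩ := gK.exists_lift gL i.toAddMonoidHom hig (m := q u) this
        change q u ∈ 𝒦 g
        rw [← (hi hz' : z = q u)]
        exact hz

end HasRes

end GradedResolution

/-! ### Gradings of polynomial rings and polynomial modules -/

namespace GradedResolution

open Finset Polynomial

variable {G : Type} [AddCommGroup G]
variable {A : Type} [CommRing A] {𝒜 : G → AddSubgroup A}
variable {M : Type} [AddCommGroup M] [Module A M] {ℳ : G → AddSubgroup M}
variable {N : Type} [AddCommGroup N] [Module A N] {𝒩 : G → AddSubgroup N}

theorem IsGr.shift (hM : IsGr 𝒜 ℳ) (c : G) : IsGr 𝒜 fun g => ℳ (g - c) where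
  smul_mem {g h a m} ha hm := by
    rw [add_sub_assoc]
    exact hM.smul_mem ha hm
  iSup_eq_top := by
    rw [← hM.iSup_eq_top]
    exact (Equiv.subRight c).iSup_comp (g := ℳ)
  indep s f hf h g hg := by
    have := hM.indep (s.map (Equiv.subRight c).toEmbedding) (fun g => f (g + c))
      (fun g => by simpa using hf (g + c)) (by simpa using h) (g - c) (by simpa using hg)
    simpa using this

/-- A submodule that is generated by homogeneous elements is graded. -/
theorem isGr_span (hA : IsGr 𝒜 𝒜)
    (smul_mem : ∀ {g h : G} {a : A} {m : M}, a ∈ 𝒜 g → m ∈ ℳ h → a • m ∈ ℳ (g + h))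
    (indep : ∀ (s : Finset G) (f : G → M), (∀ g, f g ∈ ℳ g) → ∑ g ∈ s, f g = 0 → ∀ g ∈ s, f g = 0)
    (S : Set M) (hS : ∀ m ∈ S, ∃ g, m ∈ ℳ g) :
    IsGr 𝒜 (fun g => (ℳ g).comap (Submodule.span A S).toAddSubgroup.subtype :
      G → AddSubgroup (Submodule.span A S)) where
  smul_mem {g h a m} ha hm := smul_mem (m := (m : M)) ha hm
  iSup_eq_top := by
    rw [eq_top_iff]
    rintro ⟨m, hm⟩ -
    -- The pieces `ℳ` are not assumed to span `M`, so the decomposition into components is produced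
    -- from the homogeneous generators.
    induction hm using Submodule.span_induction with
    | mem x hx =>
      obtain ⟨g, hg⟩ := hS x hx
      exact AddSubgroup.mem_iSup_of_mem g hg
    | zero => exact zero_mem _
    | add x y hx hy h h' => exact add_mem h h'
    | smul a x hx h =>
      obtain ⟨t, f, hf, -, e⟩ := exists_sum_of_mem_iSup h
      obtain ⟨s, b, hb, -, rfl⟩ := hA.exists_sum a
      have : (⟨(∑ g ∈ s, b g) • x, Submodule.smul_mem _ _ hx⟩ : Submodule.span A S) =
          ∑ g ∈ s, ∑ h ∈ t, b g • f h := by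
        simp_rw [← smul_sum, ← sum_smul, e]
        rfl
      rw [this]
      exact sum_mem fun g _ => sum_mem fun h _ =>
        AddSubgroup.mem_iSup_of_mem (g + h) (smul_mem (m := (f h : M)) (hb g) (hf h))
  indep s f hf h g hg := by
    have := indep s (fun g => (f g : M)) hf (by
      simpa using congrArg (Subtype.val) h) g hg
    exact Subtype.ext this

/-- Finitely generated graded modules have finitely many homogeneous generators. -/
theorem IsGr.exists_generators (hM : IsGr 𝒜 ℳ) [Module.Finite A M] :
    ∃ (ι : Type) (_ : Fintype ι) (d : ι → G) (x : ι → M), (∀ i, x i ∈ ℳ (d i)) ∧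
      Submodule.span A (Set.range x) = ⊤ := by
  obtain ⟨S, hS⟩ := (Module.Finite.fg_top : (⊤ : Submodule A M).FG)
  choose s f hf _ hs using hM.exists_sum
  refine ⟨Σ m : S, s m.1, inferInstance, fun i => i.2.1, fun i => f i.1.1 i.2.1,
    fun i => hf _ _, ?_⟩
  rw [eq_top_iff, ← hS, Submodule.span_le]
  intro m hm
  rw [← hs m]
  exact sum_mem fun g hg => Submodule.subset_span ⟨⟨⟨m, hm⟩, ⟨g, hg⟩⟩, rfl⟩

/-- The grading of `A[X]` with `X` in degree `c`. -/
def polyGr (𝒜 : G → AddSubgroup A) (c : G) (g : G) : AddSubgroup A[X] where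
  carrier := {p | ∀ i : ℕ, p.coeff i ∈ 𝒜 (g - i • c)}
  zero_mem' _ := zero_mem _
  add_mem' h h' i := by rw [coeff_add]; exact add_mem (h i) (h' i)
  neg_mem' h i := by rw [coeff_neg]; exact neg_mem (h i)

/-- The grading of the polynomial module `M[X]` with `X` in degree `c`. -/
def polyModGr (ℳ : G → AddSubgroup M) (c : G) (g : G) : AddSubgroup (PolynomialModule A M) where
  carrier := {p | ∀ i : ℕ, p.coeff i ∈ ℳ (g - i • c)}
  zero_mem' _ := zero_mem _
  add_mem' h h' i := add_mem (h i) (h' i)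
  neg_mem' h i := neg_mem (h i)

theorem isGr_polyGr (hA : IsGr 𝒜 𝒜) (c : G) : IsGr (polyGr 𝒜 c) (polyGr 𝒜 c) where
  smul_mem {g h a m} ha hm i := by
    rw [smul_eq_mul, coeff_mul]
    refine sum_mem fun x hx => ?_
    have := hA.smul_mem (ha x.1) (hm x.2)
    rwa [sub_add_sub_comm, ← add_smul, mem_antidiagonal.1 hx] at this
  iSup_eq_top := by
    rw [eq_top_iff]
    rintro p -
    induction p using Polynomial.induction_on' with
    | add p q hp hq => exact add_mem (hp) (hq)
    | monomial n a =>
      obtain ⟨s, u, hu, -, e⟩ := hA.exists_sum a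
      rw [← e, map_sum]
      refine sum_mem fun g _ => AddSubgroup.mem_iSup_of_mem (g + n • c) fun i => ?_
      rw [coeff_monomial]
      split_ifs with h
      · subst h
        simpa using hu g
      · exact zero_mem _
  indep s f hf h g hg := by
    ext i
    have := hA.indep (s.map (Equiv.subRight (i • c)).toEmbedding) (fun g => (f (g + i • c)).coeff i)
      (fun g => by simpa using hf (g + i • c) i) (by
        simpa [finsetSum_coeff] using congrArg (fun p => p.coeff i) h) (g - i • c) (by simpa using hg)
    simpa using this

theorem isGr_polyModGr (hM : IsGr 𝒜 ℳ) (c : G) :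
    IsGr (polyGr 𝒜 c) (polyModGr ℳ c : G → AddSubgroup (PolynomialModule A M)) where
  smul_mem {g h a m} ha hm i := by
    rw [PolynomialModule.smul_apply]
    refine sum_mem fun x hx => ?_
    have := hM.smul_mem (ha x.1) (hm x.2)
    rwa [sub_add_sub_comm, ← add_smul, mem_antidiagonal.1 hx] at this
  iSup_eq_top := by
    rw [eq_top_iff]
    rintro p -
    induction p using PolynomialModule.induction_linear with
    | zero => exact zero_mem _
    | add p q hp hq => exact add_mem (hp) (hq)
    | single n a =>
      obtain ⟨s, u, hu, -, e⟩ := hM.exists_sum a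
      change PolynomialModule.lsingle A n a ∈ _
      rw [← e, map_sum]
      refine sum_mem fun g _ => AddSubgroup.mem_iSup_of_mem (g + n • c) fun i => ?_
      rw [PolynomialModule.lsingle_apply]
      split_ifs with h
      · subst h
        simpa using hu g
      · exact zero_mem _
  indep s f hf h g hg := by
    ext i
    have := hM.indep (s.map (Equiv.subRight (i • c)).toEmbedding) (fun g => (f (g + i • c)).coeff i)
      (fun g => by simpa using hf (g + i • c) i) (by
        simpa using congrArg (fun p => p.coeff i) h) (g - i • c) (by simpa using hg)
    simpa using this

/-- Scalar extension from `A` to `A[X]` is exact because a polynomial relation holds exactly when it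
holds in each coefficient: the kernel of the extended cover is `K[X]`, where `K` is the kernel of
the original one. The map `F` is this identification. -/
theorem HasRes.polynomialModule (c : G) (k : ℕ) : ∀ {M : Type} [AddCommGroup M] [Module A M]
    {ℳ : G → AddSubgroup M}, HasRes 𝒜 k M ℳ →
    HasRes (polyGr 𝒜 c) k (PolynomialModule A M) (polyModGr ℳ c) := by
  induction k with
  | zero =>
    intro M _ _ ℳ h
    have : Subsingleton M := h
    exact (PolynomialModule.coeff_injective (R := A) (M := M)).subsingleton
  | succ k ih =>
    rintro M _ _ ℳ ⟨ι, _, d, x, hx, hs, hk⟩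
    have key : ∀ (u : ι → A[X]) (n : ℕ),
        (Fintype.linearCombination A[X] (fun i => PolynomialModule.single A 0 (x i)) u).coeff n =
        Fintype.linearCombination A x fun i => (u i).coeff n := by
      intro u n
      simp [Fintype.linearCombination_apply]
    refine ⟨ι, inferInstance, d, fun i => PolynomialModule.single A 0 (x i), fun i n => ?_,
      fun m => ?_, ?_⟩
    · rw [PolynomialModule.coeff_single, Finsupp.single_apply]
      split_ifs with h
      · subst h
        simpa using hx i
      · exact zero_mem _
    · induction m using PolynomialModule.induction_linear with
      | zero => exact ⟨0, map_zero _⟩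
      | add p q hp hq =>
        obtain ⟨u, rfl⟩ := hp
        obtain ⟨v, rfl⟩ := hq
        exact ⟨u + v, map_add _ _ _⟩
      | single n m =>
        obtain ⟨u, rfl⟩ := hs m
        refine ⟨fun i => monomial n (u i), ?_⟩
        ext l
        rw [key, PolynomialModule.coeff_single, Finsupp.single_apply]
        simp only [coeff_monomial]
        split_ifs with h
        · rfl
        · exact map_zero _
    · set K := LinearMap.ker (Fintype.linearCombination A x)
      let ψ : ι → PolynomialModule A K →ₗ[A] A[X] := fun i =>
        PolynomialModule.equivPolynomial.toLinearMap.comp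
          (PolynomialModule.map A ((LinearMap.proj i).comp K.subtype))
      have hψ : ∀ i f n, (ψ i f).coeff n = (f.coeff n).1 i := fun i f n => rfl
      have hψs : ∀ i (a : A[X]) f, ψ i (a • f) = a • ψ i f := by
        intro i a f
        change PolynomialModule.equivPolynomial (PolynomialModule.map A _ (a • f)) = _
        rw [PolynomialModule.map_smul, ← PolynomialModule.equivPolynomialSelf_apply_eq, map_smul]
        simp only [Algebra.algebraMap_self, Polynomial.map_id]
        rfl
      let F : PolynomialModule A K →+
          LinearMap.ker (Fintype.linearCombination A[X] fun i => PolynomialModule.single A 0 (x i)) :=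
        { toFun := fun f => ⟨fun i => ψ i f, by
            rw [LinearMap.mem_ker]
            ext n
            rw [key]
            exact (f.coeff n).2⟩
          map_zero' := by ext i; simp
          map_add' := fun f g => by ext i; simp }
      have hF : Function.Bijective F := by
        constructor
        · intro f g h
          ext n : 2
          apply Subtype.ext
          funext i
          rw [← hψ, ← hψ]
          exact congrArg (fun p => p.coeff n) (congrFun (congrArg Subtype.val h) i)
        · intro u
          have hu : ∀ n, (fun i => (u.1 i).coeff n) ∈ K := fun n => by
            rw [LinearMap.mem_ker, ← key, LinearMap.mem_ker.1 u.2]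
            rfl
          classical
          refine ⟨.ofCoeff A (Finsupp.onFinset (univ.biUnion fun i => (u.1 i).support)
            (fun n => ⟨_, hu n⟩) fun n hn => ?_), ?_⟩
          · by_contra h
            simp only [mem_biUnion, mem_univ, true_and, not_exists, mem_support_iff, not_not] at h
            exact hn (Subtype.ext (funext h))
          · apply Subtype.ext
            funext i
            ext n
            exact hψ i _ n
      refine (ih hk).congr (RingEquiv.refl _) (fun _ _ => Iff.rfl) _ (AddEquiv.ofBijective F hF)
        (fun a f => ?_) (fun g f => ?_)
      · apply Subtype.ext
        funext i
        exact hψs i a f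
      · constructor
        · intro h i n
          have := h n i
          change (ψ i f).coeff n ∈ _
          rw [hψ]
          rwa [sub_right_comm] at this
        · intro h n i
          have := h i n
          change (ψ i f).coeff n ∈ _ at this
          rw [hψ] at this
          rwa [sub_right_comm] at this

end GradedResolution

/-! ### The filtration by degree of a module over `A[X]` -/

namespace GradedResolution

open Finset Polynomial

variable {G : Type} [AddCommGroup G]

section filtration

variable {A : Type} [CommRing A] {M : Type} [AddCommGroup M] [Module A[X] M] [Module A M]
variable {ι : Type} [Fintype ι]

/-- The combinations of the elements `x i` with polynomial coefficients of degree less than `n`. -/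
def degLTSpan (A : Type) [CommRing A] [Module A[X] M] [Module A M] (x : ι → M) (n : ℕ) :
    Submodule A M :=
  Submodule.span A (Set.range fun p : Fin n × ι => (X ^ (p.1 : ℕ) : A[X]) • x p.2)

variable [IsScalarTower A A[X] M] (x : ι → M)

theorem mem_degLTSpan {n : ℕ} {m : M} : m ∈ degLTSpan A x n ↔
    ∃ u : ι → A[X], (∀ i j, n ≤ j → (u i).coeff j = 0) ∧ Fintype.linearCombination A[X] x u = m := by
  constructor
  · intro h
    induction h using Submodule.span_induction with
    | mem m h =>
      obtain ⟨⟨j, i⟩, rfl⟩ := h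
      classical
      refine ⟨Pi.single i (X ^ (j : ℕ)), fun i' l hl => ?_, by simp⟩
      rcases eq_or_ne i' i with rfl | hne
      · rw [Pi.single_eq_same, coeff_X_pow, if_neg (by omega)]
      · simp [hne]
    | zero => exact ⟨0, by simp, map_zero _⟩
    | add m m' _ _ h h' =>
      obtain ⟨u, hu, rfl⟩ := h
      obtain ⟨v, hv, rfl⟩ := h'
      exact ⟨u + v, fun i j hj => by simp [hu i j hj, hv i j hj], map_add _ _ _⟩
    | smul a m _ h =>
      obtain ⟨u, hu, rfl⟩ := h
      refine ⟨a • u, fun i j hj => by simp [hu i j hj], ?_⟩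
      rw [← algebraMap_smul A[X] a u, map_smul, algebraMap_smul]
  · rintro ⟨u, hu, rfl⟩
    rw [Fintype.linearCombination_apply]
    refine sum_mem fun i _ => ?_
    have e : u i = ∑ j ∈ range n, monomial j ((u i).coeff j) := by
      ext l
      simp only [finsetSum_coeff, coeff_monomial, Finset.sum_ite_eq', mem_range]
      split_ifs with h
      · rfl
      · exact hu i l (by omega)
    rw [e, sum_smul]
    refine sum_mem fun j hj => ?_
    rw [← C_mul_X_pow_eq_monomial, mul_smul, ← Polynomial.algebraMap_eq, algebraMap_smul]
    exact Submodule.smul_mem _ _ (Submodule.subset_span ⟨⟨⟨j, mem_range.1 hj⟩, i⟩, rfl⟩)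

theorem degLTSpan_mono {n k : ℕ} (h : n ≤ k) : degLTSpan A x n ≤ degLTSpan A x k := by
  intro m hm
  rw [mem_degLTSpan] at hm ⊢
  obtain ⟨u, hu, rfl⟩ := hm
  exact ⟨u, fun i j hj => hu i j (h.trans hj), rfl⟩

theorem X_smul_mem_degLTSpan {n : ℕ} {m : M} (h : m ∈ degLTSpan A x n) :
    (X : A[X]) • m ∈ degLTSpan A x (n + 1) := by
  rw [mem_degLTSpan] at h ⊢
  obtain ⟨u, hu, rfl⟩ := h
  refine ⟨(X : A[X]) • u, fun i j hj => ?_, map_smul _ _ _⟩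
  obtain ⟨j, rfl⟩ : ∃ k, j = k + 1 := ⟨j - 1, by omega⟩
  simpa using hu i j (by omega)

/-- The coefficients in degree `n` of the relations of degree at most `n`. -/
def leadingRelations (A : Type) [CommRing A] [Module A[X] M] (x : ι → M) (n : ℕ) :
    Submodule A (ι → A) where
  carrier := {c | ∃ u : ι → A[X], (∀ i j, n + 1 ≤ j → (u i).coeff j = 0) ∧
    (∀ i, (u i).coeff n = c i) ∧ Fintype.linearCombination A[X] x u = 0}
  zero_mem' := ⟨0, by simp, by simp, map_zero _⟩
  add_mem' := by
    rintro c d ⟨u, hu, hc, h⟩ ⟨v, hv, hd, h'⟩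
    exact ⟨u + v, fun i j hj => by simp [hu i j hj, hv i j hj], fun i => by simp [hc, hd], by
      rw [map_add, h, h', add_zero]⟩
  smul_mem' := by
    rintro a c ⟨u, hu, hc, h⟩
    exact ⟨C a • u, fun i j hj => by simp [hu i j hj], fun i => by simp [hc], by
      rw [map_smul, h, smul_zero]⟩

-- Multiplication by `X` turns a relation of degree `n` into one of degree `n + 1` with the same
-- leading coefficients.
omit [Module A M] [IsScalarTower A A[X] M] in
theorem leadingRelations_mono : Monotone (leadingRelations A x) := by
  refine monotone_nat_of_le_succ fun n => ?_
  rintro c ⟨u, hu, hc, h⟩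
  refine ⟨(X : A[X]) • u, fun i j hj => ?_, fun i => by simpa using hc i, by
    rw [map_smul, h, smul_zero]⟩
  obtain ⟨j, rfl⟩ : ∃ k, j = k + 1 := ⟨j - 1, by omega⟩
  simpa using hu i j (by omega)

/-- The chain of modules of leading coefficients stabilizes because `A` is Noetherian. If `m` is
given by coefficients `u` of degree at most `n`, and `X • m` by `v` of degree at most `n`, then `X u
- v` is a relation of degree at most `n + 1` whose leading coefficients are those of `u` in degree
`n`. By stability a relation `w` of degree at most `n` has the same leading coefficients, and `u -
w` represents `m` in lower degree. -/
theorem exists_degLTSpan_stable [IsNoetherianRing A] : ∃ n₀ : ℕ, ∀ n, n₀ ≤ n → ∀ m : M,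
    m ∈ degLTSpan A x (n + 1) → (X : A[X]) • m ∈ degLTSpan A x (n + 1) → m ∈ degLTSpan A x n := by
  obtain ⟨n₀, h₀⟩ := monotone_stabilizes_iff_noetherian.2
    (inferInstance : IsNoetherian A (ι → A)) ⟨leadingRelations A x, leadingRelations_mono x⟩
  refine ⟨n₀, fun n hn m hm hXm => ?_⟩
  rw [mem_degLTSpan] at hm hXm ⊢
  obtain ⟨u, hu, rfl⟩ := hm
  obtain ⟨v, hv, e⟩ := hXm
  have h1 : (fun i => (u i).coeff n) ∈ leadingRelations A x (n + 1) := by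
    refine ⟨(X : A[X]) • u - v, fun i j hj => ?_, fun i => ?_, by
      rw [map_sub, map_smul, e, sub_self]⟩
    · obtain ⟨j, rfl⟩ : ∃ k, j = k + 1 := ⟨j - 1, by omega⟩
      simp [hu i j (by omega), hv i (j + 1) (by omega)]
    · simp [hv i (n + 1) le_rfl]
  have h2 : leadingRelations A x (n + 1) = leadingRelations A x n :=
    (h₀ (n + 1) (by omega)).symm.trans (h₀ n hn)
  rw [h2] at h1
  obtain ⟨w, hw, hwn, hw0⟩ := h1
  refine ⟨u - w, fun i j hj => ?_, by rw [map_sub, hw0, sub_zero]⟩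
  rcases hj.eq_or_lt with rfl | hj
  · simp [hwn]
  · simp [hu i j hj, hw i j hj]

/-- The stability property removes one power of `X` at a time. It needs the a priori bound on the
degree of the next lower power multiple, which `hm` provides. -/
theorem mem_degLTSpan_of_X_pow_smul {n₀ : ℕ} (h₀ : ∀ n, n₀ ≤ n → ∀ m : M,
    m ∈ degLTSpan A x (n + 1) → (X : A[X]) • m ∈ degLTSpan A x (n + 1) → m ∈ degLTSpan A x n)
    {m : M} (hm : m ∈ degLTSpan A x (n₀ + 1)) (e : ℕ)
    (h : (X ^ (e + 1) : A[X]) • m ∈ degLTSpan A x (n₀ + 1 + e)) : m ∈ degLTSpan A x n₀ := by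
  induction e with
  | zero => exact h₀ n₀ le_rfl m hm (by simpa using h)
  | succ e ih =>
    apply ih
    rw [add_right_comm]
    refine h₀ _ (by omega) _ ?_ ?_
    · have : ∀ k : ℕ, (X ^ k : A[X]) • m ∈ degLTSpan A x (n₀ + 1 + k) := by
        intro k
        induction k with
        | zero => simpa using hm
        | succ k ih =>
          rw [pow_succ', mul_smul]
          exact X_smul_mem_degLTSpan x ih
      have := this (e + 1)
      rwa [show n₀ + 1 + (e + 1) = n₀ + e + 1 + 1 by ring] at this
    · rw [smul_smul, ← pow_succ']
      rwa [show n₀ + 1 + (e + 1) = n₀ + e + 1 + 1 by ring] at h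

variable (A) in
/-- Multiplication by `X` on the filtration by degree. -/
noncomputable def degLTSpanX (n : ℕ) : degLTSpan A x n →ₗ[A] degLTSpan A x (n + 1) where
  toFun m := ⟨(X : A[X]) • (m : M), X_smul_mem_degLTSpan x m.2⟩
  map_add' m m' := Subtype.ext (smul_add _ _ _)
  map_smul' a m := Subtype.ext (by
    change (X : A[X]) • (a • (m : M)) = a • ((X : A[X]) • (m : M))
    rw [← algebraMap_smul A[X] a, ← algebraMap_smul A[X] a, smul_comm])

variable (A) in
/-- The map `X ⊗ 1 - 1 ⊗ X` on the filtration by degree. -/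
noncomputable def degLTSpanDiff (n : ℕ) : PolynomialModule A (degLTSpan A x n) →ₗ[A[X]]
    PolynomialModule A (degLTSpan A x (n + 1)) where
  toFun f := (X : A[X]) • PolynomialModule.map A
    (Submodule.inclusion (degLTSpan_mono x n.le_succ)) f - PolynomialModule.map A (degLTSpanX A x n) f
  map_add' f g := by
    simp only [map_add, smul_add]
    abel
  map_smul' a f := by
    simp only [PolynomialModule.map_smul, Algebra.algebraMap_self, Polynomial.map_id, smul_sub,
      RingHom.id_apply]
    rw [smul_comm]

variable (A) in
/-- The evaluation map `A[X] ⊗ D → M`. -/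
noncomputable def degLTSpanEval (n : ℕ) : PolynomialModule A (degLTSpan A x n) →ₗ[A[X]] M where
  toFun f := PolynomialModule.eval (X : A[X])
    (PolynomialModule.map A[X] (degLTSpan A x n).subtype f)
  map_add' f g := by simp
  map_smul' a f := by
    rw [PolynomialModule.map_smul, PolynomialModule.eval_smul]
    rw [Polynomial.algebraMap_eq, eval_map, eval₂_C_X]
    rfl

omit [Fintype ι] in
theorem degLTSpanEval_single (n i : ℕ) (m : degLTSpan A x n) :
    degLTSpanEval A x n (PolynomialModule.single A i m) = (X ^ i : A[X]) • (m : M) := by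
  simp [degLTSpanEval]

omit [Fintype ι] in
theorem degLTSpanEval_apply (n : ℕ) (f) : degLTSpanEval A x n f =
    f.coeff.sum fun i m => (X ^ i : A[X]) • (m : M) := by
  change ((f.coeff.mapRange (fun m : degLTSpan A x n => (m : M)) rfl).sum fun i m => (X ^ i : A[X]) • m) = _
  rw [Finsupp.sum_mapRange_index]
  exact fun i => smul_zero _

theorem degLTSpanDiff_single (n i : ℕ) (m : degLTSpan A x n) :
    degLTSpanDiff A x n (PolynomialModule.single A i m) =
      PolynomialModule.single A (i + 1) (Submodule.inclusion (degLTSpan_mono x n.le_succ) m) -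
        PolynomialModule.single A i (degLTSpanX A x n m) := by
  simp only [degLTSpanDiff, LinearMap.coe_mk, AddHom.coe_mk, PolynomialModule.map_single]
  rw [← monomial_one_one_eq_X, PolynomialModule.monomial_smul_single, one_smul]
  simp only [Nat.add_comm 1 i]

theorem degLTSpanEval_diff (n : ℕ) (f) :
    degLTSpanEval A x (n + 1) (degLTSpanDiff A x n f) = 0 := by
  induction f using PolynomialModule.induction_linear with
  | zero => simp
  | add f g hf hg => rw [map_add, map_add, hf, hg, add_zero]
  | single i m =>
    rw [degLTSpanDiff_single, map_sub, degLTSpanEval_single, degLTSpanEval_single, pow_succ,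
      mul_smul, sub_eq_zero]
    rfl

theorem coeff_degLTSpanDiff_succ (n : ℕ) (f) (i : ℕ) :
    (((degLTSpanDiff A x n f).coeff (i + 1) : degLTSpan A x (n + 1)) : M) =
      (f.coeff i : M) - (X : A[X]) • (f.coeff (i + 1) : M) := by
  have e : degLTSpanDiff A x n f = monomial 1 (1 : A) • PolynomialModule.map A
      (Submodule.inclusion (degLTSpan_mono x n.le_succ)) f -
        PolynomialModule.map A (degLTSpanX A x n) f := by
    rw [monomial_one_one_eq_X]
    rfl
  have e' := congrArg (fun p => p.coeff (i + 1)) e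
  change (degLTSpanDiff A x n f).coeff (i + 1) =
    (monomial 1 (1 : A) • PolynomialModule.map A _ f).coeff (i + 1) -
      (PolynomialModule.map A _ f).coeff (i + 1) at e'
  rw [PolynomialModule.monomial_smul_apply, if_pos (by omega), one_smul, Nat.add_sub_cancel] at e'
  rw [e']
  rfl

theorem coeff_degLTSpanDiff_zero (n : ℕ) (f) :
    (((degLTSpanDiff A x n f).coeff 0 : degLTSpan A x (n + 1)) : M) =
      - ((X : A[X]) • (f.coeff 0 : M)) := by
  have e : degLTSpanDiff A x n f = monomial 1 (1 : A) • PolynomialModule.map A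
      (Submodule.inclusion (degLTSpan_mono x n.le_succ)) f -
        PolynomialModule.map A (degLTSpanX A x n) f := by
    rw [monomial_one_one_eq_X]
    rfl
  have e' := congrArg (fun p => p.coeff 0) e
  change (degLTSpanDiff A x n f).coeff 0 =
    (monomial 1 (1 : A) • PolynomialModule.map A _ f).coeff 0 -
      (PolynomialModule.map A _ f).coeff 0 at e'
  rw [PolynomialModule.monomial_smul_apply, if_neg (by omega), zero_sub] at e'
  rw [e']
  rfl

/-- In the kernel, the coefficient of index `i` is `X` times the one of index `i + 1`, so the
coefficients vanish from the top downwards. -/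
theorem degLTSpanDiff_injective (n : ℕ) : Function.Injective (degLTSpanDiff A x n) := by
  rw [injective_iff_map_eq_zero]
  intro f hf
  have h : ∀ i, f.coeff (i + 1) = 0 → f.coeff i = 0 := fun i hi => by
    have := coeff_degLTSpanDiff_succ x n f i
    rw [hf, hi] at this
    simpa using this.symm
  obtain ⟨b, hb⟩ : ∃ b, ∀ i, b ≤ i → f.coeff i = 0 := by
    refine ⟨f.coeff.support.sup id + 1, fun i hi => ?_⟩
    by_contra hne
    have := Finset.le_sup (f := id) (Finsupp.mem_support_iff.2 hne)
    simp at this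
    omega
  ext i
  congr 1
  change f.coeff i = 0
  rcases le_or_gt b i with h' | h'
  · exact hb i h'
  · exact Nat.decreasingInduction (motive := fun k _ => f.coeff k = 0) (fun k _ hk => h k hk)
      (hb b le_rfl) h'.le

/-- A division algorithm in the degree of `f`. If `f` evaluates to zero, the top coefficient times
its power of `X` is minus the sum of the lower terms, hence has small degree; by stability the top
coefficient already lies in the smaller step `degLTSpan A x n₀`. Subtracting the image of the
corresponding monomial under `X ⊗ 1 - 1 ⊗ X` lowers the degree of `f`. -/
theorem degLTSpan_exact {n₀ : ℕ} (h₀ : ∀ n, n₀ ≤ n → ∀ m : M,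
    m ∈ degLTSpan A x (n + 1) → (X : A[X]) • m ∈ degLTSpan A x (n + 1) → m ∈ degLTSpan A x n) :
    Function.Exact (degLTSpanDiff A x n₀) (degLTSpanEval A x (n₀ + 1)) := by
  have key : ∀ (e : ℕ) (f : PolynomialModule A (degLTSpan A x (n₀ + 1))),
      (∀ i, e < i → f.coeff i = 0) → degLTSpanEval A x (n₀ + 1) f = 0 →
      ∃ h, degLTSpanDiff A x n₀ h = f := by
    intro e
    induction e with
    | zero =>
      intro f hf h
      have : f = PolynomialModule.single A 0 (f.coeff 0) := by
        apply PolynomialModule.ext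
        ext i
        rcases i with _ | i
        · simp
        · rw [hf (i + 1) (by omega)]; simp
      rw [this, degLTSpanEval_single, pow_zero, one_smul] at h
      have h0 : f.coeff 0 = 0 := Subtype.ext h
      rw [this, h0]
      exact ⟨0, by simp⟩
    | succ e ih =>
      intro f hf h
      have hsum : degLTSpanEval A x (n₀ + 1) f =
          ∑ i ∈ range (e + 2), (X ^ i : A[X]) • ((f.coeff i : degLTSpan A x (n₀ + 1)) : M) := by
        have : f = ∑ i ∈ range (e + 2), PolynomialModule.single A i (f.coeff i) := by
          apply PolynomialModule.ext
          ext i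
          simp only [PolynomialModule.coeff_sum, PolynomialModule.coeff_single, Finsupp.coe_finsetSum,
            Finset.sum_apply, Finsupp.single_apply, Finset.sum_ite_eq', mem_range]
          split_ifs with hi
          · rfl
          · rw [hf i (by omega)]
        conv_lhs => rw [this, map_sum]
        simp only [degLTSpanEval_single]
      rw [h, sum_range_succ, eq_comm, add_comm, ← eq_neg_iff_add_eq_zero] at hsum
      have hm : ((f.coeff (e + 1) : degLTSpan A x (n₀ + 1)) : M) ∈ degLTSpan A x n₀ := by
        refine mem_degLTSpan_of_X_pow_smul x h₀ (f.coeff (e + 1)).2 e ?_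
        rw [hsum]
        refine neg_mem (sum_mem fun i hi => ?_)
        have : ∀ k : ℕ, (X ^ k : A[X]) • ((f.coeff i : degLTSpan A x (n₀ + 1)) : M) ∈
            degLTSpan A x (n₀ + 1 + k) := by
          intro k
          induction k with
          | zero => simp
          | succ k ih =>
            rw [pow_succ', mul_smul]
            exact X_smul_mem_degLTSpan x ih
        exact degLTSpan_mono x (by have := mem_range.1 hi; omega) (this i)
      obtain ⟨h', hh'⟩ := ih (f - degLTSpanDiff A x n₀ (PolynomialModule.single A e ⟨_, hm⟩))
        (fun i hi => by
          rw [degLTSpanDiff_single]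
          change f.coeff i - ((PolynomialModule.single A (e + 1) _).coeff i -
            (PolynomialModule.single A e _).coeff i) = 0
          rw [PolynomialModule.coeff_single, PolynomialModule.coeff_single]
          rcases eq_or_ne i (e + 1) with rfl | hne
          · simp
            exact sub_eq_zero.2 (Subtype.ext rfl)
          · rw [hf i (by omega)]
            simp [hne.symm, show e ≠ i by omega])
        (by rw [map_sub, h, degLTSpanEval_diff, sub_zero])
      exact ⟨h' + PolynomialModule.single A e ⟨_, hm⟩, by rw [map_add, hh', sub_add_cancel]⟩
  intro f
  constructor
  · intro h
    obtain ⟨b, hb⟩ : ∃ b, ∀ i, b < i → f.coeff i = 0 := by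
      refine ⟨f.coeff.support.sup id, fun i hi => ?_⟩
      by_contra hne
      have := Finset.le_sup (f := id) (Finsupp.mem_support_iff.2 hne)
      simp at this
      omega
    obtain ⟨h', hh'⟩ := key b f hb h
    exact ⟨h', hh'⟩
  · rintro ⟨g, rfl⟩
    exact degLTSpanEval_diff x n₀ g

end filtration

end GradedResolution

/-! ### The graded syzygy theorem -/

namespace GradedResolution

open Finset

variable {G : Type} [AddCommGroup G]

section polynomial

open Polynomial

variable {A : Type} [CommRing A] {𝒜 : G → AddSubgroup A}

/-- If all finitely generated graded modules over a Noetherian graded ring `A` have finite graded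
free resolutions, then so do those over `A[X]`. -/
theorem exists_hasRes_polynomial [IsNoetherianRing A] (hA : IsGr 𝒜 𝒜) (one_mem : (1 : A) ∈ 𝒜 0)
    (H : ∀ (N : Type) [AddCommGroup N] [Module A N] (𝒩 : G → AddSubgroup N), IsGr 𝒜 𝒩 →
      Module.Finite A N → ∃ k, HasRes 𝒜 k N 𝒩) (c : G)
    {M : Type} [AddCommGroup M] [Module A[X] M] {ℳ : G → AddSubgroup M}
    (hM : IsGr (polyGr 𝒜 c) ℳ) [Module.Finite A[X] M] :
    ∃ k, HasRes (polyGr 𝒜 c) k M ℳ := by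
  obtain ⟨ι, _, d, x, hx, hs⟩ := hM.exists_generators
  let _ : Module A M := Module.compHom M (C : A →+* A[X])
  have : IsScalarTower A A[X] M := ⟨fun a p m => by
    rw [Polynomial.smul_eq_C_mul, mul_smul]
    rfl⟩
  obtain ⟨n, hn⟩ := exists_degLTSpan_stable (A := A) x
  have hC : ∀ {g a}, a ∈ 𝒜 g → C a ∈ polyGr 𝒜 c g := fun {g a} ha i => by
    rw [coeff_C]
    split_ifs with h
    · subst h; simpa using ha
    · exact zero_mem _
  have hsmul : ∀ {g h : G} {a : A} {m : M}, a ∈ 𝒜 g → m ∈ ℳ h → a • m ∈ ℳ (g + h) :=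
    fun ha hm => hM.smul_mem (hC ha) hm
  have h1 : ∀ i (k : ℕ), (X ^ k : A[X]) • x i ∈ ℳ (d i + k • c) := by
    intro i k
    rw [add_comm]
    refine hM.smul_mem (fun l => ?_) (hx i)
    rw [coeff_X_pow]
    split_ifs with h
    · subst h; simpa using one_mem
    · exact zero_mem _
  have hD : ∀ k, IsGr 𝒜 (fun g => (ℳ g).comap (degLTSpan A x k).toAddSubgroup.subtype :
      G → AddSubgroup (degLTSpan A x k)) := fun k =>
    isGr_span hA hsmul hM.indep _ (by
      rintro _ ⟨⟨j, i⟩, rfl⟩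
      exact ⟨_, h1 i j⟩)
  have hF : ∀ k, Module.Finite A (degLTSpan A x k) := fun k =>
    Module.Finite.span_of_finite A (Set.finite_range _)
  -- The first step of the filtration carries the grading shifted by `c`, the degree of `X`, so that
  -- `X ⊗ 1 - 1 ⊗ X` preserves degrees.
  obtain ⟨k₁, hk₁⟩ := H _ _ ((hD n).shift c) (hF n)
  obtain ⟨k₂, hk₂⟩ := H _ _ (hD (n + 1)) (hF (n + 1))
  -- With `D_k` the steps of the filtration, `0 → D_n[X] → D_{n+1}[X] → M → 0` is exact, and the two
  -- left terms are extended from graded modules over `A`.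
  refine ⟨max k₁ k₂ + 1, HasRes.cokernel (isGr_polyGr hA c)
    (isGr_polyModGr ((hD n).shift c) c) (isGr_polyModGr (hD (n + 1)) c) hM
    (degLTSpanDiff A x n) (degLTSpanEval A x (n + 1)) (degLTSpanDiff_injective x n)
    (degLTSpan_exact x hn) ?_ ?_ ?_ ((hk₁.polynomialModule c k₁).mono (le_max_left _ _))
    ((hk₂.polynomialModule c k₂).mono (le_max_right _ _))⟩
  · rw [← LinearMap.range_eq_top, eq_top_iff, ← hs, Submodule.span_le]
    rintro _ ⟨i, rfl⟩
    refine ⟨PolynomialModule.single A 0 ⟨x i, Submodule.subset_span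
      ⟨⟨⟨0, n.succ_pos⟩, i⟩, by simp⟩⟩, ?_⟩
    rw [degLTSpanEval_single]
    simp
  · intro g f hf i
    change ((degLTSpanDiff A x n f).coeff i : M) ∈ ℳ (g - i • c)
    have hf' : ∀ i, ((f.coeff i : degLTSpan A x n) : M) ∈ ℳ (g - i • c - c) := hf
    have hXf : ∀ i, (X : A[X]) • ((f.coeff i : degLTSpan A x n) : M) ∈ ℳ (g - i • c) := fun i => by
      have := hM.smul_mem (g := c) (a := X) (fun l => by
        rw [coeff_X]
        split_ifs with h
        · subst h; simpa using one_mem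
        · exact zero_mem _) (hf' i)
      rwa [add_sub_cancel] at this
    rcases i with _ | i
    · rw [coeff_degLTSpanDiff_zero]
      exact neg_mem (hXf 0)
    · rw [coeff_degLTSpanDiff_succ]
      refine sub_mem ?_ (hXf _)
      have := hf' i
      rwa [sub_sub, ← succ_nsmul] at this
  · intro g f hf
    have hf' : ∀ i, ((f.coeff i : degLTSpan A x (n + 1)) : M) ∈ ℳ (g - i • c) := hf
    rw [degLTSpanEval_apply]
    refine sum_mem fun i _ => ?_
    have := hM.smul_mem (g := i • c) (a := X ^ i) (fun l => by
        rw [coeff_X_pow]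
        split_ifs with h
        · subst h; simpa using one_mem
        · exact zero_mem _) (hf' i)
    rwa [add_sub_cancel] at this

end polynomial

/-- The base case: finite-dimensional graded vector spaces are graded free. -/
theorem exists_hasRes_field {K : Type} [Field K] {𝒜 : G → AddSubgroup K} {M : Type} [AddCommGroup M]
    [Module K M] {ℳ : G → AddSubgroup M} (hM : IsGr 𝒜 ℳ) [Module.Finite K M] :
    ∃ k, HasRes 𝒜 k M ℳ := by
  obtain ⟨ι, _, d, x, hx, hs⟩ := hM.exists_generators
  -- A basis is selected among the homogeneous generators, so there are no relations and length `1`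
  -- suffices.
  obtain ⟨b, hb, hbs, hbl⟩ := exists_linearIndependent K (Set.range x)
  have hfin : Finite b := (Set.finite_range x).subset hb
  let _ := Fintype.ofFinite b
  choose j hj using fun m : b => hb m.2
  refine ⟨1, b, inferInstance, fun m => d (j m), fun m => m, fun m => by
    have := hx (j m)
    rwa [hj] at this, ?_, ?_⟩
  · rw [← LinearMap.range_eq_top, Fintype.range_linearCombination, Subtype.range_coe, hbs, hs]
  · refine ⟨fun u v => ?_⟩
    have h0 : ∀ u : LinearMap.ker (Fintype.linearCombination K fun m : b => (m : M)), u = 0 := by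
      intro u
      apply Subtype.ext
      funext m
      have := u.2
      rw [LinearMap.mem_ker, Fintype.linearCombination_apply] at this
      exact Fintype.linearIndependent_iff.1 hbl u.1 this m
    rw [h0 u, h0 v]

theorem exists_hasRes_of_ringEquiv {A B : Type} [CommRing A] [CommRing B] {𝒜 : G → AddSubgroup A}
    {ℬ : G → AddSubgroup B} (e : A ≃+* B) (he : ∀ g a, a ∈ 𝒜 g ↔ e a ∈ ℬ g)
    (H : ∀ (N : Type) [AddCommGroup N] [Module B N] (𝒩 : G → AddSubgroup N), IsGr ℬ 𝒩 →
      Module.Finite B N → ∃ k, HasRes ℬ k N 𝒩)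
    {M : Type} [AddCommGroup M] [Module A M] {ℳ : G → AddSubgroup M} (hM : IsGr 𝒜 ℳ)
    [Module.Finite A M] : ∃ k, HasRes 𝒜 k M ℳ := by
  let _ : Module B M := Module.compHom M (e.symm : B →+* A)
  have hs : ∀ (b : B) (m : M), b • m = e.symm b • m := fun _ _ => rfl
  have hs' : ∀ (a : A) (m : M), e a • m = a • m := fun a m => by rw [hs, e.symm_apply_apply]
  have hB : IsGr ℬ ℳ := ⟨fun {g h b m} hb hm => hM.smul_mem ((he _ _).2 (by simpa using hb)) hm,
    hM.iSup_eq_top, hM.indep⟩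
  have : Module.Finite B M := by
    let f : M →ₛₗ[(e : A →+* B)] M :=
      { toFun := id
        map_add' := fun _ _ => rfl
        map_smul' := fun a m => (hs' a m).symm }
    have : RingHomSurjective (e : A →+* B) := ⟨e.surjective⟩
    exact Module.Finite.of_surjective f Function.surjective_id
  obtain ⟨k, hk⟩ := H M ℳ hB this
  exact ⟨k, hk.congr e.symm (fun g b => by rw [he]; simp) k (AddEquiv.refl M)
    (fun b m => rfl) fun g m => Iff.rfl⟩

section mvPolynomial

open MvPolynomial

variable {σ : Type}

/-- The grading of a polynomial ring by weights of the variables. -/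
noncomputable def mvGr (w : σ → G) (g : G) : AddSubgroup (MvPolynomial σ ℂ) :=
  (weightedHomogeneousSubmodule ℂ w g).toAddSubgroup

theorem mem_mvGr {w : σ → G} {g : G} {p : MvPolynomial σ ℂ} :
    p ∈ mvGr w g ↔ IsWeightedHomogeneous w p g := Iff.rfl

theorem isGr_mvGr (w : σ → G) : IsGr (mvGr w) (mvGr w) where
  smul_mem ha hm := IsWeightedHomogeneous.mul ha hm
  iSup_eq_top := by
    rw [eq_top_iff]
    rintro p -
    rw [p.as_sum]
    exact sum_mem fun m _ => AddSubgroup.mem_iSup_of_mem (Finsupp.weight w m)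
      (isWeightedHomogeneous_monomial w m _ rfl)
  indep s f hf h g hg := by
    ext m
    rw [coeff_zero]
    by_contra hne
    have hgm : Finsupp.weight w m = g := hf g hne
    have := congrArg (coeff m) h
    rw [coeff_sum, coeff_zero, sum_eq_single_of_mem g hg] at this
    · exact hne this
    · intro g' _ hg'
      by_contra hne'
      exact hg' ((hf g' hne').symm.trans hgm)

/-- Hilbert's syzygy theorem for graded modules, with arbitrary weights of the variables. -/
theorem exists_hasRes_mvPolynomial (n : ℕ) : ∀ (w : Fin n → G) (M : Type) [AddCommGroup M]
    [Module (MvPolynomial (Fin n) ℂ) M] (ℳ : G → AddSubgroup M), IsGr (mvGr w) ℳ →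
    Module.Finite (MvPolynomial (Fin n) ℂ) M → ∃ k, HasRes (mvGr w) k M ℳ := by
  induction n with
  | zero =>
    intro w M _ _ ℳ hM _
    let e := isEmptyRingEquiv ℂ (Fin 0)
    exact exists_hasRes_of_ringEquiv (ℬ := fun g => (mvGr w g).comap e.symm.toAddMonoidHom) e
      (fun g a => by simp) (fun N _ _ 𝒩 hN _ => exists_hasRes_field hN) hM
  | succ n ih =>
    intro w M _ _ ℳ hM _
    refine exists_hasRes_of_ringEquiv (ℬ := polyGr (mvGr fun i => w i.succ) (w 0))
      (finSuccEquiv ℂ n).toRingEquiv (fun g p => ?_) (fun N _ _ 𝒩 hN _ =>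
        exists_hasRes_polynomial (isGr_mvGr _) (isWeightedHomogeneous_one _ _) (ih _) (w 0) hN) hM
    -- The weight of a monomial splits into the part of the variable `0`, which plays the role of
    -- `X`, and the part of the remaining variables; this matches the grading `polyGr`.
    have hw : ∀ (i : ℕ) (m : Fin n →₀ ℕ), Finsupp.weight w (m.cons i) =
        i • w 0 + Finsupp.weight (fun i => w i.succ) m := by
      intro i m
      simp [Finsupp.weight_apply, Finsupp.sum_fintype, Fin.sum_univ_succ]
    constructor
    · intro hp i m hm
      change coeff m (Polynomial.coeff (finSuccEquiv ℂ n p) i) ≠ 0 at hm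
      rw [finSuccEquiv_coeff_coeff] at hm
      have := hp hm
      rw [hw] at this
      exact eq_sub_of_add_eq' this
    · intro hp m hm
      have h := hp (m 0) (d := m.tail) (by
        change coeff m.tail (Polynomial.coeff (finSuccEquiv ℂ n p) (m 0)) ≠ 0
        rwa [finSuccEquiv_coeff_coeff, Finsupp.cons_tail])
      rw [← Finsupp.cons_tail m, hw, h, add_sub_cancel]

end mvPolynomial

end GradedResolution

/-! ### Triangulated classes closed under extensions -/

namespace CategoryTheory.ObjectProperty

open Limits Preadditive ZeroObject Pretriangulated Triangulated

variable {C : Type*} [Category* C] [HasZeroObject C] [HasShift C ℤ]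
  [Preadditive C] [∀ n : ℤ, (shiftFunctor C n).Additive] [Pretriangulated C]

/-- If there is no non-zero morphism from `P` to `Q`, extensions of an object of `P` by an object of
`Q` split. -/
theorem extensionProduct_swap_le {P Q : ObjectProperty C} [Q.IsStableUnderShift ℤ]
    (h : P ≤ Q.leftOrthogonal) : extensionProduct Q P ≤ extensionProduct P Q := by
  rintro X ⟨Y, Z, f, g, k, hT, hY, hZ⟩
  -- The connecting morphism goes from an object of `P` to a shift of an object of `Q`.
  have hk : k = 0 := h Z hZ k (Q.le_shift (1 : ℤ) _ hY)
  obtain ⟨e, -, -⟩ := exists_iso_binaryBiproduct_of_distTriang _ hT hk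
  refine (extensionProduct P Q).prop_of_iso ((biprod.braiding Z Y).trans e.symm) ?_
  exact ⟨Z, Y, _, _, _, binaryBiproductTriangle_distinguished Z Y, hZ, hY⟩

/-- Write `*` for `extensionProduct`. An extension of two objects of `P * Q` lies in `P * Q * P *
Q`. By orthogonality the inner `Q * P` is contained in `P * Q`, and then `P * P` and `Q * Q`
collapse to `P` and `Q`. This permits checking membership in `P * Q` on generators of a triangulated
class. -/
theorem isTriangulated_extensionProduct [IsTriangulated C] {P Q : ObjectProperty C}
    [P.IsTriangulated] [Q.IsTriangulated] [P.IsClosedUnderIsomorphisms]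
    [Q.IsClosedUnderIsomorphisms] (h : P ≤ Q.leftOrthogonal) :
    (extensionProduct P Q).IsTriangulated where
  exists_zero := by
    obtain ⟨Z, hZ, hP⟩ := P.exists_prop_of_containsZero
    exact ⟨Z, hZ, le_extensionProduct_left Q _ hP⟩
  ext₂' T hT h₁ h₃ := by
    rw [isoClosure_eq_self]
    have h2 : extensionProduct (extensionProduct P Q) (extensionProduct P Q) T.obj₂ :=
      ⟨_, _, _, _, _, hT, h₁, h₃⟩
    rw [extensionProduct_assoc, ← extensionProduct_assoc Q P Q] at h2
    have h3 := monotone_extensionProduct_right P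
      (monotone_extensionProduct_left Q (extensionProduct_swap_le h)) _ h2
    rw [extensionProduct_assoc P Q Q, ← extensionProduct_assoc P P] at h3
    have h4 := monotone_extensionProduct_left _
      (extensionProduct_le_of_isTriangulatedClosed₂ le_rfl le_rfl) _ h3
    exact monotone_extensionProduct_right P
      (extensionProduct_le_of_isTriangulatedClosed₂ le_rfl le_rfl) _ h4

/-- The smallest strictly full triangulated subcategory that contains `P`. -/
def triangulatedHull (P : ObjectProperty C) : ObjectProperty C := fun X =>
  ∀ Q : ObjectProperty C, Q.IsTriangulated → Q.IsClosedUnderIsomorphisms → P ≤ Q → Q X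

theorem le_triangulatedHull (P : ObjectProperty C) : P ≤ P.triangulatedHull :=
  fun X hX _ _ _ h => h X hX

theorem triangulatedHull_le {P Q : ObjectProperty C} [hQ : Q.IsTriangulated]
    [hQ' : Q.IsClosedUnderIsomorphisms] (h : P ≤ Q) : P.triangulatedHull ≤ Q :=
  fun _ hX => hX Q hQ hQ' h

instance (P : ObjectProperty C) : P.triangulatedHull.IsClosedUnderIsomorphisms where
  of_iso e hX Q hQ hQ' h := Q.prop_of_iso e (hX Q hQ hQ' h)

instance (P : ObjectProperty C) : P.triangulatedHull.IsTriangulated where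
  exists_zero := ⟨0, isZero_zero C, fun Q _ _ _ => by
    obtain ⟨Z, hZ, hQ⟩ := Q.exists_prop_of_containsZero
    exact Q.prop_of_iso (hZ.iso (isZero_zero C)) hQ⟩
  isStableUnderShiftBy n := ⟨fun X hX Q hQ hQ' h => Q.le_shift n _ (hX Q hQ hQ' h)⟩
  ext₂' T hT h₁ h₃ := by
    rw [isoClosure_eq_self]
    exact fun Q hQ hQ' h => Q.ext_of_isTriangulatedClosed₂ T hT (h₁ Q hQ hQ' h) (h₃ Q hQ hQ' h)

theorem triangulatedHull_mono {P Q : ObjectProperty C} (h : P ≤ Q) :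
    P.triangulatedHull ≤ Q.triangulatedHull :=
  triangulatedHull_le (h.trans (le_triangulatedHull Q))

end CategoryTheory.ObjectProperty

/-! ### Twists of the structure sheaf, characters of the torus, and free bundles -/

namespace GaugedQuotient

open CategoryTheory MvPolynomial GradedResolution

/-- The category of twists of the structure sheaf: `f : X ⟶ Y` is a homogeneous polynomial whose
degree is the difference of those of `Y` and `X`. -/
structure Twist {G : Type} {n : ℕ} (w : Fin n → G) where
  deg : G

namespace Twist

variable {G : Type} [AddCommGroup G] {n : ℕ} {w : Fin n → G}

noncomputable instance : Category (Twist w) where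
  Hom X Y := mvGr w (Y.deg - X.deg)
  id X := ⟨1, by rw [sub_self]; exact isWeightedHomogeneous_one _ _⟩
  comp {X Y Z} f g := ⟨f.1 * g.1, by
    have := IsWeightedHomogeneous.mul f.2 g.2
    rwa [sub_add_sub_cancel'] at this⟩
  id_comp f := Subtype.ext (one_mul _)
  comp_id f := Subtype.ext (mul_one _)
  assoc f g h := Subtype.ext (mul_assoc _ _ _)

/-- The polynomial that underlies a morphism of twists. -/
def poly {X Y : Twist w} (f : X ⟶ Y) : MvPolynomial (Fin n) ℂ :=
  (show mvGr w (Y.deg - X.deg) from f).1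

/-- The morphism of twists given by a homogeneous polynomial. -/
def ofPoly {X Y : Twist w} (f : MvPolynomial (Fin n) ℂ)
    (hf : IsWeightedHomogeneous w f (Y.deg - X.deg)) : X ⟶ Y :=
  (⟨f, hf⟩ : mvGr w (Y.deg - X.deg))

theorem poly_mem {X Y : Twist w} (f : X ⟶ Y) :
    IsWeightedHomogeneous w (poly f) (Y.deg - X.deg) :=
  (show mvGr w (Y.deg - X.deg) from f).2

@[ext]
theorem hom_ext {X Y : Twist w} {f g : X ⟶ Y} (h : poly f = poly g) : f = g := Subtype.ext h

@[simp]
theorem poly_id (X : Twist w) : poly (𝟙 X) = 1 := rfl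

@[simp]
theorem poly_comp {X Y Z : Twist w} (f : X ⟶ Y) (g : Y ⟶ Z) : poly (f ≫ g) = poly f * poly g := rfl

noncomputable instance : Preadditive (Twist w) where
  homGroup X Y := inferInstanceAs (AddCommGroup (mvGr w (Y.deg - X.deg)))
  add_comp _ _ _ _ _ _ := Subtype.ext (add_mul _ _ _)
  comp_add _ _ _ _ _ _ := Subtype.ext (mul_add _ _ _)

@[simp]
theorem poly_add {X Y : Twist w} (f g : X ⟶ Y) : poly (f + g) = poly f + poly g := rfl

@[simp]
theorem poly_zero {X Y : Twist w} : poly (0 : X ⟶ Y) = 0 := rfl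

@[simp]
theorem poly_neg {X Y : Twist w} (f : X ⟶ Y) : poly (-f) = -poly f := rfl

/-- `poly` as an additive map. -/
def polyHom (X Y : Twist w) : (X ⟶ Y) →+ MvPolynomial (Fin n) ℂ where
  toFun := poly
  map_zero' := rfl
  map_add' _ _ := rfl

theorem poly_sum {ι : Type*} {X Y : Twist w} (s : Finset ι) (f : ι → (X ⟶ Y)) :
    poly (∑ i ∈ s, f i) = ∑ i ∈ s, poly (f i) := map_sum (polyHom X Y) f s

end Twist

section character

variable {n : ℕ} (a r : Fin n → ℤ) {R : Type} [CommRing R]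

/-- The pairs of weights of the coordinates. -/
abbrev weights (i : Fin n) : ℤ × ℤ := (a i, r i)

/-- The character of weight `g` of `C*_G × C*_R`. -/
def chi (l s : Rˣ) (g : ℤ × ℤ) : Rˣ := l ^ g.1 * s ^ g.2

theorem chi_add (l s : Rˣ) (g h : ℤ × ℤ) : chi l s (g + h) = chi l s g * chi l s h := by
  simp only [chi, Prod.fst_add, Prod.snd_add, zpow_add]
  rw [mul_mul_mul_comm]

@[simp]
theorem chi_zero (l s : Rˣ) : chi l s 0 = 1 := by simp [chi]

theorem chi_neg (l s : Rˣ) (g : ℤ × ℤ) : chi l s (-g) = (chi l s g)⁻¹ :=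
  eq_inv_of_mul_eq_one_left (by rw [← chi_add, neg_add_cancel, chi_zero])

theorem chi_nsmul (l s : Rˣ) (m : ℕ) (g : ℤ × ℤ) : chi l s (m • g) = chi l s g ^ m := by
  induction m with
  | zero => simp
  | succ m ih => rw [succ_nsmul, chi_add, ih, pow_succ]

@[simp]
theorem chi_one_one (g : ℤ × ℤ) : chi (1 : Rˣ) 1 g = 1 := by simp [chi]

theorem chi_mul_mul (l s l' s' : Rˣ) (g : ℤ × ℤ) :
    chi (l * l') (s * s') g = chi l s g * chi l' s' g := by
  simp only [chi, mul_zpow]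
  rw [mul_mul_mul_comm]

theorem chi_map {R' : Type} [CommRing R'] [Algebra ℂ R] [Algebra ℂ R'] (φ : R →ₐ[ℂ] R')
    (l s : Rˣ) (g : ℤ × ℤ) :
    ((chi (Units.map (φ : R →* R') l) (Units.map (φ : R →* R') s) g : R'ˣ) : R') =
      φ (chi l s g : Rˣ) := by
  simp only [chi, Units.val_mul, val_map_zpow, map_mul]

variable {a r}

theorem aeval_act [Algebra ℂ R] (l s : Rˣ) (v : Fin n → R) {f : MvPolynomial (Fin n) ℂ}
    {g : ℤ × ℤ} (hf : IsWeightedHomogeneous (weights a r) f g) :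
    aeval (act a r l s v) f = (chi l s g : R) * aeval v f := by
  have key : ∀ m : Fin n →₀ ℕ, m.prod (fun i e => act a r l s v i ^ e) =
      (chi l s (Finsupp.weight (weights a r) m) : R) * m.prod fun i e => v i ^ e := by
    intro m
    induction m using Finsupp.induction_linear with
    | zero => simp
    | add m m' h h' =>
      rw [Finsupp.prod_add_index' (by simp) (by intros; rw [pow_add]), h, h', map_add, chi_add,
        Finsupp.prod_add_index' (by simp) (by intros; rw [pow_add]), Units.val_mul]
      ring
    | single i e =>
      rw [Finsupp.prod_single_index (by simp), Finsupp.prod_single_index (by simp),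
        Finsupp.weight_single, chi_nsmul, act, mul_pow]
      rfl
  rw [f.as_sum, map_sum, map_sum, Finset.mul_sum]
  refine Finset.sum_congr rfl fun m hm => ?_
  rw [aeval_monomial, aeval_monomial, key, hf (mem_support_iff.mp hm)]
  ring

end character

namespace EqBundle

variable {n : ℕ} {a r : Fin n → ℤ}

/-- The direct sum of the line bundles `O(k)[j]`, for the values `(k, j)` of `d`. -/
def free {ι : Type} [Fintype ι] (d : ι → ℤ × ℤ) : EqBundle a r where
  M p := ι → p.R
  map {p q} h :=
    { toFun := fun x i => (chi h.l h.s (d i) : q.R) * h.φ (x i)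
      map_add' := fun x y => by funext i; simp [mul_add]
      map_smul' := fun c x => by
        funext i
        simp only [Pi.smul_apply, smul_eq_mul, map_mul, RingHom.coe_coe]
        ring }
  map_id p m := by
    funext i
    change (chi (1 : p.Rˣ) 1 (d i) : p.R) * m i = m i
    simp
  map_comp {p q u} h k m := by
    funext i
    change (chi (k.l * Units.map (k.φ : q.R →* u.R) h.l) (k.s * Units.map (k.φ : q.R →* u.R) h.s)
      (d i) : u.R) * k.φ (h.φ (m i)) = (chi k.l k.s (d i) : u.R) *
        k.φ ((chi h.l h.s (d i) : q.R) * h.φ (m i))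
    rw [chi_mul_mul, Units.val_mul, chi_map, map_mul, mul_assoc]
  isBaseChange {p q} h := by
    classical
    intro Q _ _ g
    refine ⟨∑ i, (LinearMap.proj i).smulRight
      ((((chi h.l h.s (d i))⁻¹ : q.Rˣ) : q.R) • g (Pi.single i 1)), ?_, ?_⟩
    · intro m
      have e : g m = ∑ i, h.φ (m i) • g (Pi.single i 1) := by
        conv_lhs => rw [pi_eq_sum_univ' m, map_sum]
        exact Finset.sum_congr rfl fun i _ => by
          rw [g.map_smulₛₗ]; rfl
      rw [LinearMap.sum_apply, e]
      refine Finset.sum_congr rfl fun i _ => ?_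
      rw [LinearMap.smulRight_apply, LinearMap.proj_apply, smul_smul]
      congr 1
      simp only [LinearMap.coe_mk, AddHom.coe_mk]
      rw [mul_right_comm, Units.mul_inv, one_mul]
    · intro g' hg'
      refine LinearMap.pi_ext' fun i => LinearMap.ext_ring ?_
      rw [LinearMap.comp_apply, LinearMap.comp_apply, LinearMap.sum_apply,
        Finset.sum_eq_single i, LinearMap.smulRight_apply, LinearMap.proj_apply,
        LinearMap.single_apply, Pi.single_eq_same, one_smul, ← hg', ← map_smul]
      · congr 1
        funext j
        by_cases hj : j = i
        · subst hj; simp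
        · simp [hj]
      · intro j _ hj
        simp [hj]
      · simp

/-- The character `chi` is the product of the character in `lineBundle` and the one in `shift`;
apart from this, only an enumeration of `ι` is needed. -/
theorem isWindowSum_free {ι : Type} [Fintype ι] (d : ι → ℤ × ℤ) {t e : ℤ}
    (h : ∀ i, t ≤ (d i).1 ∧ (d i).1 ≤ t + e - 1) :
    (free d : EqBundle a r).IsWindowSum t e := by
  let σ := Fintype.equivFin ι
  have key : ∀ {p q : Pt a} (f : PtHom r p q) (g : ℤ × ℤ) (x : p.R),
      ((lineBundle a r g.1).shift g.2).map f x = (chi f.l f.s g : q.R) * f.φ x := by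
    intro p q f g x
    change ((f.s ^ g.2 : q.Rˣ) : q.R) * (((f.l ^ g.1 : q.Rˣ) : q.R) * f.φ x) = _
    rw [chi, Units.val_mul]
    ring
  refine ⟨Fintype.card ι, fun i => (d (σ.symm i)).1, fun i => (d (σ.symm i)).2,
    fun i => h _, ⟨⟨⟨fun p => LinearMap.funLeft p.R p.R σ.symm, fun f m => ?_⟩,
      ⟨fun p => LinearMap.funLeft p.R p.R σ, fun f m => ?_⟩, ?_, ?_⟩⟩⟩
  · funext i
    exact (key f (d (σ.symm i)) (m (σ.symm i))).symm
  · funext i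
    refine (key f (d (σ.symm (σ i))) (m (σ i))).trans ?_
    rw [σ.symm_apply_apply]
    rfl
  · apply Hom.ext; funext p; apply LinearMap.ext; intro m; funext i
    exact congrArg m (σ.symm_apply_apply i)
  · apply Hom.ext; funext p; apply LinearMap.ext; intro m; funext i
    exact congrArg m (σ.apply_symm_apply i)

end EqBundle

end GaugedQuotient

/-! ### Evaluation of complexes of twists at points -/

namespace GaugedQuotient

open CategoryTheory MvPolynomial GradedResolution

section evaluation

variable {G : Type} [AddCommGroup G] {n : ℕ} {w : Fin n → G} {R : Type} [CommRing R] [Algebra ℂ R]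

/-- The value at a point of `ℂⁿ` of a matrix of homogeneous polynomials. -/
noncomputable def evalMat (v : Fin n → R) {P Q : Mat_ (Twist w)} (f : P ⟶ Q) :
    (P.ι → R) →ₗ[R] (Q.ι → R) where
  toFun x j := ∑ i, aeval v (Twist.poly (f i j)) * x i
  map_add' x y := by
    funext j
    simp only [Pi.add_apply, mul_add, Finset.sum_add_distrib]
  map_smul' c x := by
    funext j
    simp only [Pi.smul_apply, smul_eq_mul, Finset.mul_sum, RingHom.id_apply]
    exact Finset.sum_congr rfl fun i _ => by ring

theorem evalMat_apply (v : Fin n → R) {P Q : Mat_ (Twist w)} (f : P ⟶ Q) (x : P.ι → R) (j : Q.ι) :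
    evalMat v f x j = ∑ i, aeval v (Twist.poly (f i j)) * x i := rfl

theorem evalMat_id (v : Fin n → R) (P : Mat_ (Twist w)) : evalMat v (𝟙 P) = LinearMap.id := by
  apply LinearMap.ext
  intro x
  funext j
  rw [evalMat_apply, Finset.sum_eq_single j]
  · simp
  · intro i _ hi
    rw [Mat_.id_apply_of_ne _ _ _ hi]
    simp
  · simp

theorem evalMat_comp (v : Fin n → R) {P Q T : Mat_ (Twist w)} (f : P ⟶ Q) (g : Q ⟶ T) :
    evalMat v (f ≫ g) = (evalMat v g).comp (evalMat v f) := by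
  apply LinearMap.ext
  intro x
  funext j
  simp only [LinearMap.comp_apply, evalMat_apply, Mat_.comp_apply, Twist.poly_sum, map_sum,
    Twist.poly_comp, map_mul, Finset.sum_mul, Finset.mul_sum]
  rw [Finset.sum_comm]
  exact Finset.sum_congr rfl fun i _ => Finset.sum_congr rfl fun k _ => by ring

theorem evalMat_add (v : Fin n → R) {P Q : Mat_ (Twist w)} (f g : P ⟶ Q) :
    evalMat v (f + g) = evalMat v f + evalMat v g := by
  apply LinearMap.ext
  intro x
  funext j
  rw [LinearMap.add_apply, Pi.add_apply]
  simp only [evalMat_apply, Mat_.add_apply, Twist.poly_add, map_add, add_mul,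
    Finset.sum_add_distrib]

theorem evalMat_zero (v : Fin n → R) (P Q : Mat_ (Twist w)) :
    evalMat v (0 : P ⟶ Q) = 0 := by
  have := evalMat_add v (0 : P ⟶ Q) 0
  rwa [add_zero, left_eq_add] at this

/-- Evaluation at a point, as a functor. -/
noncomputable def evalFunctor (w : Fin n → G) (v : Fin n → R) : Mat_ (Twist w) ⥤ ModuleCat.{0} R where
  obj P := ModuleCat.of R (P.ι → R)
  map f := ModuleCat.ofHom (evalMat v f)
  map_id P := by rw [evalMat_id]; rfl
  map_comp f g := by rw [evalMat_comp]; rfl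

instance (w : Fin n → G) (v : Fin n → R) : (evalFunctor w v).Additive where
  map_add {_ _ f g} := by
    change ModuleCat.ofHom (evalMat v (f + g)) = _
    rw [evalMat_add]; rfl

theorem evalMat_map {R' : Type} [CommRing R'] [Algebra ℂ R'] (φ : R →ₐ[ℂ] R') (v : Fin n → R)
    {P Q : Mat_ (Twist w)} (f : P ⟶ Q) (x : P.ι → R) :
    evalMat (fun i => φ (v i)) f (fun i => φ (x i)) = fun j => φ (evalMat v f x j) := by
  funext j
  simp only [evalMat_apply, map_sum, map_mul]
  refine Finset.sum_congr rfl fun i _ => ?_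
  congr 1
  exact (comp_aeval_apply v φ _).symm

end evaluation

variable {n : ℕ} {a r : Fin n → ℤ}

/-- The degree of each matrix entry is the difference of the degrees of its target and source, so
its character accounts for the difference of the two transition factors. -/
theorem evalMat_act {R : Type} [CommRing R] [Algebra ℂ R] (l s : Rˣ) (v : Fin n → R)
    {P Q : Mat_ (Twist (weights a r))} (f : P ⟶ Q) (x : P.ι → R) :
    evalMat (act a r l s v) f (fun i => (chi l s (P.X i).deg : R) * x i) =
      fun j => (chi l s (Q.X j).deg : R) * evalMat v f x j := by
  funext j
  simp only [evalMat_apply, Finset.mul_sum]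
  refine Finset.sum_congr rfl fun i _ => ?_
  rw [aeval_act l s v (Twist.poly_mem (f i j))]
  have : chi l s (Q.X j).deg = chi l s ((Q.X j).deg - (P.X i).deg) * chi l s (P.X i).deg := by
    rw [← chi_add, sub_add_cancel]
  rw [this, Units.val_mul]
  ring

/-- The equivariant bundle of a formal direct sum of twists. -/
noncomputable def toBundle (a r : Fin n → ℤ) : Mat_ (Twist (weights a r)) ⥤ EqBundle a r where
  obj P := EqBundle.free fun i => (P.X i).deg
  map f :=
    { app := fun p => evalMat p.v f
      naturality := fun {p q} h m => by
        change evalMat q.v f (fun i => (chi h.l h.s _ : q.R) * h.φ (m i)) =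
          fun j => (chi h.l h.s _ : q.R) * h.φ (evalMat p.v f m j)
        rw [← h.act_eq, evalMat_act]
        exact funext fun j => congrArg _ (congrFun (evalMat_map h.φ p.v f m) j) }
  map_id P := EqBundle.Hom.ext (funext fun p => evalMat_id _ _)
  map_comp f g := EqBundle.Hom.ext (funext fun p => evalMat_comp _ _ _)

instance : (toBundle a r).PreservesZeroMorphisms where
  map_zero P Q := EqBundle.Hom.ext (funext fun _ => evalMat_zero _ P Q)

section acyclic

variable {G : Type} [AddCommGroup G] {w : Fin n → G}

instance : Limits.HasBinaryBiproducts (Mat_ (Twist w)) :=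
  Limits.hasBinaryBiproducts_of_finite_biproducts _

/-- The homotopy category of complexes of formal direct sums of twists. -/
abbrev HoTwist (w : Fin n → G) := HomotopyCategory (Mat_ (Twist w)) (ComplexShape.up ℤ)

/-- The complexes that are exact at a given point. -/
def acyclicAt {R : Type} [CommRing R] [Algebra ℂ R] (w : Fin n → G) (v : Fin n → R) :
    ObjectProperty (HoTwist w) :=
  (HomotopyCategory.subcategoryAcyclic (ModuleCat.{0} R)).inverseImage
    ((evalFunctor w v).mapHomotopyCategory (ComplexShape.up ℤ))

instance {R : Type} [CommRing R] [Algebra ℂ R] (v : Fin n → R) :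
    (acyclicAt w v).IsTriangulated := by
  unfold acyclicAt; infer_instance

instance {R : Type} [CommRing R] [Algebra ℂ R] (v : Fin n → R) :
    (acyclicAt w v).IsClosedUnderIsomorphisms := by
  unfold acyclicAt; infer_instance

/-- This is the passage between the triangulated class in the homotopy category, used for formal
arguments, and exactness of matrices on elements. -/
theorem acyclicAt_quotient_iff {R : Type} [CommRing R] [Algebra ℂ R] (v : Fin n → R)
    (K : CochainComplex (Mat_ (Twist w)) ℤ) :
    acyclicAt w v ((HomotopyCategory.quotient _ _).obj K) ↔
      ∀ i j k : ℤ, i + 1 = j → j + 1 = k →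
        Function.Exact (evalMat v (K.d i j)) (evalMat v (K.d j k)) := by
  have h1 : acyclicAt w v ((HomotopyCategory.quotient _ _).obj K) ↔
      HomotopyCategory.subcategoryAcyclic (ModuleCat.{0} R) ((HomotopyCategory.quotient _ _).obj
        (((evalFunctor w v).mapHomologicalComplex _).obj K)) := Iff.rfl
  rw [h1, HomotopyCategory.quotient_obj_mem_subcategoryAcyclic_iff_exactAt]
  have h2 : ∀ i j k : ℤ, i + 1 = j → j + 1 = k →
      ((((evalFunctor w v).mapHomologicalComplex _).obj K).ExactAt j ↔
        Function.Exact (evalMat v (K.d i j)) (evalMat v (K.d j k))) := by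
    intro i j k hi hj
    rw [HomologicalComplex.exactAt_iff' _ i j k (by simp [← hi]) (by simp [hj])]
    exact ShortComplex.ShortExact.moduleCat_exact_iff_function_exact _
  constructor
  · intro h i j k hi hj
    exact (h2 i j k hi hj).1 (h j)
  · intro h j
    exact (h2 (j - 1) j (j + 1) (by ring) rfl).2 (h _ _ _ (by ring) rfl)

end acyclic

end GaugedQuotient

/-! ### Koszul complexes as iterated mapping cones -/

namespace GaugedQuotient

open CategoryTheory MvPolynomial GradedResolution Pretriangulated CochainComplex

section koszul

variable {G : Type} [AddCommGroup G] {n : ℕ} {w : Fin n → G}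

/-- Twisting by minus the weight of a variable. -/
@[simps]
def twistBy (w : Fin n → G) (i : Fin n) : Twist w ⥤ Twist w where
  obj X := ⟨X.deg - w i⟩
  map f := Twist.ofPoly (Twist.poly f) (by
    have := Twist.poly_mem f
    rwa [← sub_sub_sub_cancel_right _ _ (w i)] at this)
  map_id _ := Twist.hom_ext rfl
  map_comp _ _ := Twist.hom_ext rfl

/-- Multiplication by a variable. -/
@[simps]
noncomputable def mulX (w : Fin n → G) (i : Fin n) : twistBy w i ⟶ 𝟭 (Twist w) where
  app X := Twist.ofPoly (MvPolynomial.X i) (by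
    have := isWeightedHomogeneous_X ℂ w i
    rwa [← sub_sub_cancel X.deg (w i)] at this)
  naturality _ _ f := Twist.hom_ext (mul_comm _ _)

/-- The mapping cone of multiplication by a variable. -/
@[simps]
noncomputable def coneX (F : Twist w ⥤ CochainComplex (Mat_ (Twist w)) ℤ) (i : Fin n) :
    Twist w ⥤ CochainComplex (Mat_ (Twist w)) ℤ where
  obj X := mappingCone (F.map ((mulX w i).app X))
  map {X Y} f := mappingCone.map _ _ (F.map ((twistBy w i).map f)) (F.map f) (by
    rw [← F.map_comp, ← F.map_comp]
    exact congrArg F.map ((mulX w i).naturality f).symm)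
  map_id X := by
    convert mappingCone.map_id (F.map ((mulX w i).app X))
    · rw [CategoryTheory.Functor.map_id, CategoryTheory.Functor.map_id]
    · exact F.map_id X
  map_comp f g := by
    rw [← mappingCone.map_comp]
    congr 1 <;> simp only [Functor.map_comp]

/-- The Koszul complexes of lists of variables. -/
noncomputable def koszul (w : Fin n → G) :
    List (Fin n) → (Twist w ⥤ CochainComplex (Mat_ (Twist w)) ℤ)
  | [] => Mat_.embedding (Twist w) ⋙ CochainComplex.singleFunctor _ 0
  | i :: I => coneX (koszul w I) i

/-- The Koszul complexes, in the homotopy category. -/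
noncomputable def koszulHo (w : Fin n → G) (I : List (Fin n)) : Twist w ⥤ HoTwist w :=
  koszul w I ⋙ HomotopyCategory.quotient _ _

variable (w) in
/-- Twisting by minus the weight of a variable. -/
abbrev twistObj (i : Fin n) (X : Twist w) : Twist w := (twistBy w i).obj X

/-- Multiplication by a variable. -/
noncomputable abbrev twistMulX (i : Fin n) (X : Twist w) : twistObj w i X ⟶ X := (mulX w i).app X

theorem twistMulX_naturality (i : Fin n) {X Y : Twist w} (f : X ⟶ Y) :
    (twistBy w i).map f ≫ twistMulX i Y = twistMulX i X ≫ f := (mulX w i).naturality f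

/-- Multiplication by a variable on a Koszul complex. -/
noncomputable def koszulX (i : Fin n) (I : List (Fin n)) (X : Twist w) :
    (koszulHo w I).obj (twistObj w i X) ⟶ (koszulHo w I).obj X :=
  (koszulHo w I).map (twistMulX i X)

/-- The map from one Koszul complex to the next. -/
noncomputable def koszulInr (i : Fin n) (I : List (Fin n)) (X : Twist w) :
    (koszulHo w I).obj X ⟶ (koszulHo w (i :: I)).obj X :=
  (mappingCone.triangleh ((koszul w I).map (twistMulX i X))).mor₂

/-- The connecting map of Koszul complexes. -/
noncomputable def koszulDelta (i : Fin n) (I : List (Fin n)) (X : Twist w) :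
    (koszulHo w (i :: I)).obj X ⟶ ((koszulHo w I).obj (twistObj w i X))⟦(1 : ℤ)⟧ :=
  (mappingCone.triangleh ((koszul w I).map (twistMulX i X))).mor₃

/-- All properties of Koszul complexes below are obtained by induction along these triangles,
without writing out the complexes. -/
theorem koszulTriangle_distinguished (i : Fin n) (I : List (Fin n)) (X : Twist w) :
    Triangle.mk (koszulX i I X) (koszulInr i I X) (koszulDelta i I X) ∈ distTriang (HoTwist w) :=
  HomotopyCategory.mappingCone_triangleh_distinguished ((koszul w I).map (twistMulX i X))

/-- The morphism of triangles of Koszul complexes given by a morphism of twists. -/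
noncomputable def koszulTriangleMap (i : Fin n) (I : List (Fin n)) {X Y : Twist w} (f : X ⟶ Y) :
    Triangle.mk (koszulX i I X) (koszulInr i I X) (koszulDelta i I X) ⟶
      Triangle.mk (koszulX i I Y) (koszulInr i I Y) (koszulDelta i I Y) :=
  (HomotopyCategory.quotient _ _).mapTriangle.map (mappingCone.triangleMap
    ((koszul w I).map (twistMulX i X)) ((koszul w I).map (twistMulX i Y))
    ((koszul w I).map ((twistBy w i).map f)) ((koszul w I).map f) (by
    rw [← Functor.map_comp, ← Functor.map_comp, twistMulX_naturality]))

theorem koszulInr_naturality (i : Fin n) (I : List (Fin n)) {X Y : Twist w} (f : X ⟶ Y) :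
    (koszulHo w I).map f ≫ koszulInr i I Y = koszulInr i I X ≫ (koszulHo w (i :: I)).map f :=
  (koszulTriangleMap i I f).comm₂.symm

theorem koszulDelta_naturality (i : Fin n) (I : List (Fin n)) {X Y : Twist w} (f : X ⟶ Y) :
    (koszulHo w (i :: I)).map f ≫ koszulDelta i I Y =
      koszulDelta i I X ≫ ((koszulHo w I).map ((twistBy w i).map f))⟦(1 : ℤ)⟧' :=
  (koszulTriangleMap i I f).comm₃.symm

theorem koszulX_comp_koszulInr (i : Fin n) (I : List (Fin n)) (X : Twist w) :
    koszulX i I X ≫ koszulInr i I X = 0 :=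
  comp_distTriang_mor_zero₁₂ _ (koszulTriangle_distinguished i I X)

theorem koszulDelta_comp_shift_koszulX (i : Fin n) (I : List (Fin n)) (X : Twist w) :
    koszulDelta i I X ≫ (koszulX i I X)⟦(1 : ℤ)⟧' = 0 :=
  comp_distTriang_mor_zero₃₁ _ (koszulTriangle_distinguished i I X)

section exactness

variable {i : Fin n} {I : List (Fin n)} {X : Twist w} {A : HoTwist w}

theorem exists_eq_comp_koszulX (f : A ⟶ (koszulHo w I).obj X) (h : f ≫ koszulInr i I X = 0) :
    ∃ g, f = g ≫ koszulX i I X :=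
  Triangle.coyoneda_exact₂ _ (koszulTriangle_distinguished i I X) f h

theorem exists_eq_comp_koszulInr (f : A ⟶ (koszulHo w (i :: I)).obj X)
    (h : f ≫ koszulDelta i I X = 0) : ∃ g, f = g ≫ koszulInr i I X :=
  Triangle.coyoneda_exact₃ _ (koszulTriangle_distinguished i I X) f h

theorem exists_eq_koszulDelta_comp (f : (koszulHo w (i :: I)).obj X ⟶ A)
    (h : koszulInr i I X ≫ f = 0) : ∃ g, f = koszulDelta i I X ≫ g :=
  Triangle.yoneda_exact₃ _ (koszulTriangle_distinguished i I X) f h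

theorem exists_eq_shift_koszulX_comp (f : ((koszulHo w I).obj (twistObj w i X))⟦(1 : ℤ)⟧ ⟶ A)
    (h : koszulDelta i I X ≫ f = 0) : ∃ g, f = (koszulX i I X)⟦(1 : ℤ)⟧' ≫ g := by
  obtain ⟨g, hg⟩ := Triangle.yoneda_exact₃ _
    (rot_of_distTriang _ (koszulTriangle_distinguished i I X)) f h
  -- The rotated triangle has the first morphism with a minus sign, which is moved to `g`.
  refine ⟨-g, hg.trans ?_⟩
  exact (Preadditive.neg_comp _ _).trans (Preadditive.comp_neg _ _).symm

end exactness

end koszul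

end GaugedQuotient

/-! ### Morphisms from twists to Koszul complexes -/

namespace GaugedQuotient

open CategoryTheory MvPolynomial GradedResolution Pretriangulated CochainComplex

section orthogonality

variable {G : Type} [AddCommGroup G] {n : ℕ} {w : Fin n → G}

/-- A twist, as a complex in degree `0`. -/
noncomputable abbrev lineHo (w : Fin n → G) : Twist w ⥤ HoTwist w := koszulHo w []

instance : (lineHo w).Full :=
  inferInstanceAs ((Mat_.embedding (Twist w) ⋙ CochainComplex.singleFunctor _ 0) ⋙
    HomotopyCategory.quotient _ _).Full

instance : (lineHo w).Additive :=
  inferInstanceAs ((Mat_.embedding (Twist w) ⋙ CochainComplex.singleFunctor _ 0) ⋙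
    HomotopyCategory.quotient _ _).Additive

/-- Between complexes concentrated in degree `0` every homotopy contributes zero, so a
null-homotopic map is zero. -/
theorem lineHo_map_eq_zero {X Y : Twist w} {f : X ⟶ Y} (h : (lineHo w).map f = 0) : f = 0 := by
  let φ := (CochainComplex.singleFunctor (Mat_ (Twist w)) 0).map ((Mat_.embedding (Twist w)).map f)
  have h0 : (HomotopyCategory.quotient _ _).map φ = (HomotopyCategory.quotient _ _).map 0 := by
    rw [Functor.map_zero]; exact h
  have h1 := (HomotopyCategory.homotopyOfEq _ _ h0).comm 0
  have h2 : φ = 0 := by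
    apply HomologicalComplex.from_single_hom_ext
    rw [h1]
    simp [dNext, prevD]
    rfl
  apply (Mat_.embedding (Twist w)).map_injective
  apply (CochainComplex.singleFunctor (Mat_ (Twist w)) 0).map_injective
  rw [Functor.map_zero, Functor.map_zero]
  exact h2

/-- The two complexes sit in different degrees, so in each degree the source or the target of a
chain map is zero. -/
theorem eq_zero_of_shift_lineHo {X Y : Twist w} {m : ℤ} (hm : m ≠ 0)
    (f : ((lineHo w).obj X)⟦m⟧ ⟶ (lineHo w).obj Y) : f = 0 := by
  let KX := (CochainComplex.singleFunctor (Mat_ (Twist w)) 0).obj ((Mat_.embedding (Twist w)).obj X)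
  let e : (HomotopyCategory.quotient _ _).obj (KX⟦m⟧) ≅ ((lineHo w).obj X)⟦m⟧ :=
    ((HomotopyCategory.quotient _ (ComplexShape.up ℤ)).commShiftIso m).app KX
  obtain ⟨φ, hφ⟩ := (HomotopyCategory.quotient _ _).map_surjective (e.hom ≫ f)
  have : φ = 0 := by
    ext j : 1
    by_cases hj : j = 0
    · apply Limits.IsZero.eq_of_src
      exact HomologicalComplex.isZero_single_obj_X (ComplexShape.up ℤ) 0 _ (j + m) (by lia)
    · apply Limits.IsZero.eq_of_tgt
      exact HomologicalComplex.isZero_single_obj_X _ _ _ _ hj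
  rw [this, Functor.map_zero] at hφ
  exact (cancel_epi e.hom).mp (hφ.symm.trans Limits.comp_zero.symm)

theorem eq_zero_of_lineHo_shift {X Y : Twist w} {m : ℤ} (hm : m ≠ 0)
    (f : (lineHo w).obj X ⟶ ((lineHo w).obj Y)⟦m⟧) : f = 0 := by
  apply (CategoryTheory.shiftFunctor _ (-m)).map_injective
  rw [Functor.map_zero, ← cancel_mono ((shiftShiftNeg ((lineHo w).obj Y) m).hom), Limits.zero_comp]
  exact eq_zero_of_shift_lineHo (neg_ne_zero.mpr hm) _

/-- The ideal generated by the variables of a list. -/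
noncomputable abbrev varIdeal (I : List (Fin n)) : Ideal (MvPolynomial (Fin n) ℂ) :=
  Ideal.span (X '' {i | i ∈ I})

/-- The variables form a regular sequence. In terms of monomials: another factor `X i` does not
affect divisibility by a variable of the list, because `i` is not in it. -/
theorem mem_varIdeal_of_mul_X_mem {I : List (Fin n)} {i : Fin n} (hi : i ∉ I)
    {f : MvPolynomial (Fin n) ℂ} (h : f * X i ∈ varIdeal I) : f ∈ varIdeal I := by
  rw [mem_ideal_span_X_image] at h ⊢
  intro m hm
  obtain ⟨j, hj, hne⟩ := h (m + Finsupp.single i 1) (by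
    rw [mem_support_iff, coeff_mul_X]
    exact mem_support_iff.mp hm)
  refine ⟨j, hj, ?_⟩
  have hij : i ≠ j := by rintro rfl; exact hi hj
  simpa [hij] using hne

/-- Division of monomials by `X i` respects weights. The monomials of the remainder are not
divisible by `X i`, hence are divisible by one of the other variables. -/
theorem exists_sub_mul_X_mem_varIdeal {I : List (Fin n)} {i : Fin n} {f : MvPolynomial (Fin n) ℂ}
    {g : G} (hf : IsWeightedHomogeneous w f g) (h : f ∈ varIdeal (i :: I)) :
    ∃ v, IsWeightedHomogeneous w v (g - w i) ∧ f - v * X i ∈ varIdeal I := by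
  refine ⟨f.divMonomial (Finsupp.single i 1), ?_, ?_⟩
  · intro m hm
    rw [coeff_divMonomial] at hm
    have := hf hm
    rw [map_add, Finsupp.weight_single, one_nsmul] at this
    rw [← this, add_sub_cancel_left]
  · rw [mem_ideal_span_X_image] at h ⊢
    intro m hm
    have h1 : f - f.divMonomial (Finsupp.single i 1) * X i =
        f.modMonomial (Finsupp.single i 1) := by
      rw [mul_comm, sub_eq_iff_eq_add', divMonomial_add_modMonomial_single]
    rw [h1, mem_support_iff] at hm
    by_cases hle : Finsupp.single i 1 ≤ m
    · exact absurd (coeff_modMonomial_of_le _ hle) hm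
    · rw [coeff_modMonomial_of_not_le _ hle] at hm
      obtain ⟨j, hj, hne⟩ := h m (mem_support_iff.mpr hm)
      refine ⟨j, ?_, hne⟩
      rcases List.mem_cons.mp hj with rfl | hj
      · rw [Finsupp.single_le_iff] at hle
        lia
      · exact hj

theorem varIdeal_le_cons (i : Fin n) (I : List (Fin n)) : varIdeal I ≤ varIdeal (i :: I) :=
  Ideal.span_mono (Set.image_mono fun _ h => List.mem_cons_of_mem i h)

theorem X_mem_varIdeal_cons (i : Fin n) (I : List (Fin n)) :
    (X i : MvPolynomial (Fin n) ℂ) ∈ varIdeal (i :: I) :=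
  Ideal.subset_span ⟨i, List.mem_cons_self, rfl⟩

/-- The inclusion of the last term of the Koszul complex. -/
noncomputable def koszulTop : ∀ (I : List (Fin n)) (X : Twist w),
    (lineHo w).obj X ⟶ (koszulHo w I).obj X
  | [], _ => 𝟙 _
  | i :: I, X => koszulTop I X ≫ koszulInr i I X

theorem koszulTop_naturality (I : List (Fin n)) {X Y : Twist w} (f : X ⟶ Y) :
    (lineHo w).map f ≫ koszulTop I Y = koszulTop I X ≫ (koszulHo w I).map f := by
  induction I with
  | nil => exact (Category.comp_id _).trans (Category.id_comp _).symm
  | cons i I ih =>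
    rw [koszulTop, koszulTop, ← Category.assoc, ih, Category.assoc, koszulInr_naturality,
      Category.assoc]

/-- A morphism from a shift to a shift by `1` is a shift. -/
theorem exists_eq_shift_map {C : Type*} [Category* C] [HasShift C ℤ] {A B : C} {m : ℤ}
    (f : A⟦m⟧ ⟶ B⟦(1 : ℤ)⟧) :
    ∃ g : A⟦m - 1⟧ ⟶ B, f = ((shiftFunctorAdd' C (m - 1) 1 m (by ring)).app A).hom ≫ g⟦(1 : ℤ)⟧' := by
  obtain ⟨g, hg⟩ := (CategoryTheory.shiftFunctor C (1 : ℤ)).map_surjective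
    (((shiftFunctorAdd' C (m - 1) 1 m (by ring)).app A).inv ≫ f)
  exact ⟨g, by rw [hg, Iso.hom_inv_id_assoc]⟩

/-- The morphisms from a twist to a Koszul complex. -/
theorem lineHo_koszulHo (I : List (Fin n)) (hI : I.Nodup) :
    (∀ (X Y : Twist w) (m : ℤ), m ≠ 0 → ∀ f : ((lineHo w).obj X)⟦m⟧ ⟶ (koszulHo w I).obj Y, f = 0) ∧
    (∀ (X Y : Twist w) (f : (lineHo w).obj X ⟶ (koszulHo w I).obj Y),
      ∃ u : X ⟶ Y, f = (lineHo w).map u ≫ koszulTop I Y) ∧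
    (∀ (X Y : Twist w) (u : X ⟶ Y),
      (lineHo w).map u ≫ koszulTop I Y = 0 ↔ Twist.poly u ∈ varIdeal I) := by
  -- The claim is that the morphisms from shifts of a twist to the Koszul complex are concentrated
  -- in shift `0`, where they are a graded component of `S` modulo the variables of `I`. The
  -- induction is the long exact sequence of the Koszul triangle together with the regularity of the
  -- next variable.
  induction I with
  | nil =>
    refine ⟨fun X Y m hm f => eq_zero_of_shift_lineHo hm f, fun X Y f => ?_, fun X Y u => ?_⟩
    · obtain ⟨u, rfl⟩ := (lineHo w).map_surjective f
      exact ⟨u, (Category.comp_id _).symm⟩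
    · have h1 : koszulTop [] Y = 𝟙 ((lineHo w).obj Y) := rfl
      rw [h1, Category.comp_id]
      have h2 : varIdeal (n := n) [] = ⊥ := by simp [varIdeal]
      rw [h2, Ideal.mem_bot]
      constructor
      · intro h
        rw [lineHo_map_eq_zero h, Twist.poly_zero]
      · intro h
        rw [show u = 0 from Twist.hom_ext h, Functor.map_zero]
  | cons i I ih =>
    obtain ⟨h0, h1, h2⟩ := ih hI.of_cons
    have hiI : i ∉ I := (List.nodup_cons.mp hI).1
    have hnat : ∀ (X Y : Twist w) (v : X ⟶ twistObj w i Y),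
        ((lineHo w).map v ≫ koszulTop I _) ≫ koszulX i I Y =
          (lineHo w).map (v ≫ twistMulX i Y) ≫ koszulTop I Y := by
      intro X Y v
      rw [Category.assoc, koszulX, ← koszulTop_naturality, ← Category.assoc, ← Functor.map_comp]
    have hsplit : ∀ (X Y : Twist w) (u : X ⟶ Y) (v : X ⟶ twistObj w i Y),
        Twist.poly (u - v ≫ twistMulX i Y) = Twist.poly u - Twist.poly v * MvPolynomial.X i := by
      intro X Y u v
      rw [sub_eq_add_neg, sub_eq_add_neg]
      rfl
    refine ⟨fun X Y m hm f => ?_, fun X Y f => ?_, fun X Y u => ?_⟩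
    · have hfδ : f ≫ koszulDelta i I Y = 0 := by
        obtain ⟨g, hg⟩ := exists_eq_shift_map (f ≫ koszulDelta i I Y)
        -- Composition with the connecting map amounts to a morphism from the shift by `m - 1` to
        -- the shorter complex. Only `m = 1` can contribute, and there the class is annihilated by
        -- `X i`, hence zero by regularity.
        by_cases hm1 : m = 1
        · subst hm1
          let e : ((lineHo w).obj X)⟦(1 : ℤ) - 1⟧ ≅ (lineHo w).obj X :=
            (shiftFunctorZero' _ _ (sub_self 1)).app _
          obtain ⟨v, hv⟩ := h1 X _ (e.inv ≫ g)
          have hz : g ≫ koszulX i I Y = 0 := by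
            apply (CategoryTheory.shiftFunctor _ (1 : ℤ)).map_injective
            rw [Functor.map_zero, Functor.map_comp, ← cancel_epi ((CategoryTheory.shiftFunctorAdd' (HoTwist w)
              ((1 : ℤ) - 1) 1 1 (by ring)).app ((lineHo w).obj X)).hom, ← Category.assoc, ← hg,
              Category.assoc, koszulDelta_comp_shift_koszulX, Limits.comp_zero, Limits.comp_zero]
          have hz' : (e.inv ≫ g) ≫ koszulX i I Y = 0 := by
            rw [Category.assoc, hz, Limits.comp_zero]
          rw [hv, hnat, h2, Twist.poly_comp] at hz'
          have hv0 := (h2 _ _ v).mpr (mem_varIdeal_of_mul_X_mem hiI hz')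
          rw [hv0] at hv
          have hg0 : g = 0 := by rw [← cancel_epi e.inv, hv, Limits.comp_zero]
          rw [hg, hg0, Functor.map_zero, Limits.comp_zero]
        · rw [hg, h0 _ _ _ (sub_ne_zero.mpr hm1) g, Functor.map_zero, Limits.comp_zero]
      obtain ⟨g, hg⟩ := exists_eq_comp_koszulInr f hfδ
      rw [hg, h0 _ _ _ hm g, Limits.zero_comp]
    · have hfδ : f ≫ koszulDelta i I Y = 0 := by
        let e : ((lineHo w).obj X)⟦(0 : ℤ)⟧ ≅ (lineHo w).obj X := (shiftFunctorZero _ _).app _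
        obtain ⟨g, hg⟩ := exists_eq_shift_map (e.hom ≫ f ≫ koszulDelta i I Y)
        rw [h0 _ _ _ (by norm_num) g, Functor.map_zero, Limits.comp_zero] at hg
        rw [← cancel_epi e.hom, hg, Limits.comp_zero]
      obtain ⟨g, hg⟩ := exists_eq_comp_koszulInr f hfδ
      obtain ⟨u, hu⟩ := h1 _ _ g
      exact ⟨u, by rw [hg, hu, Category.assoc, koszulTop]⟩
    · rw [koszulTop, ← Category.assoc]
      constructor
      · intro h
        obtain ⟨g, hg⟩ := exists_eq_comp_koszulX _ h
        obtain ⟨v, hv⟩ := h1 _ _ g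
        rw [hv, hnat, ← sub_eq_zero, ← Preadditive.sub_comp, ← Functor.map_sub, h2, hsplit] at hg
        rw [← sub_add_cancel (Twist.poly u) (Twist.poly v * MvPolynomial.X i)]
        exact add_mem (varIdeal_le_cons i I hg) (Ideal.mul_mem_left _ _ (X_mem_varIdeal_cons i I))
      · intro h
        obtain ⟨v, hv, hv'⟩ := exists_sub_mul_X_mem_varIdeal (Twist.poly_mem u) h
        let v' : X ⟶ twistObj w i Y := Twist.ofPoly v (by
          rwa [sub_right_comm] at hv)
        have h4 : (lineHo w).map (u - v' ≫ twistMulX i Y) ≫ koszulTop I Y = 0 := by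
          rw [h2, hsplit]
          exact hv'
        rw [Functor.map_sub, Preadditive.sub_comp, sub_eq_zero] at h4
        rw [h4, ← hnat, Category.assoc, koszulX_comp_koszulInr, Limits.comp_zero]

end orthogonality

end GaugedQuotient

/-! ### Morphisms from Koszul complexes to twists -/

namespace GaugedQuotient

open CategoryTheory MvPolynomial GradedResolution Pretriangulated CochainComplex

section orthogonality

variable {G : Type} [AddCommGroup G] {n : ℕ} {w : Fin n → G}

/-- The iterated shift as a single shift. -/
def shiftSucc {C : Type*} [Category* C] [HasShift C ℤ] {k m : ℤ} (h : k + 1 = m) (A : C) :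
    (A⟦k⟧)⟦(1 : ℤ)⟧ ≅ A⟦m⟧ :=
  ((CategoryTheory.shiftFunctorAdd' C k 1 m h).app A).symm

theorem shiftSucc_naturality {C : Type*} [Category* C] [HasShift C ℤ] {k m : ℤ} (h : k + 1 = m)
    {A B : C} (f : A ⟶ B) :
    (f⟦k⟧')⟦(1 : ℤ)⟧' ≫ (shiftSucc h B).hom = (shiftSucc h A).hom ≫ f⟦m⟧' :=
  (CategoryTheory.shiftFunctorAdd' C k 1 m h).inv.naturality f

/-- A morphism from a shift by `1` to a shift is a shift. -/
theorem exists_eq_shift_map_comp {C : Type*} [Category* C] [HasShift C ℤ] {A B : C} {k m : ℤ}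
    (h : k + 1 = m) (f : A⟦(1 : ℤ)⟧ ⟶ B⟦m⟧) :
    ∃ g : A ⟶ B⟦k⟧, f = g⟦(1 : ℤ)⟧' ≫ (shiftSucc h B).hom := by
  obtain ⟨g, hg⟩ := (CategoryTheory.shiftFunctor C (1 : ℤ)).map_surjective
    (f ≫ (shiftSucc h B).inv)
  exact ⟨g, by rw [hg, Category.assoc, Iso.inv_hom_id, Category.comp_id]⟩

variable (w) in
/-- A family of projections of the Koszul complexes to their first terms. -/
structure KoszulBot (I : List (Fin n)) where
  obj : Twist w → Twist w
  map : ∀ {X Y : Twist w}, (X ⟶ Y) → (obj X ⟶ obj Y)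
  proj : ∀ X : Twist w, (koszulHo w I).obj X ⟶ ((lineHo w).obj (obj X))⟦(I.length : ℤ)⟧
  deg_obj : ∀ X, (obj X).deg = X.deg - (I.map w).sum
  poly_map : ∀ {X Y : Twist w} (f : X ⟶ Y), Twist.poly (map f) = Twist.poly f
  naturality : ∀ {X Y : Twist w} (f : X ⟶ Y), (koszulHo w I).map f ≫ proj Y =
    proj X ≫ ((lineHo w).map (map f))⟦(I.length : ℤ)⟧'

/-- The projection for the empty list. -/
noncomputable def koszulBotNil (w : Fin n → G) : KoszulBot w [] where
  obj X := X
  map f := f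
  proj X := ((CategoryTheory.shiftFunctorZero' (HoTwist w)
    ((([] : List (Fin n)).length : ℕ) : ℤ) rfl).app ((lineHo w).obj X)).inv
  deg_obj X := by simp
  poly_map f := rfl
  naturality f := (CategoryTheory.shiftFunctorZero' (HoTwist w)
    ((([] : List (Fin n)).length : ℕ) : ℤ) rfl).inv.naturality ((lineHo w).map f)

theorem length_add_one (i : Fin n) (I : List (Fin n)) :
    (I.length : ℤ) + 1 = ((i :: I).length : ℕ) := by simp

/-- The projection for a longer list. -/
noncomputable def koszulBotCons (i : Fin n) {I : List (Fin n)} (β : KoszulBot w I) :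
    KoszulBot w (i :: I) where
  obj X := β.obj (twistObj w i X)
  map f := β.map ((twistBy w i).map f)
  proj X := koszulDelta i I X ≫ (β.proj (twistObj w i X))⟦(1 : ℤ)⟧' ≫
    (shiftSucc (length_add_one i I) _).hom
  deg_obj X := by
    rw [β.deg_obj, List.map_cons, List.sum_cons, ← sub_sub]
    rfl
  poly_map f := by
    rw [β.poly_map]
    rfl
  naturality {X Y} f := by
    rw [← Category.assoc, koszulDelta_naturality]
    simp only [Category.assoc]
    rw [← shiftSucc_naturality, ← (CategoryTheory.shiftFunctor (HoTwist w) (1 : ℤ)).map_comp_assoc,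
      β.naturality, (CategoryTheory.shiftFunctor (HoTwist w) (1 : ℤ)).map_comp_assoc]

/-- The projections to the first terms. -/
noncomputable def koszulBot (w : Fin n → G) : ∀ I : List (Fin n), KoszulBot w I
  | [] => koszulBotNil w
  | i :: I => koszulBotCons i (koszulBot w I)

/-- The morphisms from a Koszul complex to a twist. -/
theorem koszulHo_lineHo (I : List (Fin n)) (hI : I.Nodup) :
    (∀ (X Y : Twist w) (m : ℤ), m ≠ I.length →
      ∀ f : (koszulHo w I).obj X ⟶ ((lineHo w).obj Y)⟦m⟧, f = 0) ∧
    (∀ (X Y : Twist w) (f : (koszulHo w I).obj X ⟶ ((lineHo w).obj Y)⟦(I.length : ℤ)⟧),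
      ∃ u : (koszulBot w I).obj X ⟶ Y,
        f = (koszulBot w I).proj X ≫ ((lineHo w).map u)⟦(I.length : ℤ)⟧') ∧
    (∀ (X Y : Twist w) (u : (koszulBot w I).obj X ⟶ Y),
      (koszulBot w I).proj X ≫ ((lineHo w).map u)⟦(I.length : ℤ)⟧' = 0 ↔
        Twist.poly u ∈ varIdeal I) := by
  -- This is the self-duality of the Koszul complex: morphisms to shifted twists exist only for the
  -- shift by the number of variables, where they are again a graded component of `S` modulo these
  -- variables, now twisted by the sum of the weights.
  induction I with
  | nil =>
    let e := fun X : Twist w => (CategoryTheory.shiftFunctorZero' (HoTwist w)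
      ((([] : List (Fin n)).length : ℕ) : ℤ) rfl).app ((lineHo w).obj X)
    have hnat : ∀ (X Y : Twist w) (u : X ⟶ Y),
        (koszulBot w []).proj X ≫ ((lineHo w).map u)⟦((([] : List (Fin n)).length : ℕ) : ℤ)⟧' =
          (lineHo w).map u ≫ (e Y).inv :=
      fun X Y u => ((koszulBot w []).naturality u).symm
    refine ⟨fun X Y m hm f => eq_zero_of_lineHo_shift hm f, fun X Y f => ?_, fun X Y u => ?_⟩
    · obtain ⟨u, hu⟩ := (lineHo w).map_surjective (f ≫ (e Y).hom)
      exact ⟨u, ((Iso.eq_comp_inv _).mpr hu.symm).trans (hnat X Y u).symm⟩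
    · refine Iff.trans (Eq.congr (hnat X Y u) rfl) ?_
      have h2 : varIdeal (n := n) [] = ⊥ := by simp [varIdeal]
      rw [h2, Ideal.mem_bot]
      constructor
      · intro h
        exact congrArg Twist.poly (lineHo_map_eq_zero
          (((cancel_mono (e Y).inv).mp (h.trans Limits.zero_comp.symm))))
      · intro h
        have hu : (lineHo w).map (show X ⟶ Y from u) = 0 :=
          (congrArg (lineHo w).map (Twist.hom_ext h)).trans (Functor.map_zero _ _ _)
        exact (congrArg (· ≫ (e Y).inv) hu).trans Limits.zero_comp
  | cons i I ih =>
    obtain ⟨h0, h1, h2⟩ := ih hI.of_cons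
    have hiI : i ∉ I := (List.nodup_cons.mp hI).1
    -- The projections of the shorter complexes are replaced by an arbitrary family `β`, so that
    -- only the properties recorded in `KoszulBot` and the three statements of the induction enter.
    generalize hβ' : koszulBot w (i :: I) = β'
    have hβ'' : β' = koszulBotCons i (koszulBot w I) := hβ'.symm
    clear hβ'
    generalize koszulBot w I = β at *
    subst hβ''
    have hlen := length_add_one i I
    have hnat : ∀ (X Y : Twist w) (v : β.obj X ⟶ Y),
        koszulX i I X ≫ β.proj X ≫ ((lineHo w).map v)⟦(I.length : ℤ)⟧' =
          β.proj _ ≫ ((lineHo w).map (β.map (twistMulX i X) ≫ v))⟦(I.length : ℤ)⟧' := by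
      intro X Y v
      rw [← Category.assoc, koszulX, β.naturality, Category.assoc, ← Functor.map_comp,
        ← Functor.map_comp]
    have hpoly : ∀ X : Twist w, Twist.poly (β.map (twistMulX i X)) = MvPolynomial.X i :=
      fun X => β.poly_map _
    have hsplit : ∀ (X Y : Twist w) (u : β.obj (twistObj w i X) ⟶ Y) (v : β.obj X ⟶ Y),
        Twist.poly (u - β.map (twistMulX i X) ≫ v) =
          Twist.poly u - Twist.poly v * MvPolynomial.X i := by
      intro X Y u v
      rw [sub_eq_add_neg, sub_eq_add_neg, Twist.poly_add, Twist.poly_neg, Twist.poly_comp, hpoly,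
        mul_comm]
    -- The restriction to the shorter complex can be non-zero only for the shift by the length of
    -- `I`. There the corresponding class is annihilated by `X i`, so regularity makes it zero.
    have hinr : ∀ (X Y : Twist w) (m : ℤ), m ≠ ((i :: I).length : ℕ) →
        ∀ f : (koszulHo w (i :: I)).obj X ⟶ ((lineHo w).obj Y)⟦m⟧, koszulInr i I X ≫ f = 0 := by
      intro X Y m hm f
      by_cases hm1 : m = I.length
      · subst hm1
        obtain ⟨u, hu⟩ := h1 _ _ (koszulInr i I X ≫ f)
        have h3 : koszulX i I X ≫ koszulInr i I X ≫ f = 0 := by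
          rw [← Category.assoc, koszulX_comp_koszulInr, Limits.zero_comp]
        rw [hu, hnat, h2, Twist.poly_comp, hpoly, mul_comm] at h3
        rw [hu, h2]
        exact mem_varIdeal_of_mul_X_mem hiI h3
      · exact h0 _ _ _ hm1 _
    have hbot : ∀ (X Y : Twist w) (u : β.obj (twistObj w i X) ⟶ Y),
        (koszulBotCons i β).proj X ≫ ((lineHo w).map u)⟦((i :: I).length : ℤ)⟧' =
          koszulDelta i I X ≫ (β.proj _ ≫ ((lineHo w).map u)⟦(I.length : ℤ)⟧')⟦(1 : ℤ)⟧' ≫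
            (shiftSucc hlen _).hom := by
      intro X Y u
      change (koszulDelta i I X ≫ (β.proj (twistObj w i X))⟦(1 : ℤ)⟧' ≫ (shiftSucc hlen _).hom) ≫
        ((lineHo w).map u)⟦((i :: I).length : ℤ)⟧' = _
      rw [Functor.map_comp, Category.assoc, Category.assoc, Category.assoc, shiftSucc_naturality]
    refine ⟨fun X Y m hm f => ?_, fun X Y f => ?_,
      fun X Y (u : β.obj (twistObj w i X) ⟶ Y) => ?_⟩
    · obtain ⟨g, rfl⟩ := exists_eq_koszulDelta_comp f (hinr X Y m hm f)
      obtain ⟨g', rfl⟩ := exists_eq_shift_map_comp (sub_add_cancel m 1) g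
      rw [h0 _ _ _ (by lia) g', Functor.map_zero, Limits.zero_comp, Limits.comp_zero]
    · obtain ⟨g, rfl⟩ := exists_eq_koszulDelta_comp f (h0 _ _ _ (by lia) _)
      obtain ⟨g', rfl⟩ := exists_eq_shift_map_comp hlen g
      obtain ⟨u, rfl⟩ := h1 _ _ g'
      exact ⟨u, (hbot X Y u).symm⟩
    · refine Iff.trans (Eq.congr (hbot X Y u) rfl) ?_
      rw [← Category.assoc, ← cancel_mono (shiftSucc hlen ((lineHo w).obj Y)).inv,
        Category.assoc, Iso.hom_inv_id, Category.comp_id, Limits.zero_comp]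
      constructor
      · intro h
        obtain ⟨g, hg⟩ := exists_eq_shift_koszulX_comp _ h
        obtain ⟨g', rfl⟩ := (CategoryTheory.shiftFunctor _ (1 : ℤ)).map_surjective g
        obtain ⟨v, rfl⟩ := h1 _ _ g'
        rw [← Functor.map_comp] at hg
        have h3 := (CategoryTheory.shiftFunctor _ (1 : ℤ)).map_injective hg
        rw [hnat, ← sub_eq_zero, ← Preadditive.comp_sub, ← Functor.map_sub, ← Functor.map_sub] at h3
        have h4 := (h2 _ _ _).mp h3
        rw [hsplit] at h4
        have h5 := add_mem (varIdeal_le_cons i I h4)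
          (Ideal.mul_mem_left _ (Twist.poly v) (X_mem_varIdeal_cons i I))
        rw [sub_add_cancel] at h5
        exact h5
      · intro h
        obtain ⟨v, hv, hv'⟩ := exists_sub_mul_X_mem_varIdeal (Twist.poly_mem u) h
        have hdeg : (β.obj (twistObj w i X)).deg + w i = (β.obj X).deg := by
          rw [β.deg_obj, β.deg_obj]
          change X.deg - w i - _ + _ = _
          abel
        let v' : β.obj X ⟶ Y := Twist.ofPoly v (by
          have h5 := hv
          rw [sub_sub] at h5
          change IsWeightedHomogeneous w v (Y.deg - ((β.obj (twistObj w i X)).deg + w i)) at h5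
          rwa [hdeg] at h5)
        have h4 : β.proj _ ≫ ((lineHo w).map (u - β.map (twistMulX i X) ≫ v'))⟦(I.length : ℤ)⟧'
            = 0 := by
          rw [h2, hsplit]
          exact hv'
        rw [Functor.map_sub, Functor.map_sub, Preadditive.comp_sub, sub_eq_zero] at h4
        have h5 : koszulDelta i I X ≫ (β.proj _ ≫
            ((lineHo w).map u)⟦(I.length : ℤ)⟧')⟦(1 : ℤ)⟧' = 0 := by
          rw [h4, ← hnat, Functor.map_comp, ← Category.assoc, koszulDelta_comp_shift_koszulX,
            Limits.zero_comp]
        exact h5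

end orthogonality

end GaugedQuotient

/-! ### Weights in the Koszul complex of the variables of positive weight -/

namespace GaugedQuotient

open CategoryTheory MvPolynomial GradedResolution Pretriangulated

section windows

variable {n : ℕ} {a r : Fin n → ℤ}

section

variable (H : ObjectProperty (HoTwist (weights a r))) [H.IsTriangulated] [H.IsClosedUnderIsomorphisms]

/-- Each cone adds a copy twisted down by `a i`, so the twists that occur have weights lowered by
partial sums. As all `a i` are positive, these partial sums lie between zero and the full sum. -/
theorem koszulHo_mem (I : List (Fin n)) (hI : ∀ i ∈ I, 0 < a i) (X : Twist (weights a r))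
    (h : ∀ Z : Twist (weights a r), X.deg.1 - (I.map a).sum ≤ Z.deg.1 → Z.deg.1 ≤ X.deg.1 →
      H ((lineHo _).obj Z)) : H ((koszulHo _ I).obj X) := by
  induction I generalizing X with
  | nil => exact h X (by simp) le_rfl
  | cons i I ih =>
    have hi := hI i List.mem_cons_self
    have hI' := fun j hj => hI j (List.mem_cons_of_mem i hj)
    have hsum : 0 ≤ (I.map a).sum := List.sum_nonneg (by
      intro x hx
      obtain ⟨j, hj, rfl⟩ := List.mem_map.mp hx
      exact (hI' j hj).le)
    rw [List.map_cons, List.sum_cons] at h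
    refine H.ext_of_isTriangulatedClosed₃ _ (koszulTriangle_distinguished i I X)
      (ih hI' _ fun Z h1 h2 => h Z ?_ ?_) (ih hI' _ fun Z h1 h2 => h Z ?_ ?_)
    · change X.deg.1 - a i - _ ≤ _ at h1
      lia
    · change _ ≤ X.deg.1 - a i at h2
      lia
    · lia
    · lia

/-- The cone of the inclusion of the last term is built from the remaining twists. These are lowered
by at least one positive weight, whence the strict upper bound. -/
theorem koszulTop_mem (I : List (Fin n)) (hI : ∀ i ∈ I, 0 < a i) (X : Twist (weights a r))
    (h : ∀ Z : Twist (weights a r), X.deg.1 - (I.map a).sum ≤ Z.deg.1 → Z.deg.1 < X.deg.1 →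
      H ((lineHo _).obj Z)) : H.trW (koszulTop I X) := by
  induction I generalizing X with
  | nil => exact MorphismProperty.id_mem _ _
  | cons i I ih =>
    have hi := hI i List.mem_cons_self
    have hI' := fun j hj => hI j (List.mem_cons_of_mem i hj)
    rw [List.map_cons, List.sum_cons] at h
    refine MorphismProperty.comp_mem _ _ _ (ih hI' _ fun Z h1 h2 => h Z (by lia) h2) ?_
    refine (H.trW_iff_of_distinguished' _ (koszulTriangle_distinguished i I X)).mpr ?_
    refine koszulHo_mem H I hI' _ fun Z h1 h2 => h Z ?_ ?_
    · change X.deg.1 - a i - _ ≤ _ at h1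
      lia
    · change _ ≤ X.deg.1 - a i at h2
      lia

/-- Dual to `koszulTop_mem`: removing the first term removes the only summand lowered by the full
sum, whence the strict lower bound. -/
theorem koszulBot_mem (I : List (Fin n)) (hI : ∀ i ∈ I, 0 < a i) (X : Twist (weights a r))
    (h : ∀ Z : Twist (weights a r), X.deg.1 - (I.map a).sum < Z.deg.1 → Z.deg.1 ≤ X.deg.1 →
      H ((lineHo _).obj Z)) : H.trW ((koszulBot _ I).proj X) := by
  induction I generalizing X with
  | nil =>
    have : IsIso ((koszulBot (weights a r) []).proj X) := by
      dsimp only [koszulBot, koszulBotNil]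
      infer_instance
    exact MorphismProperty.of_isIso _ _
  | cons i I ih =>
    have hi := hI i List.mem_cons_self
    have hI' := fun j hj => hI j (List.mem_cons_of_mem i hj)
    rw [List.map_cons, List.sum_cons] at h
    refine MorphismProperty.comp_mem _ _ _ ?_ (MorphismProperty.comp_mem _ _ _ ?_
      (MorphismProperty.of_isIso _ _))
    · refine (H.trW_iff_of_distinguished' _
        (rot_of_distTriang _ (koszulTriangle_distinguished i I X))).mpr ?_
      exact koszulHo_mem H I hI' _ fun Z h1 h2 => h Z (by lia) h2
    · refine H.trW.shift (ih hI' _ fun Z h1 h2 => h Z ?_ ?_) 1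
      · change X.deg.1 - a i - _ < _ at h1
        lia
      · change _ ≤ X.deg.1 - a i at h2
        lia

end

/-- The list of the variables of positive weight. -/
noncomputable def posVars (a : Fin n → ℤ) : List (Fin n) :=
  (Finset.univ.filter fun i => 0 < a i).toList

theorem mem_posVars {i : Fin n} : i ∈ posVars a ↔ 0 < a i := by
  simp [posVars]

theorem nodup_posVars : (posVars a).Nodup := Finset.nodup_toList _

theorem sum_posVars : ((posVars a).map a).sum = ∑ i with 0 < a i, a i :=
  Finset.sum_map_toList _ _

/-- A monomial without variables of positive weight has weight at most zero. -/
theorem mem_varIdeal_posVars {f : MvPolynomial (Fin n) ℂ} {g : ℤ × ℤ}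
    (hf : IsWeightedHomogeneous (weights a r) f g) (hg : 0 < g.1) : f ∈ varIdeal (posVars a) := by
  rw [mem_ideal_span_X_image]
  intro m hm
  by_contra! hcon
  have h1 : Finsupp.weight (weights a r) m = g := hf (mem_support_iff.mp hm)
  have h2 : g.1 = ∑ i, (m i : ℤ) * a i := by
    rw [← h1, Finsupp.weight_apply, Finsupp.sum_fintype _ _ (by simp), Prod.fst_sum]
    simp [weights]
  rw [h2] at hg
  refine absurd hg (not_lt.mpr (Finset.sum_nonpos fun i _ => ?_))
  by_cases hi : 0 < a i
  · rw [hcon i (mem_posVars.mpr hi)]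
    simp
  · exact mul_nonpos_of_nonneg_of_nonpos (by positivity) (not_lt.mp hi)

/-- The morphisms form the component of `S` modulo the positive variables in the positive weight
`Y.deg.1 - X.deg.1`, which is zero. -/
theorem lineHo_koszulHo_posVars {X Y : Twist (weights a r)} (h : X.deg.1 < Y.deg.1) {m : ℤ}
    (f : ((lineHo _).obj X)⟦m⟧ ⟶ (koszulHo _ (posVars a)).obj Y) : f = 0 := by
  obtain ⟨h0, h1, h2⟩ := lineHo_koszulHo (w := weights a r) (posVars a) nodup_posVars
  by_cases hm : m = 0
  · subst hm
    let e : ((lineHo _).obj X)⟦(0 : ℤ)⟧ ≅ (lineHo _).obj X := (shiftFunctorZero _ _).app _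
    obtain ⟨u, hu⟩ := h1 _ _ (e.inv ≫ f)
    rw [(h2 _ _ u).mpr (mem_varIdeal_posVars (Twist.poly_mem u) (sub_pos.mpr h))] at hu
    rw [← cancel_epi e.inv, hu, Limits.comp_zero]
  · exact h0 _ _ _ hm f

/-- Morphisms factor through the first term of the Koszul complex, whose weight is `X.deg.1` minus
the full sum. The bound `h` says that the polynomial involved has positive weight, so it acts as
zero. -/
theorem koszulHo_posVars_lineHo {X Y : Twist (weights a r)}
    (h : X.deg.1 - ∑ i with 0 < a i, a i < Y.deg.1) {m : ℤ}
    (f : (koszulHo _ (posVars a)).obj X ⟶ ((lineHo _).obj Y)⟦m⟧) : f = 0 := by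
  obtain ⟨h0, h1, h2⟩ := koszulHo_lineHo (w := weights a r) (posVars a) nodup_posVars
  by_cases hm : m = (posVars a).length
  · subst hm
    obtain ⟨u, hu⟩ := h1 _ _ f
    rw [hu, h2]
    refine mem_varIdeal_posVars (Twist.poly_mem u) (sub_pos.mpr ?_)
    rw [KoszulBot.deg_obj]
    have : (((posVars a).map (weights a r)).sum).1 = ∑ i with 0 < a i, a i := by
      rw [← sum_posVars]
      generalize posVars a = I
      induction I with
      | nil => rfl
      | cons i I ih => simpa using ih
    change X.deg.1 - _ < _
    rwa [this]
  · exact h0 _ _ _ hm f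

end windows

end GaugedQuotient

/-! ### Torsion complexes and the narrowing of intervals of weights -/

namespace GaugedQuotient

open CategoryTheory MvPolynomial GradedResolution Pretriangulated
open scoped ZeroObject

section torsion

variable {G : Type} [AddCommGroup G] {n : ℕ} {w : Fin n → G}

attribute [local instance] HasDerivedCategory.standard

/-- Evaluation at a point, as a functor to the derived category. -/
noncomputable abbrev evalDerived (w : Fin n → G) {R : Type} [CommRing R] [Algebra ℂ R]
    (v : Fin n → R) : HoTwist w ⥤ DerivedCategory (ModuleCat.{0} R) :=
  (evalFunctor w v).mapHomotopyCategory (ComplexShape.up ℤ) ⋙ DerivedCategory.Qh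

theorem acyclicAt_of_isZero {R : Type} [CommRing R] [Algebra ℂ R] {v : Fin n → R}
    {X : HoTwist w} (h : Limits.IsZero ((evalDerived w v).obj X)) : acyclicAt w v X := by
  refine (HomotopyCategory.mem_subcategoryAcyclic_iff _).mpr fun m => ?_
  refine Limits.IsZero.of_iso ?_
    ((DerivedCategory.homologyFunctorFactorsh (ModuleCat.{0} R) m).symm.app _)
  exact Functor.map_isZero (DerivedCategory.homologyFunctor (ModuleCat.{0} R) m) h

theorem isIso_evalFunctor_map {R : Type} [CommRing R] [Algebra ℂ R] {v : Fin n → R}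
    {X Y : Twist w} {f : X ⟶ Y} (hf : IsUnit (aeval v (Twist.poly f))) :
    IsIso ((evalFunctor w v).map ((Mat_.embedding _).map f)) := by
  rw [ConcreteCategory.isIso_iff_bijective]
  change Function.Bijective (evalMat v ((Mat_.embedding _).map f))
  have key : ∀ x : ((Mat_.embedding (Twist w)).obj X).ι → R,
      evalMat v ((Mat_.embedding _).map f) x = fun _ => aeval v (Twist.poly f) * x PUnit.unit := by
    intro x
    funext j
    exact Fintype.sum_unique (fun i : PUnit => aeval v (Twist.poly f) * x i)
  obtain ⟨u, hu⟩ := hf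
  constructor
  · intro x y hxy
    rw [key, key, ← hu] at hxy
    funext j
    exact u.isUnit.mul_left_cancel (congrFun hxy PUnit.unit)
  · intro y
    refine ⟨fun _ => ((u⁻¹ : Rˣ) : R) * y PUnit.unit, (key _).trans ?_⟩
    funext j
    rw [← hu]
    exact Units.mul_inv_cancel_left u _

theorem isIso_map_conj {C D : Type*} [Category* C] [Category* D] (F : C ⥤ D) {X X' Y Y' : C}
    (e : X' ≅ X) (f : X ⟶ Y) (e' : Y' ≅ Y) (h : IsIso (F.map f)) :
    IsIso (F.map (e.hom ≫ f ≫ e'.inv)) := by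
  rw [Functor.map_comp, Functor.map_comp]
  infer_instance

/-- The five lemma for the Koszul triangles reduces this to a single twist, where it is
multiplication by a unit. -/
theorem isIso_evalDerived_koszulHo {R : Type} [CommRing R] [Algebra ℂ R] {v : Fin n → R}
    (I : List (Fin n)) {X Y : Twist w} {f : X ⟶ Y} (hf : IsUnit (aeval v (Twist.poly f))) :
    IsIso ((evalDerived w v).map ((koszulHo w I).map f)) := by
  induction I generalizing X Y f with
  | nil =>
    have h1 := isIso_evalFunctor_map hf
    have h2 : IsIso (((evalFunctor w v).mapHomologicalComplex (ComplexShape.up ℤ)).map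
        ((CochainComplex.singleFunctor _ 0).map ((Mat_.embedding _).map f))) := by
      have : ∀ j : ℤ, IsIso ((((evalFunctor w v).mapHomologicalComplex (ComplexShape.up ℤ)).map
          ((CochainComplex.singleFunctor _ 0).map ((Mat_.embedding _).map f))).f j) := by
        intro j
        by_cases hj : j = 0
        · subst hj
          have h3 : ((CochainComplex.singleFunctor _ 0).map ((Mat_.embedding _).map f)).f 0 = _ :=
            HomologicalComplex.single_map_f_self (ComplexShape.up ℤ) 0 ((Mat_.embedding _).map f)
          change IsIso ((evalFunctor w v).map _)
          rw [h3]
          exact isIso_map_conj _ _ _ _ h1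
        · refine (Functor.map_isZero (evalFunctor w v) ?_).isIso (Functor.map_isZero (evalFunctor w v) ?_) _
          · exact HomologicalComplex.isZero_single_obj_X (ComplexShape.up ℤ) 0 _ j hj
          · exact HomologicalComplex.isZero_single_obj_X (ComplexShape.up ℤ) 0 _ j hj
      exact HomologicalComplex.Hom.isIso_of_components _
    change IsIso (DerivedCategory.Qh.map ((HomotopyCategory.quotient _ _).map
      (((evalFunctor w v).mapHomologicalComplex (ComplexShape.up ℤ)).map
        ((CochainComplex.singleFunctor _ 0).map ((Mat_.embedding _).map f)))))
    infer_instance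
  | cons i I ih =>
    have hT := fun X : Twist w => koszulTriangle_distinguished i I X
    exact isIso₃_of_isIso₁₂ ((evalDerived w v).mapTriangle.map (koszulTriangleMap i I f))
      ((evalDerived w v).map_distinguished _ (hT X)) ((evalDerived w v).map_distinguished _ (hT Y))
      (ih (f := (twistBy w i).map f) hf) (ih hf)

/-- When the invertible coordinate is the one of the last cone, that cone is taken of an
isomorphism. Otherwise it is the cone of a map between complexes that are already acyclic. -/
theorem acyclicAt_koszulHo {R : Type} [CommRing R] [Algebra ℂ R] {v : Fin n → R}
    {I : List (Fin n)} {i : Fin n} (hi : i ∈ I) (hv : IsUnit (v i)) (X : Twist w) :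
    acyclicAt w v ((koszulHo w I).obj X) := by
  induction I generalizing X with
  | nil => simp at hi
  | cons j I ih =>
    have hT := koszulTriangle_distinguished j I X
    rcases List.mem_cons.mp hi with rfl | hi
    · apply acyclicAt_of_isZero
      refine Triangle.isZero₃_of_isIso₁ _ ((evalDerived w v).map_distinguished _ hT) ?_
      refine isIso_evalDerived_koszulHo I ?_
      rw [show Twist.poly (twistMulX i X) = MvPolynomial.X i from rfl, aeval_X]
      exact hv
    · exact (acyclicAt w v).ext_of_isTriangulatedClosed₃ _ hT (ih hi _) (ih hi _)

end torsion

section windows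

variable {n : ℕ} {a r : Fin n → ℤ}

/-- The complexes that are exact at the points with an invertible coordinate of positive weight. -/
def torsionComplexes (a r : Fin n → ℤ) : ObjectProperty (HoTwist (weights a r)) := fun X =>
  ∀ (R : Type) [CommRing R] [Algebra ℂ R] (v : Fin n → R) (i : Fin n), 0 < a i → IsUnit (v i) →
    acyclicAt (weights a r) v X

instance : (torsionComplexes a r).IsClosedUnderIsomorphisms where
  of_iso e h R _ _ v i hi hv := (acyclicAt _ v).prop_of_iso e (h R v i hi hv)

instance : (torsionComplexes a r).IsTriangulated where
  exists_zero := ⟨0, Limits.isZero_zero _, fun R _ _ v i _ _ => by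
    obtain ⟨Z, hZ, hQ⟩ := (acyclicAt (weights a r) v).exists_prop_of_containsZero
    exact (acyclicAt _ v).prop_of_iso (hZ.iso (Limits.isZero_zero _)) hQ⟩
  isStableUnderShiftBy n := ⟨fun X hX R _ _ v i hi hv =>
    (acyclicAt _ v).le_shift n _ (hX R v i hi hv)⟩
  ext₂' T hT h₁ h₃ := by
    rw [ObjectProperty.isoClosure_eq_self]
    exact fun R _ _ v i hi hv => (acyclicAt _ v).ext_of_isTriangulatedClosed₂ T hT
      (h₁ R v i hi hv) (h₃ R v i hi hv)

theorem torsionComplexes_koszulHo (X : Twist (weights a r)) :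
    torsionComplexes a r ((koszulHo _ (posVars a)).obj X) :=
  fun _ _ _ _ _ hi hv => acyclicAt_koszulHo (mem_posVars.mpr hi) hv X

/-- The twists with `C*_G`-weights in an interval, as complexes. -/
def linesIn (a r : Fin n → ℤ) (lo hi : ℤ) : ObjectProperty (HoTwist (weights a r)) := fun X =>
  ∃ Z : Twist (weights a r), lo ≤ Z.deg.1 ∧ Z.deg.1 ≤ hi ∧ X = (lineHo _).obj Z

theorem linesIn_hull {lo hi : ℤ} {Z : Twist (weights a r)} (h : lo ≤ Z.deg.1) (h' : Z.deg.1 ≤ hi) :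
    (linesIn a r lo hi).triangulatedHull ((lineHo _).obj Z) :=
  (linesIn a r lo hi).le_triangulatedHull _ ⟨Z, h, h', rfl⟩

theorem eq_zero_of_forall_shift {C : Type*} [Category* C] [HasShift C ℤ] [Preadditive C]
    [∀ m : ℤ, (shiftFunctor C m).Additive] {X Y : C} (h : ∀ (m : ℤ) (f : X⟦m⟧ ⟶ Y), f = 0) (m : ℤ)
    (f : X ⟶ Y⟦m⟧) : f = 0 := by
  apply (shiftFunctor _ (-m)).map_injective
  rw [Functor.map_zero, ← cancel_mono ((shiftShiftNeg Y m).hom), Limits.zero_comp]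
  exact h _ _

theorem eq_zero_of_forall_shift' {C : Type*} [Category* C] [HasShift C ℤ] [Preadditive C]
    [∀ m : ℤ, (shiftFunctor C m).Additive] {X Y : C} (h : ∀ (m : ℤ) (f : X ⟶ Y⟦m⟧), f = 0) (m : ℤ)
    (f : X⟦m⟧ ⟶ Y) : f = 0 := by
  apply (shiftFunctor _ (-m)).map_injective
  rw [Functor.map_zero, ← cancel_epi ((shiftShiftNeg X m).inv), Limits.comp_zero]
  exact h _ _

/-- Closing the Koszul complex under shifts makes its left orthogonal triangulated, so orthogonality
need only be checked for the twists that generate the hull. -/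
theorem linesIn_hull_orthogonal_koszulHo {lo hi : ℤ} {Z : Twist (weights a r)} (h : hi < Z.deg.1) :
    (linesIn a r lo hi).triangulatedHull.rightOrthogonal ((koszulHo _ (posVars a)).obj Z) := by
  let K : ObjectProperty (HoTwist (weights a r)) :=
    (ObjectProperty.singleton ((koszulHo _ (posVars a)).obj Z)).shiftClosure ℤ
  have key : (linesIn a r lo hi).triangulatedHull ≤ K.leftOrthogonal := by
    refine ObjectProperty.triangulatedHull_le ?_
    rintro _ ⟨Y, -, hY, rfl⟩ T f ⟨T', m, e, hT'⟩
    obtain rfl := (ObjectProperty.singleton_iff _ _).mp hT'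
    rw [← cancel_mono e.hom, Limits.zero_comp]
    exact eq_zero_of_forall_shift (fun m f => lineHo_koszulHo_posVars (by lia) f) m _
  intro X f hX
  exact key X hX f (ObjectProperty.le_shiftClosure _ _ ((ObjectProperty.singleton_iff _ _).mpr rfl))

theorem koszulHo_orthogonal_linesIn_hull {lo hi : ℤ} {Z : Twist (weights a r)}
    (h : Z.deg.1 - ∑ i with 0 < a i, a i < lo) :
    (linesIn a r lo hi).triangulatedHull.leftOrthogonal ((koszulHo _ (posVars a)).obj Z) := by
  let K : ObjectProperty (HoTwist (weights a r)) :=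
    (ObjectProperty.singleton ((koszulHo _ (posVars a)).obj Z)).shiftClosure ℤ
  have key : (linesIn a r lo hi).triangulatedHull ≤ K.rightOrthogonal := by
    refine ObjectProperty.triangulatedHull_le ?_
    rintro _ ⟨Y, hY, -, rfl⟩ T f ⟨T', m, e, hT'⟩
    obtain rfl := (ObjectProperty.singleton_iff _ _).mp hT'
    rw [← cancel_epi e.inv, Limits.comp_zero]
    exact eq_zero_of_forall_shift' (fun m f => koszulHo_posVars_lineHo (by lia) f) m _
  intro X f hX
  exact key X hX f (ObjectProperty.le_shiftClosure _ _ ((ObjectProperty.singleton_iff _ _).mpr rfl))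

/-- Up to complexes that are exact at the semistable points, the highest weight of a complex can be
lowered. -/
theorem lower_window {lo hi : ℤ} (h : lo + ∑ i with 0 < a i, a i ≤ hi) :
    (linesIn a r lo hi).triangulatedHull ≤
      ObjectProperty.extensionProduct (linesIn a r lo (hi - 1)).triangulatedHull
        (torsionComplexes a r) := by
  set P := (linesIn a r lo (hi - 1)).triangulatedHull with hP
  -- Restricting the torsion complexes to those orthogonal to `P` makes the extension product
  -- triangulated; this reduces the claim to single twists.
  let Q := P.rightOrthogonal ⊓ torsionComplexes a r
  have hPQ : P ≤ Q.leftOrthogonal := fun X hX Y f hY => hY.1 f hX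
  have := ObjectProperty.isTriangulated_extensionProduct hPQ
  refine le_trans (ObjectProperty.triangulatedHull_le ?_)
    (ObjectProperty.monotone_extensionProduct_right P (inf_le_right : Q ≤ torsionComplexes a r))
  rintro _ ⟨Z, hlo, hhi, rfl⟩
  by_cases hZ : Z.deg.1 ≤ hi - 1
  · exact ObjectProperty.le_extensionProduct_left Q _ (linesIn_hull hlo hZ)
  -- Only weight `hi` remains. The twist is the last term of the Koszul complex of `Z`; the other
  -- terms have weights from `hi` minus the sum up to `hi - 1`, and the hypothesis `h` puts these
  -- into the smaller interval. The triangle then has the Koszul complex as its torsion part.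
  · obtain ⟨F, f, g, hT, hF⟩ := (P.trW_iff' _).mp (koszulTop_mem P (posVars a)
      (fun i hi => mem_posVars.mp hi) Z fun Y h1 h2 => linesIn_hull (by
        rw [sum_posVars] at h1; lia) (by lia))
    exact ⟨F, _, _, _, _, hT, hF, linesIn_hull_orthogonal_koszulHo (by lia),
      torsionComplexes_koszulHo Z⟩

/-- Up to complexes that are exact at the semistable points, the lowest weight of a complex can be
raised. -/
theorem raise_window {lo hi : ℤ} (h : lo + ∑ i with 0 < a i, a i ≤ hi) :
    (linesIn a r lo hi).triangulatedHull ≤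
      ObjectProperty.extensionProduct (torsionComplexes a r)
        (linesIn a r (lo + 1) hi).triangulatedHull := by
  set Q := (linesIn a r (lo + 1) hi).triangulatedHull with hQ
  -- As in `lower_window`, with the torsion part now on the other side of the extension.
  let P := Q.leftOrthogonal ⊓ torsionComplexes a r
  have hPQ : P ≤ Q.leftOrthogonal := inf_le_left
  have := ObjectProperty.isTriangulated_extensionProduct hPQ
  refine le_trans (ObjectProperty.triangulatedHull_le ?_)
    (ObjectProperty.monotone_extensionProduct_left Q (inf_le_right : P ≤ torsionComplexes a r))
  rintro _ ⟨Z, hlo, hhi, rfl⟩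
  by_cases hZ : lo + 1 ≤ Z.deg.1
  · exact ObjectProperty.le_extensionProduct_right P _ (linesIn_hull hZ hhi)
  -- The full sum of weights is added so that `Z`, of the lowest weight `lo`, becomes the first term
  -- of the Koszul complex of `X`.
  · let X : Twist (weights a r) := ⟨Z.deg + ((posVars a).map (weights a r)).sum⟩
    have hX : (koszulBot (weights a r) (posVars a)).obj X = Z := by
      have h1 := (koszulBot (weights a r) (posVars a)).deg_obj X
      change _ = Z.deg + _ - _ at h1
      rw [add_sub_cancel_right] at h1
      generalize (koszulBot (weights a r) (posVars a)).obj X = Y at h1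
      cases Y; cases Z
      exact congrArg _ h1
    have hX1 : X.deg.1 = Z.deg.1 + ((posVars a).map a).sum := by
      change Z.deg.1 + _ = _
      congr 1
      generalize posVars a = I
      induction I with
      | nil => rfl
      | cons i I ih => simpa using ih
    rw [sum_posVars] at hX1
    obtain ⟨F, f, g, hT, hF⟩ := koszulBot_mem Q (posVars a)
      (fun i hi => mem_posVars.mp hi) X fun Y h1 h2 => linesIn_hull (by
        rw [sum_posVars] at h1; lia) (by lia)
    have h1 : ObjectProperty.extensionProduct P Q
        (((lineHo _).obj ((koszulBot _ (posVars a)).obj X))⟦((posVars a).length : ℤ)⟧) :=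
      ⟨_, _, _, _, _, hT, ⟨koszulHo_orthogonal_linesIn_hull (by lia),
        torsionComplexes_koszulHo X⟩, hF⟩
    rw [hX] at h1
    -- The first term sits in a shift by the number of variables; the class is stable under shifts,
    -- so the shift may be dropped.
    exact (ObjectProperty.prop_shift_iff_of_isStableUnderShift _ _ _).mp h1

end windows

end GaugedQuotient

/-! ### Base change to localizations and local arguments at semistable points -/

namespace GaugedQuotient

open CategoryTheory MvPolynomial GradedResolution

section baseChange

variable {R S M N : Type} [CommRing R] [CommRing S] {φ : R →+* S}
    [AddCommGroup M] [Module R M] [AddCommGroup N] [Module S N] {f : M →ₛₗ[φ] N}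

/-- The quotient map by the span and the zero map agree on the image of `f`, so the uniqueness in
the universal property identifies them. -/
theorem IsSemilinearBaseChange.span_range (hf : IsSemilinearBaseChange f) :
    Submodule.span S (Set.range f) = ⊤ := by
  obtain ⟨g', -, huniq⟩ := hf (N ⧸ Submodule.span S (Set.range f)) 0
  rw [← Submodule.ker_mkQ (Submodule.span S (Set.range f)), LinearMap.ker_eq_top,
    huniq (Submodule.mkQ _) fun m => ?_, ← huniq 0 fun m => rfl]
  exact (Submodule.Quotient.mk_eq_zero _).mpr (Submodule.subset_span ⟨m, rfl⟩)

end baseChange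

section localization

variable {R R' M N : Type} [CommRing R] [CommRing R'] [Algebra R R']
    [AddCommGroup M] [Module R M] [AddCommGroup N] [Module R' N]
    {f : M →ₛₗ[algebraMap R R'] N}

/-- The universal property yields a map from `N` to the localized module, where an element vanishes
only if a power of `b` annihilates it. -/
theorem IsSemilinearBaseChange.exists_pow_smul_eq_zero (b : R) [IsLocalization.Away b R']
    (hf : IsSemilinearBaseChange f) {m : M}
    (hm : f m = 0) : ∃ k : ℕ, b ^ k • m = 0 := by
  let e := IsLocalization.algEquiv (Submonoid.powers b) R' (Localization.Away b)
  let _ : Module R' (LocalizedModule (Submonoid.powers b) M) :=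
    Module.compHom _ (e : R' →+* Localization.Away b)
  let g : M →ₛₗ[algebraMap R R'] LocalizedModule (Submonoid.powers b) M :=
    { toFun := LocalizedModule.mkLinearMap (Submonoid.powers b) M
      map_add' := map_add _
      map_smul' := fun c x => by
        have h : e (algebraMap R R' c) = algebraMap R (Localization.Away b) c := e.commutes c
        change _ = e (algebraMap R R' c) •
          (LocalizedModule.mkLinearMap (Submonoid.powers b) M x)
        rw [h, map_smul, algebraMap_smul] }
  obtain ⟨g', hg', -⟩ := hf _ g
  have h0 : LocalizedModule.mkLinearMap (Submonoid.powers b) M m = 0 := by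
    have := hg' m
    rw [hm, map_zero] at this
    exact this.symm
  obtain ⟨⟨_, k, rfl⟩, hc⟩ := (IsLocalizedModule.eq_zero_iff (Submonoid.powers b) _).mp h0
  exact ⟨k, hc⟩

theorem IsSemilinearBaseChange.exists_pow_smul_eq (b : R) [IsLocalization.Away b R']
    (hf : IsSemilinearBaseChange f) (y : N) :
    ∃ (k : ℕ) (m : M), f m = algebraMap R R' (b ^ k) • y := by
  have hy : y ∈ Submodule.span R' (Set.range f) := by
    rw [hf.span_range]; trivial
  induction hy using Submodule.span_induction with
  | mem x hx =>
    obtain ⟨m, rfl⟩ := hx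
    exact ⟨0, m, by simp⟩
  | zero => exact ⟨0, 0, by simp⟩
  | add x y _ _ hx hy =>
    obtain ⟨k, m, hm⟩ := hx
    obtain ⟨k', m', hm'⟩ := hy
    refine ⟨k + k', b ^ k' • m + b ^ k • m', ?_⟩
    rw [map_add, f.map_smulₛₗ, f.map_smulₛₗ, hm, hm', smul_smul, smul_smul, ← map_mul, ← map_mul,
      smul_add, pow_add, mul_comm (b ^ k')]
  | smul c x _ hx =>
    obtain ⟨k, m, hm⟩ := hx
    obtain ⟨⟨c', ⟨_, k', rfl⟩⟩, hc⟩ := IsLocalization.surj (Submonoid.powers b) c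
    refine ⟨k + k', c' • m, ?_⟩
    rw [f.map_smulₛₗ, hm, ← hc, smul_smul, smul_smul, pow_add, map_mul]
    congr 1
    ring

end localization

section points

variable {n : ℕ} {a r : Fin n → ℤ}

/-- Each monomial of positive weight is divisible by a variable of positive weight, and these
variables are themselves admissible functions. -/
theorem isSemistable_iff {R : Type} [CommRing R] [Algebra ℂ R] {v : Fin n → R} :
    IsSemistable a v ↔ Ideal.span (v '' {i | 0 < a i}) = ⊤ := by
  constructor
  · intro h
    change Ideal.span _ = ⊤ at h
    rw [eq_top_iff, ← h, Ideal.span_le]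
    rintro _ ⟨m, hm, f, hf, rfl⟩
    rw [f.as_sum, map_sum]
    refine sum_mem fun d hd => ?_
    rw [aeval_monomial]
    refine Ideal.mul_mem_left _ _ ?_
    obtain ⟨i, hi, hdi⟩ : ∃ i, 0 < a i ∧ d i ≠ 0 := by
      by_contra! hcon
      have h1 : Finsupp.weight a d = m := hf (mem_support_iff.mp hd)
      rw [Finsupp.weight_apply, Finsupp.sum_fintype _ _ (by simp)] at h1
      have h2 : ∑ i, d i • a i ≤ 0 := Finset.sum_nonpos fun i _ => by
        by_cases hi : 0 < a i
        · simp [hcon i hi]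
        · exact smul_nonpos_of_nonneg_of_nonpos (Nat.zero_le _) (not_lt.mp hi)
      lia
    refine Ideal.mem_of_dvd _ (Finset.dvd_prod_of_mem _ (Finsupp.mem_support_iff.mpr hdi)) ?_
    exact Ideal.pow_mem_of_mem _ (Ideal.subset_span (Set.mem_image_of_mem v (show i ∈ {i | 0 < a i} from hi))) _
      (Nat.pos_of_ne_zero hdi)
  · intro h
    change Ideal.span _ = ⊤
    rw [eq_top_iff, ← h, Ideal.span_le]
    rintro _ ⟨i, hi, rfl⟩
    refine Ideal.subset_span ⟨(a i).toNat, by simpa using hi, X i, ?_, aeval_X _ _⟩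
    rw [Int.toNat_of_nonneg (le_of_lt hi)]
    exact isWeightedHomogeneous_X ℂ a i

theorem IsSemistable.map {R R' : Type} [CommRing R] [Algebra ℂ R] [CommRing R'] [Algebra ℂ R']
    {v : Fin n → R} (h : IsSemistable a v) (φ : R →ₐ[ℂ] R') : IsSemistable a fun i => φ (v i) := by
  rw [isSemistable_iff] at h ⊢
  have := congrArg (Ideal.map (φ : R →+* R')) h
  rw [Ideal.map_span, Ideal.map_top, ← Set.image_comp] at this
  exact this

theorem exists_sum_eq_one (p : Pt a) : ∃ u : Fin n → p.R, ∑ i with 0 < a i, u i * p.v i = 1 := by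
  have h : (1 : p.R) ∈ Ideal.span (p.v '' ((Finset.univ.filter fun i => 0 < a i : Finset _) :
      Set (Fin n))) := by
    have h1 := isSemistable_iff.mp p.semistable
    have h2 : ((Finset.univ.filter fun i => 0 < a i : Finset _) : Set (Fin n)) = {i | 0 < a i} := by
      ext; simp
    rw [h2, h1]; trivial
  obtain ⟨u, hu⟩ := (Submodule.mem_span_image_finset_iff_exists_fun p.R).mp h
  refine ⟨fun i => if h : 0 < a i then u ⟨i, by simpa using h⟩ else 0, ?_⟩
  rw [← hu, ← Finset.sum_coe_sort]
  refine Finset.sum_congr rfl fun i _ => ?_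
  have hi : 0 < a i := (Finset.mem_filter.mp i.2).2
  simp [hi]

/-- An element that is killed by powers of the coordinates of positive weight is zero. -/
theorem eq_zero_of_pow_smul (p : Pt a) {M : Type} [AddCommGroup M] [Module p.R M] {m : M}
    (h : ∀ i, 0 < a i → ∃ k : ℕ, p.v i ^ k • m = 0) : m = 0 := by
  have h1 := isSemistable_iff.mp p.semistable
  -- The positive coordinates lie in the radical of the annihilator of `m`; since they generate the
  -- unit ideal, so does the annihilator.
  have h2 : Ideal.span (p.v '' {i | 0 < a i}) ≤ (Submodule.span p.R {m}).annihilator.radical := by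
    rw [Ideal.span_le]
    rintro _ ⟨i, hi, rfl⟩
    obtain ⟨k, hk⟩ := h i hi
    exact ⟨k, (Submodule.mem_annihilator_span_singleton _ _).mpr hk⟩
  rw [h1, top_le_iff, Ideal.radical_eq_top] at h2
  have h3 : (1 : p.R) ∈ (Submodule.span p.R {m}).annihilator := by rw [h2]; trivial
  simpa using (Submodule.mem_annihilator_span_singleton _ _).mp h3

/-- A submodule that contains multiples by powers of the coordinates of positive weight of an
element contains the element. -/
theorem mem_of_pow_smul_mem (p : Pt a) {M : Type} [AddCommGroup M] [Module p.R M]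
    {N : Submodule p.R M} {m : M} (h : ∀ i, 0 < a i → ∃ k : ℕ, p.v i ^ k • m ∈ N) : m ∈ N := by
  rw [← Submodule.Quotient.mk_eq_zero]
  refine eq_zero_of_pow_smul p fun i hi => ?_
  obtain ⟨k, hk⟩ := h i hi
  exact ⟨k, by rwa [← Submodule.Quotient.mk_smul, Submodule.Quotient.mk_eq_zero]⟩

/-- A morphism of points without action of the group. -/
def PtHom.ofAlgHom (r : Fin n → ℤ) {p q : Pt a} (φ : p.R →ₐ[ℂ] q.R)
    (h : ∀ i, φ (p.v i) = q.v i) : PtHom r p q where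
  φ := φ
  l := 1
  s := 1
  act_eq := by
    funext i
    simp [act, h]

/-- The open subscheme where a function is invertible. -/
noncomputable def Pt.away (p : Pt a) (b : p.R) : Pt a where
  R := Localization.Away b
  v i := algebraMap p.R (Localization.Away b) (p.v i)
  semistable := p.semistable.map (IsScalarTower.toAlgHom ℂ p.R (Localization.Away b))

noncomputable instance (p : Pt a) (b : p.R) : Algebra p.R (p.away b).R :=
  inferInstanceAs (Algebra p.R (Localization.Away b))

instance (p : Pt a) (b : p.R) : IsScalarTower ℂ p.R (p.away b).R :=
  inferInstanceAs (IsScalarTower ℂ p.R (Localization.Away b))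

instance (p : Pt a) (b : p.R) : IsLocalization.Away b (p.away b).R :=
  inferInstanceAs (IsLocalization.Away b (Localization.Away b))

/-- Restriction to the open subscheme where a function is invertible. -/
noncomputable def PtHom.toAway (r : Fin n → ℤ) (p : Pt a) (b : p.R) : PtHom r p (p.away b) :=
  PtHom.ofAlgHom r (IsScalarTower.toAlgHom ℂ p.R (p.away b).R) fun _ => rfl

/-- Morphisms from an open subscheme. -/
noncomputable def PtHom.ofAway {p q : Pt a} (h : PtHom r p q) {b : p.R} (hb : IsUnit (h.φ b)) :
    PtHom r (p.away b) q where
  φ := IsLocalization.liftAlgHom (M := Submonoid.powers b) (f := h.φ) (by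
    rintro ⟨_, k, rfl⟩
    rw [map_pow]
    exact hb.pow k)
  l := h.l
  s := h.s
  act_eq := by
    rw [← h.act_eq]
    congr 1
    funext i
    exact IsLocalization.lift_eq (M := Submonoid.powers b) (S := (p.away b).R) _ _

theorem PtHom.toAway_comp_ofAway {p q : Pt a} (h : PtHom r p q) {b : p.R} (hb : IsUnit (h.φ b)) :
    (PtHom.toAway r p b).comp (h.ofAway hb) = h := by
  refine PtHom.ext ?_ ?_ ?_
  · apply AlgHom.ext
    intro x
    exact IsLocalization.lift_eq (M := Submonoid.powers b) (S := (p.away b).R) _ _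
  · simp [PtHom.comp, PtHom.toAway, PtHom.ofAlgHom, PtHom.ofAway]
  · simp [PtHom.comp, PtHom.toAway, PtHom.ofAlgHom, PtHom.ofAway]

variable (E : EqBundle a r)

theorem EqBundle.exists_pow_smul_eq_zero {p : Pt a} {b : p.R} {m : E.M p}
    (h : E.map (PtHom.toAway r p b) m = 0) : ∃ k : ℕ, b ^ k • m = 0 :=
  IsSemilinearBaseChange.exists_pow_smul_eq_zero
    (f := E.map (PtHom.toAway r p b)) b (E.isBaseChange (PtHom.toAway r p b)) h

theorem EqBundle.exists_pow_smul_eq {p : Pt a} {b : p.R} (y : E.M (p.away b)) :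
    ∃ (k : ℕ) (m : E.M p), E.map (PtHom.toAway r p b) m =
      algebraMap p.R (p.away b).R (b ^ k) • y :=
  IsSemilinearBaseChange.exists_pow_smul_eq
    (f := E.map (PtHom.toAway r p b)) b (E.isBaseChange (PtHom.toAway r p b)) y

end points

end GaugedQuotient

/-! ### Homogeneous elements and the universal translate by the torus -/

namespace GaugedQuotient

open CategoryTheory MvPolynomial GradedResolution

section characters

/-- The evaluation of the character of weight `g` at the complex points of the torus. -/
noncomputable def charHom (g : ℤ × ℤ) : ℂˣ × ℂˣ →* ℂ where
  toFun t := (chi t.1 t.2 g : ℂˣ)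
  map_one' := by simp
  map_mul' t t' := by simp [chi_mul_mul]

/-- The element `2` of `ℂˣ` has infinite order, so the values at `(2, 1)` and `(1, 2)` recover both
weights. -/
theorem charHom_injective : Function.Injective charHom := by
  intro g h hgh
  have two : (2 : ℂ) ≠ 0 := by norm_num
  have key : ∀ z z' : ℤ, ((Units.mk0 (2 : ℂ) two ^ z : ℂˣ) : ℂ) = (Units.mk0 (2 : ℂ) two ^ z' : ℂˣ) →
      z = z' := by
    intro z z' hz
    have h1 : ((2 : ℝ) : ℂ) ^ z = ((2 : ℝ) : ℂ) ^ z' := by simpa using hz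
    have h2 : (2 : ℝ) ^ z = (2 : ℝ) ^ z' := by exact_mod_cast h1
    exact zpow_right_injective₀ (by norm_num) (by norm_num) h2
  refine Prod.ext (key _ _ ?_) (key _ _ ?_)
  · simpa [charHom, chi] using DFunLike.congr_fun hgh (Units.mk0 (2 : ℂ) two, 1)
  · simpa [charHom, chi] using DFunLike.congr_fun hgh (1, Units.mk0 (2 : ℂ) two)

/-- Vector-valued combinations of characters of the torus determine their coefficients. -/
theorem eq_zero_of_forall_sum_chi {V : Type} [AddCommGroup V] [Module ℂ V]
    {s : Finset (ℤ × ℤ)} {f : ℤ × ℤ → V}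
    (h : ∀ t : ℂˣ × ℂˣ, ∑ g ∈ s, (chi t.1 t.2 g : ℂ) • f g = 0) : ∀ g ∈ s, f g = 0 := by
  have li := (linearIndependent_monoidHom (ℂˣ × ℂˣ) ℂ).comp charHom charHom_injective
  rw [linearIndependent_iff'] at li
  intro g hg
  -- Linear functionals reduce the claim to Dedekind's independence of scalar characters.
  rw [← Module.forall_dual_apply_eq_zero_iff ℂ]
  intro φ
  refine li s (fun g => φ (f g)) ?_ g hg
  funext t
  have := congrArg φ (h t)
  rw [map_sum, map_zero] at this
  rw [Pi.zero_apply, ← this, Finset.sum_apply]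
  refine Finset.sum_congr rfl fun g _ => ?_
  rw [map_smul, Pi.smul_apply, smul_eq_mul, smul_eq_mul, mul_comm]
  rfl

end characters

section homogeneous

variable {n : ℕ} {a r : Fin n → ℤ} (E : EqBundle a r)

/-- An element of a fibre is homogeneous of degree `g` if the group acts on its images under base
change by the character of weight `g`. -/
def IsHom {p : Pt a} (g : ℤ × ℤ) (e : E.M p) : Prop :=
  ∀ (q : Pt a) (m m' : PtHom r p q),
    (chi m'.l m'.s g : q.R) • E.map m e = (chi m.l m.s g : q.R) • E.map m' e

variable {E}

theorem IsHom.zero {p : Pt a} {g : ℤ × ℤ} : IsHom E g (0 : E.M p) := fun q m m' => by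
  simp

theorem IsHom.add {p : Pt a} {g : ℤ × ℤ} {e e' : E.M p} (h : IsHom E g e) (h' : IsHom E g e') :
    IsHom E g (e + e') := fun q m m' => by
  rw [map_add, map_add, smul_add, smul_add, h q m m', h' q m m']

theorem IsHom.neg {p : Pt a} {g : ℤ × ℤ} {e : E.M p} (h : IsHom E g e) :
    IsHom E g (-e) := fun q m m' => by
  rw [map_neg, map_neg, smul_neg, smul_neg, h q m m']

/-- The value at a point of the polynomial functions. -/
theorem PtHom.map_aeval {p q : Pt a} (m : PtHom r p q) {f : MvPolynomial (Fin n) ℂ} {g : ℤ × ℤ}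
    (hf : IsWeightedHomogeneous (weights a r) f g) :
    aeval q.v f = (chi m.l m.s g : q.R) * m.φ (aeval p.v f) := by
  rw [← m.act_eq, aeval_act m.l m.s _ hf]
  congr 1
  rw [← comp_aeval_apply]

/-- Multiplication by a homogeneous `f` multiplies the failure of `e` to be homogeneous by a unit
times the value of `f`. Hence homogeneity is preserved when the failure is zero, and is created when
`f` annihilates it, as in `IsHom.exists_generic`. -/
theorem map_aeval_smul_sub {p q : Pt a} (m m' : PtHom r p q) (g : ℤ × ℤ) {g' : ℤ × ℤ} (e : E.M p)
    {f : MvPolynomial (Fin n) ℂ} (hf : IsWeightedHomogeneous (weights a r) f g') :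
    (chi m'.l m'.s (g - g') : q.R) • E.map m (aeval p.v f • e) -
      (chi m.l m.s (g - g') : q.R) • E.map m' (aeval p.v f • e) =
    (((chi m'.l m'.s g')⁻¹ : q.Rˣ) * ((chi m.l m.s g')⁻¹ : q.Rˣ) * aeval q.v f : q.R) •
      ((chi m'.l m'.s g : q.R) • E.map m e - (chi m.l m.s g : q.R) • E.map m' e) := by
  have h4 : ∀ k : PtHom r p q, (chi k.l k.s (g - g') : q.R) =
      (chi k.l k.s g : q.R) * ((chi k.l k.s g')⁻¹ : q.Rˣ) := fun k => by
    rw [sub_eq_add_neg, chi_add, chi_neg, Units.val_mul]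
  have h5 : ∀ k : PtHom r p q, k.φ (aeval p.v f) =
      ((chi k.l k.s g')⁻¹ : q.Rˣ) * aeval q.v f := fun k => by
    rw [k.map_aeval hf, ← mul_assoc, Units.inv_mul, one_mul]
  simp only [(E.map _).map_smulₛₗ, h4, RingHom.coe_coe, h5, smul_smul, smul_sub]
  congr 2 <;> ring

/-- The degree drops by `g'` because the pullback of the value of `f` is its value at the new point
divided by the character of weight `g'`. -/
theorem IsHom.aeval_smul {p : Pt a} {g g' : ℤ × ℤ} {e : E.M p} (h : IsHom E g e)
    {f : MvPolynomial (Fin n) ℂ} (hf : IsWeightedHomogeneous (weights a r) f g') :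
    IsHom E (g - g') (aeval p.v f • e) := fun q m m' => by
  rw [← sub_eq_zero, map_aeval_smul_sub m m' g e hf, h q m m', sub_self, smul_zero]

/-- It suffices to test homogeneity on a pair of morphisms through which all pairs factor. -/
theorem IsHom.of_pair {p w : Pt a} {k k' : PtHom r p w}
    (hw : ∀ (q : Pt a) (m m' : PtHom r p q), ∃ h : PtHom r w q, k.comp h = m ∧ k'.comp h = m')
    {g : ℤ × ℤ} {e : E.M p}
    (h : (chi k'.l k'.s g : w.R) • E.map k e = (chi k.l k.s g : w.R) • E.map k' e) :
    IsHom E g e := fun q m m' => by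
  obtain ⟨u, rfl, rfl⟩ := hw q m m'
  have h1 := congrArg (E.map u) h
  rw [(E.map u).map_smulₛₗ, (E.map u).map_smulₛₗ] at h1
  rw [E.map_comp, E.map_comp]
  simp only [PtHom.comp, chi_mul_mul, Units.val_mul, chi_map, mul_smul]
  simp only [RingHom.coe_coe] at h1
  rw [h1, smul_comm]

end homogeneous

section torus

variable {n : ℕ} {a r : Fin n → ℤ}

/-- The coordinate of weight `g` on the torus. -/
noncomputable def torusUnit (R : Type) [CommRing R] (g : ℤ × ℤ) : (AddMonoidAlgebra R (ℤ × ℤ))ˣ where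
  val := AddMonoidAlgebra.single g 1
  inv := AddMonoidAlgebra.single (-g) 1
  val_inv := by simp [AddMonoidAlgebra.single_mul_single, AddMonoidAlgebra.one_def]
  inv_val := by simp [AddMonoidAlgebra.single_mul_single, AddMonoidAlgebra.one_def]

theorem torusUnit_add (R : Type) [CommRing R] (g h : ℤ × ℤ) :
    torusUnit R (g + h) = torusUnit R g * torusUnit R h :=
  Units.ext (by simp [torusUnit, AddMonoidAlgebra.single_mul_single])

/-- The universal element of the torus. -/
theorem chi_torusUnit (R : Type) [CommRing R] (g : ℤ × ℤ) :
    chi (torusUnit R (1, 0)) (torusUnit R (0, 1)) g = torusUnit R g := by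
  let F : Multiplicative (ℤ × ℤ) →* (AddMonoidAlgebra R (ℤ × ℤ))ˣ :=
    { toFun := fun g => torusUnit R g.toAdd
      map_one' := Units.ext rfl
      map_mul' := fun g h => torusUnit_add R _ _ }
  have h1 : ∀ (g : ℤ × ℤ) (z : ℤ), torusUnit R g ^ z = torusUnit R (z • g) := fun g z =>
    (map_zpow F (Multiplicative.ofAdd g) z).symm
  rw [chi, h1, h1, ← torusUnit_add]
  congr 1
  simp

theorem IsSemistable.act {R : Type} [CommRing R] [Algebra ℂ R] {v : Fin n → R}
    (h : IsSemistable a v) (l s : Rˣ) : IsSemistable a (act a r l s v) := by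
  rw [isSemistable_iff] at h ⊢
  rw [eq_top_iff, ← h, Ideal.span_le]
  rintro _ ⟨i, hi, rfl⟩
  have h1 : v i = ((l ^ a i * s ^ r i)⁻¹ : Rˣ) * GaugedQuotient.act a r l s v i := by
    rw [GaugedQuotient.act, Units.inv_mul_cancel_left]
  rw [SetLike.mem_coe, h1]
  exact Ideal.mul_mem_left _ _ (Ideal.subset_span (Set.mem_image_of_mem _ hi))

/-- The translate of a point by the universal element of the torus. -/
noncomputable def Pt.translate (r : Fin n → ℤ) (p : Pt a) : Pt a where
  R := AddMonoidAlgebra p.R (ℤ × ℤ)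
  v := act a r (torusUnit p.R (1, 0)) (torusUnit p.R (0, 1)) fun i =>
    algebraMap p.R (AddMonoidAlgebra p.R (ℤ × ℤ)) (p.v i)
  semistable :=
    (p.semistable.map (IsScalarTower.toAlgHom ℂ p.R (AddMonoidAlgebra p.R (ℤ × ℤ)))).act _ _

/-- The universal translation. -/
noncomputable def PtHom.toTranslate (r : Fin n → ℤ) (p : Pt a) : PtHom r p (p.translate r) where
  φ := IsScalarTower.toAlgHom ℂ p.R (AddMonoidAlgebra p.R (ℤ × ℤ))
  l := torusUnit p.R (1, 0)
  s := torusUnit p.R (0, 1)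
  act_eq := rfl

/-- The characters of the torus, evaluated at a point. -/
def chiHom {R : Type} [CommRing R] (l s : Rˣ) : Multiplicative (ℤ × ℤ) →* R where
  toFun g := (chi l s g.toAdd : R)
  map_one' := by simp
  map_mul' g h := by simp [chi_add]

/-- The specialization of the universal translation. -/
noncomputable def PtHom.translateRingHom {p q : Pt a} (m : PtHom r p q) (l s : q.Rˣ) :
    AddMonoidAlgebra p.R (ℤ × ℤ) →ₐ[ℂ] q.R :=
  -- The universal torus element is specialized to the quotient of `(m.l, m.s)` by `(l, s)`, so that
  -- acting afterwards by `(l, s)` recovers `m`.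
  AddMonoidAlgebra.liftNCAlgHom m.φ (chiHom (m.l * l⁻¹) (m.s * s⁻¹)) fun _ _ => Commute.all _ _

theorem PtHom.translateRingHom_single {p q : Pt a} (m : PtHom r p q) (l s : q.Rˣ) (g : ℤ × ℤ)
    (b : p.R) : m.translateRingHom l s (AddMonoidAlgebra.single g b) =
      m.φ b * (chi (m.l * l⁻¹) (m.s * s⁻¹) g : q.R) :=
  AddMonoidAlgebra.liftNC_single _ _ _ _

theorem PtHom.translateRingHom_algebraMap {p q : Pt a} (m : PtHom r p q) (l s : q.Rˣ) (b : p.R) :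
    m.translateRingHom l s (algebraMap p.R _ b) = m.φ b := by
  rw [AddMonoidAlgebra.coe_algebraMap, Function.comp_apply]
  refine (m.translateRingHom_single l s 0 _).trans ?_
  simp

theorem PtHom.translateRingHom_torusUnit {p q : Pt a} (m : PtHom r p q) (l s : q.Rˣ)
    (g : ℤ × ℤ) : m.translateRingHom l s (torusUnit p.R g : _ˣ) =
      (chi (m.l * l⁻¹) (m.s * s⁻¹) g : q.R) := by
  refine (m.translateRingHom_single l s g _).trans ?_
  simp

theorem PtHom.translateRingHom_act {p q : Pt a} (m : PtHom r p q) (l s : q.Rˣ) (i : Fin n) :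
    m.translateRingHom l s (act a r (torusUnit p.R (1, 0)) (torusUnit p.R (0, 1)) (fun i =>
    algebraMap p.R (AddMonoidAlgebra p.R (ℤ × ℤ)) (p.v i)) i) =
      (chi (m.l * l⁻¹) (m.s * s⁻¹) (a i, r i) : q.R) * m.φ (p.v i) := by
  have h1 : (torusUnit p.R (1, 0)) ^ a i * (torusUnit p.R (0, 1)) ^ r i =
      torusUnit p.R (a i, r i) := chi_torusUnit p.R (a i, r i)
  rw [act, h1, map_mul, translateRingHom_algebraMap, translateRingHom_torusUnit]

/-- Morphisms from the universal translate of a point. -/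
noncomputable def PtHom.ofTranslate {p q : Pt a} (m : PtHom r p q) (l s : q.Rˣ) :
    PtHom r (p.translate r) q where
  φ := m.translateRingHom l s
  l := l
  s := s
  act_eq := by
    rw [← m.act_eq]
    funext i
    refine (congrArg (((l ^ a i * s ^ r i : q.Rˣ) : q.R) * ·)
      (m.translateRingHom_act l s i)).trans ?_
    rw [act, ← mul_assoc, ← Units.val_mul]
    congr 2
    simp only [chi, mul_zpow, inv_zpow]
    rw [mul_mul_mul_comm, mul_comm (m.l ^ a i), mul_comm (m.s ^ r i), mul_inv_cancel_left,
      mul_inv_cancel_left]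

/-- Any morphism factors through the universal translate with an arbitrarily prescribed torus
element in the second factor; this is how a second morphism with that torus element is compared with
`m`. -/
theorem PtHom.toTranslate_comp_ofTranslate {p q : Pt a} (m : PtHom r p q) (l s : q.Rˣ) :
    (PtHom.toTranslate r p).comp (m.ofTranslate l s) = m := by
  refine PtHom.ext (AlgHom.ext fun b => m.translateRingHom_algebraMap l s b) (Units.ext ?_)
    (Units.ext ?_)
  · refine (congrArg ((l : q.R) * ·) (m.translateRingHom_torusUnit l s (1, 0))).trans ?_
    simp [chi, mul_comm (m.l : q.R)]
  · refine (congrArg ((s : q.R) * ·) (m.translateRingHom_torusUnit l s (0, 1))).trans ?_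
    simp [chi, mul_comm (m.s : q.R)]

/-- The images of the coordinates are determined by the target and the torus element, so only
functions other than the coordinates can distinguish such morphisms. -/
theorem PtHom.φ_v_eq {p p' q : Pt a} (m : PtHom r p q) (m' : PtHom r p' q) (hl : m.l = m'.l)
    (hs : m.s = m'.s) (i : Fin n) : m.φ (p.v i) = m'.φ (p'.v i) := by
  have h := (congrFun m.act_eq i).trans (congrFun m'.act_eq i).symm
  rw [act, act, hl, hs] at h
  exact (Units.mul_right_inj _).mp h

theorem PtHom.φ_v {p q : Pt a} (m : PtHom r p q) (hl : m.l = 1)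
    (hs : m.s = 1) (i : Fin n) : m.φ (p.v i) = q.v i := by
  have h := congrFun m.act_eq i
  simpa [act, hl, hs] using h

end torus

section chart

variable {n : ℕ} {a r : Fin n → ℤ}

/-- The open subscheme of `V` where a coordinate is invertible. -/
noncomputable def Pt.chart (a : Fin n → ℤ) (i : Fin n) (hi : 0 < a i) : Pt a where
  R := Localization.Away (X i : MvPolynomial (Fin n) ℂ)
  v j := algebraMap (MvPolynomial (Fin n) ℂ) _ (X j)
  semistable := isSemistable_iff.mpr <| Ideal.eq_top_of_isUnit_mem _
    (Ideal.subset_span (Set.mem_image_of_mem _ (show i ∈ {i | 0 < a i} from hi)))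
    (IsLocalization.Away.algebraMap_isUnit (X i : MvPolynomial (Fin n) ℂ))

variable {i : Fin n} {hi : 0 < a i}

noncomputable instance : Algebra (MvPolynomial (Fin n) ℂ) (Pt.chart a i hi).R :=
  inferInstanceAs (Algebra _ (Localization.Away (X i : MvPolynomial (Fin n) ℂ)))

instance : IsScalarTower ℂ (MvPolynomial (Fin n) ℂ) (Pt.chart a i hi).R :=
  inferInstanceAs (IsScalarTower ℂ _ (Localization.Away (X i : MvPolynomial (Fin n) ℂ)))

instance : IsLocalization.Away (X i : MvPolynomial (Fin n) ℂ) (Pt.chart a i hi).R :=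
  inferInstanceAs (IsLocalization.Away (X i : MvPolynomial (Fin n) ℂ) (Localization.Away (X i : MvPolynomial (Fin n) ℂ)))

theorem Pt.chart_v (j : Fin n) : (Pt.chart a i hi).v j =
    algebraMap (MvPolynomial (Fin n) ℂ) _ (X j) := rfl

theorem Pt.isUnit_chart_v : IsUnit ((Pt.chart a i hi).v i) :=
  IsLocalization.Away.algebraMap_isUnit (S := (Pt.chart a i hi).R) (X i : MvPolynomial (Fin n) ℂ)

theorem Pt.chart_aeval (f : MvPolynomial (Fin n) ℂ) :
    aeval (Pt.chart a i hi).v f = algebraMap _ (Pt.chart a i hi).R f := by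
  have : aeval (Pt.chart a i hi).v =
      IsScalarTower.toAlgHom ℂ (MvPolynomial (Fin n) ℂ) (Pt.chart a i hi).R :=
    MvPolynomial.algHom_ext fun j => by rw [aeval_X]; rfl
  rw [this]; rfl

theorem Pt.chart_algHom_ext {R : Type} [CommRing R] [Algebra ℂ R]
    {φ φ' : (Pt.chart a i hi).R →ₐ[ℂ] R}
    (h : ∀ j, φ ((Pt.chart a i hi).v j) = φ' ((Pt.chart a i hi).v j)) : φ = φ' := by
  apply IsLocalization.algHom_ext (Submonoid.powers (X i : MvPolynomial (Fin n) ℂ))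
  exact MvPolynomial.algHom_ext h

/-- Points where a coordinate is invertible lie in the corresponding chart. -/
noncomputable def PtHom.ofChart (r : Fin n → ℤ) (i : Fin n) (hi : 0 < a i) {q : Pt a}
    (hq : IsUnit (q.v i)) : PtHom r (Pt.chart a i hi) q :=
  PtHom.ofAlgHom r (IsLocalization.liftAlgHom
    (M := Submonoid.powers (X i : MvPolynomial (Fin n) ℂ)) (f := aeval q.v) (by
    rintro ⟨_, k, rfl⟩
    rw [map_pow, aeval_X]
    exact hq.pow k)) fun j => by
      refine (IsLocalization.lift_eq (M := Submonoid.powers (X i : MvPolynomial (Fin n) ℂ))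
        (S := (Pt.chart a i hi).R) _ _).trans (aeval_X _ _)

end chart

end GaugedQuotient

/-! ### Homogeneous decomposition of sections over a chart -/

namespace GaugedQuotient

open CategoryTheory MvPolynomial GradedResolution

variable {n : ℕ} {a r : Fin n → ℤ}

theorem eq_zero_of_forall_sum_chi_smul {R V : Type} [CommRing R] [Algebra ℂ R] [AddCommGroup V]
    [Module R V] {s : Finset (ℤ × ℤ)} {f : ℤ × ℤ → V}
    (h : ∀ t : ℂˣ × ℂˣ, ∑ g ∈ s, algebraMap ℂ R (chi t.1 t.2 g : ℂˣ) • f g = 0) :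
    ∀ g ∈ s, f g = 0 := by
  let _ : Module ℂ V := Module.compHom V (algebraMap ℂ R)
  exact eq_zero_of_forall_sum_chi h

section scalars

/-- The point obtained by the action of the group. -/
def Pt.actPt (r : Fin n → ℤ) (p : Pt a) (l s : p.R ˣ) : Pt a where
  R := p.R
  v := act a r l s p.v
  semistable := p.semistable.act l s

/-- The morphism back from the point obtained by the action of the group. -/
def PtHom.ofActPt (r : Fin n → ℤ) (p : Pt a) (l s : p.R ˣ) : PtHom r (p.actPt r l s) p where
  φ := AlgHom.id ℂ p.R
  l := l⁻¹
  s := s⁻¹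
  act_eq := by
    funext i
    change ((l⁻¹ ^ a i * s⁻¹ ^ r i : p.Rˣ) : p.R) *
      (((l ^ a i * s ^ r i : p.Rˣ) : p.R) * p.v i) = _
    rw [inv_zpow, inv_zpow, ← mul_inv, Units.inv_mul_cancel_left]

/-- The morphism to the point obtained by the action of the group. -/
def PtHom.toActPt (r : Fin n → ℤ) (p : Pt a) (l s : p.R ˣ) : PtHom r p (p.actPt r l s) where
  φ := AlgHom.id ℂ p.R
  l := l
  s := s
  act_eq := rfl

theorem PtHom.toActPt_comp_ofActPt (p : Pt a) (l s : p.R ˣ) :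
    (PtHom.toActPt r p l s).comp (PtHom.ofActPt r p l s) = PtHom.id r p := by
  refine PtHom.ext rfl (Units.ext ?_) (Units.ext ?_)
  · exact Units.inv_mul l
  · exact Units.inv_mul s

/-- A complex number as a unit of the coordinate ring of a point. -/
def Pt.scalar (p : Pt a) (l : ℂˣ) : p.Rˣ := Units.map (algebraMap ℂ p.R : ℂ →* p.R) l

theorem Pt.chi_scalar (p : Pt a) (l s : ℂˣ) (g : ℤ × ℤ) :
    (chi (p.scalar l) (p.scalar s) g : p.R) = algebraMap ℂ p.R (chi l s g : ℂˣ) :=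
  chi_map (Algebra.ofId ℂ p.R) l s g

end scalars

section chart

/-- The coordinate of weight `g` on the torus, as a function on the universal translate. -/
noncomputable def Pt.translateUnit (r : Fin n → ℤ) (p : Pt a) (g : ℤ × ℤ) : (p.translate r).Rˣ :=
  torusUnit p.R g

theorem single_mul_algebraMap {R : Type} [CommRing R] (b : R) (g h : ℤ × ℤ) :
    AddMonoidAlgebra.single (-(g - h)) 1 * algebraMap R (AddMonoidAlgebra R (ℤ × ℤ)) b =
      AddMonoidAlgebra.single h b * AddMonoidAlgebra.single (-g) 1 := by
  rw [AddMonoidAlgebra.coe_algebraMap, Function.comp_apply,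
    AddMonoidAlgebra.single_mul_single, AddMonoidAlgebra.single_mul_single, neg_sub, add_zero,
    sub_eq_add_neg, mul_one, one_mul]
  rfl

theorem chi_inv_inv {R : Type} [CommRing R] (l s : Rˣ) (g : ℤ × ℤ) :
    chi l⁻¹ s⁻¹ g = (chi l s g)⁻¹ := by
  simp [chi, mul_comm]

variable (E : EqBundle a r)

/-- The fibre over the translate is the base change to the group algebra of `ℤ × ℤ`, spanned by the
image of the original fibre. Sums of monomials times such images are closed under multiplication by
the group algebra. -/
theorem EqBundle.exists_coeff_translate {p : Pt a} (y : E.M (p.translate r)) :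
    ∃ f : (ℤ × ℤ) →₀ E.M p, y = f.sum fun g e =>
      (p.translateUnit r (-g) : (p.translate r).R) • E.map (PtHom.toTranslate r p) e := by
  let Φ : ((ℤ × ℤ) →₀ E.M p) →+ E.M (p.translate r) := Finsupp.liftAddHom fun g =>
    (DistribSMul.toAddMonoidHom (E.M (p.translate r))
      (p.translateUnit r (-g) : (p.translate r).R)).comp
      (E.map (PtHom.toTranslate r p)).toAddMonoidHom
  have hs : ∀ g e, Φ (Finsupp.single g e) =
      (p.translateUnit r (-g) : (p.translate r).R) • E.map (PtHom.toTranslate r p) e :=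
    fun g e => Finsupp.liftAddHom_apply_single _ _ _
  have hc : ∀ (c : AddMonoidAlgebra p.R (ℤ × ℤ)) (f : (ℤ × ℤ) →₀ E.M p),
      (show (p.translate r).R from c) • Φ f ∈ Φ.range := by
    intro c f
    induction f using Finsupp.induction_linear with
    | zero => rw [map_zero, smul_zero]; exact zero_mem _
    | add f f' h h' => rw [map_add, smul_add]; exact add_mem h h'
    | single g e =>
      induction c using AddMonoidAlgebra.induction_linear with
      | zero => exact (zero_smul (p.translate r).R (Φ _)).symm ▸ zero_mem _
      | add c c' h h' => exact (add_smul (R := (p.translate r).R) c c' (Φ _)).symm ▸ add_mem h h'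
      | single h b =>
        refine ⟨Finsupp.single (g - h) (b • e), ?_⟩
        rw [hs, hs, (E.map _).map_smulₛₗ, smul_smul, smul_smul]
        congr 1
        exact single_mul_algebraMap b g h
  have hy : y ∈ Submodule.span (p.translate r).R (Set.range (E.map (PtHom.toTranslate r p))) := by
    rw [(E.isBaseChange _).span_range]; trivial
  have hr : y ∈ Φ.range := by
    induction hy using Submodule.span_induction with
    | mem x hx =>
      obtain ⟨e, rfl⟩ := hx
      refine ⟨Finsupp.single 0 e, ?_⟩
      rw [hs]
      convert one_smul (p.translate r).R _
      exact congrArg (fun g => AddMonoidAlgebra.single g (1 : p.R)) neg_zero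
    | zero => exact zero_mem _
    | add x x' _ _ h h' => exact add_mem h h'
    | smul c x _ h =>
      obtain ⟨f, rfl⟩ := h
      exact hc c f
  obtain ⟨f, rfl⟩ := hr
  exact ⟨f, rfl⟩

variable {i : Fin n} {hi : 0 < a i}

theorem Pt.isUnit_translate_v {p : Pt a} (h : IsUnit (p.v i)) : IsUnit ((p.translate r).v i) :=
  IsUnit.mul (Units.isUnit _) (h.map (algebraMap p.R (AddMonoidAlgebra p.R (ℤ × ℤ))))

/-- A morphism out of a chart is determined by its torus element, since the chart is generated by
the coordinates and an inverse. So one universal expansion over the translate controls all pairs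
`m`, `m'`. -/
theorem PtHom.exists_chart_pair (q : Pt a) (m m' : PtHom r (Pt.chart a i hi) q) :
    (PtHom.ofChart r i hi (Pt.isUnit_translate_v Pt.isUnit_chart_v)).comp
      (m.ofTranslate m'.l m'.s) = m' := by
  have hl : ((PtHom.ofChart r i hi (Pt.isUnit_translate_v Pt.isUnit_chart_v)).comp
      (m.ofTranslate m'.l m'.s)).l = m'.l := by
    simp [PtHom.comp, PtHom.ofChart, PtHom.ofAlgHom, PtHom.ofTranslate]
  have hs : ((PtHom.ofChart r i hi (Pt.isUnit_translate_v Pt.isUnit_chart_v)).comp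
      (m.ofTranslate m'.l m'.s)).s = m'.s := by
    simp [PtHom.comp, PtHom.ofChart, PtHom.ofAlgHom, PtHom.ofTranslate]
  exact PtHom.ext (Pt.chart_algHom_ext fun j => PtHom.φ_v_eq _ _ hl hs j) hl hs

/-- The coaction of the torus on the sections over a chart. -/
theorem EqBundle.exists_coeff_chart (e : E.M (Pt.chart a i hi)) :
    ∃ f : (ℤ × ℤ) →₀ E.M (Pt.chart a i hi), ∀ (q : Pt a) (m m' : PtHom r (Pt.chart a i hi) q),
      E.map m' e = f.sum fun g x =>
        (chi (m.l * m'.l⁻¹) (m.s * m'.s⁻¹) (-g) : q.R) • E.map m x := by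
  obtain ⟨f, hf⟩ := E.exists_coeff_translate
    (E.map (PtHom.ofChart r i hi (Pt.isUnit_translate_v Pt.isUnit_chart_v)) e)
  refine ⟨f, fun q m m' => ?_⟩
  have h := congrArg (E.map (m.ofTranslate m'.l m'.s)) hf
  rw [← E.map_comp, PtHom.exists_chart_pair, Finsupp.sum, map_sum] at h
  rw [h, Finsupp.sum]
  refine Finset.sum_congr rfl fun g _ => ?_
  rw [(E.map _).map_smulₛₗ, ← E.map_comp, PtHom.toTranslate_comp_ofTranslate]
  congr 1
  exact m.translateRingHom_torusUnit _ _ _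

/-- The action of a complex point of the torus on a chart. -/
noncomputable def PtHom.chartAct (r : Fin n → ℤ) (i : Fin n) (hi : 0 < a i) (t : ℂˣ × ℂˣ) :
    PtHom r (Pt.chart a i hi) (Pt.chart a i hi) :=
  (PtHom.ofChart r i hi (q := (Pt.chart a i hi).actPt r ((Pt.chart a i hi).scalar t.1)
    ((Pt.chart a i hi).scalar t.2)) ((Units.isUnit _).mul Pt.isUnit_chart_v)).comp
    (PtHom.ofActPt r _ _ _)

theorem PtHom.chartAct_l (t : ℂˣ × ℂˣ) :
    (PtHom.chartAct r i hi t).l = ((Pt.chart a i hi).scalar t.1)⁻¹ := by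
  simp [chartAct, comp, ofChart, ofAlgHom, ofActPt]

theorem PtHom.chartAct_s (t : ℂˣ × ℂˣ) :
    (PtHom.chartAct r i hi t).s = ((Pt.chart a i hi).scalar t.2)⁻¹ := by
  simp [chartAct, comp, ofChart, ofAlgHom, ofActPt]

theorem Pt.scalar_mul (p : Pt a) (l l' : ℂˣ) : p.scalar (l * l') = p.scalar l * p.scalar l' :=
  map_mul _ _ _

/-- Over a chart, a bundle has homogeneous generators. -/
theorem EqBundle.exists_isHom_chart (e : E.M (Pt.chart a i hi)) :
    ∃ f : (ℤ × ℤ) →₀ E.M (Pt.chart a i hi), (e = f.sum fun _ x => x) ∧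
      ∀ g, IsHom E g (f g) := by
  have chi_eq : ∀ (t : ℂˣ × ℂˣ) (g : ℤ × ℤ),
      (chi ((Pt.chart a i hi).scalar t.1) ((Pt.chart a i hi).scalar t.2) (-g) : (Pt.chart a i hi).R) =
        algebraMap ℂ (Pt.chart a i hi).R (chi t⁻¹.1 t⁻¹.2 g : ℂˣ) := fun t g => by
    rw [(Pt.chart a i hi).chi_scalar]
    congr 2
    rw [chi_neg, ← chi_inv_inv]
    rfl
  have h0 : ∀ (e : E.M (Pt.chart a i hi)) (f : (ℤ × ℤ) →₀ E.M (Pt.chart a i hi)), (∀ (q : Pt a) (m m' : PtHom r (Pt.chart a i hi) q),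
      E.map m' e = f.sum fun g x =>
        (chi (m.l * m'.l⁻¹) (m.s * m'.s⁻¹) (-g) : q.R) • E.map m x) → ∀ t : ℂˣ × ℂˣ,
      E.map (PtHom.chartAct r i hi t) e = f.sum fun g x =>
        algebraMap ℂ (Pt.chart a i hi).R (chi t⁻¹.1 t⁻¹.2 g : ℂˣ) • x := fun e f hf t => by
    rw [hf _ (PtHom.id r (Pt.chart a i hi))]
    refine Finset.sum_congr rfl fun g _ => ?_
    dsimp only
    rw [E.map_id, ← chi_eq, PtHom.chartAct_l, PtHom.chartAct_s, inv_inv, inv_inv]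
    simp [PtHom.id]
  obtain ⟨f, hf⟩ := E.exists_coeff_chart e
  have hA : ∀ (t : ℂˣ × ℂˣ) (g : ℤ × ℤ), E.map (PtHom.chartAct r i hi t) (f g) =
      algebraMap ℂ (Pt.chart a i hi).R (chi t⁻¹.1 t⁻¹.2 g : ℂˣ) • f g := by
    intro t
    -- The action of `t * t'⁻¹` on `e` is expanded in two ways, with and without passing through the
    -- action of `t`. As this holds for all `t'`, independence of characters compares the two
    -- expansions term by term.
    have key : ∀ g ∈ f.support, E.map (PtHom.chartAct r i hi t) (f g) -
      algebraMap ℂ (Pt.chart a i hi).R (chi t⁻¹.1 t⁻¹.2 g : ℂˣ) • f g = 0 := by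
      refine eq_zero_of_forall_sum_chi_smul (R := (Pt.chart a i hi).R) fun t' => ?_
      have h1 := hf _ (PtHom.chartAct r i hi t) (PtHom.chartAct r i hi (t * t'⁻¹))
      rw [h0 e f hf] at h1
      simp only [smul_sub, Finset.sum_sub_distrib]
      rw [sub_eq_zero]
      refine Eq.trans ?_ (h1.symm.trans ?_)
      · refine Finset.sum_congr rfl fun g _ => ?_
        rw [PtHom.chartAct_l, PtHom.chartAct_s, PtHom.chartAct_l, PtHom.chartAct_s, inv_inv,
          inv_inv, Prod.fst_mul, Prod.snd_mul, Pt.scalar_mul, Pt.scalar_mul, inv_mul_cancel_left,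
          inv_mul_cancel_left]
        congr 1
        have := chi_eq t'⁻¹ g
        rw [inv_inv] at this
        exact this.symm
      · refine Finset.sum_congr rfl fun g _ => ?_
        rw [smul_smul, ← map_mul, ← Units.val_mul, ← chi_mul_mul]
        congr 4
    intro g
    by_cases hg : g ∈ f.support
    · exact sub_eq_zero.mp (key g hg)
    · rw [Finsupp.notMem_support_iff.mp hg, map_zero, smul_zero]
  refine ⟨f, ?_, fun g q m m' => ?_⟩
  · have := hf _ (PtHom.id r (Pt.chart a i hi)) (PtHom.id r (Pt.chart a i hi))
    simpa only [E.map_id, mul_inv_cancel, chi_one_one, Units.val_one, one_smul] using this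
  obtain ⟨f', hf'⟩ := E.exists_coeff_chart (f g)
  -- Being an eigenvector for the complex points of the torus forces, again by independence of
  -- characters, the whole coaction of `f g` to be concentrated in `g`. This gives homogeneity over
  -- arbitrary rings.
  have hf'' : f' = Finsupp.single g (f g) := by
    rw [← sub_eq_zero]
    ext h
    by_contra hne
    refine hne (eq_zero_of_forall_sum_chi_smul (R := (Pt.chart a i hi).R)
      (s := (f' - Finsupp.single g (f g)).support) (fun t => ?_) h (Finsupp.mem_support_iff.mpr hne))
    have h1 := h0 (f g) f' hf' t⁻¹
    rw [hA, inv_inv] at h1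
    change ((f' - Finsupp.single g (f g)).sum fun g x => algebraMap ℂ (Pt.chart a i hi).R (chi t.1 t.2 g : ℂˣ) • x) = 0
    rw [Finsupp.sum_sub_index (fun _ _ _ => smul_sub _ _ _), ← h1,
      Finsupp.sum_single_index (by rw [smul_zero]), sub_self]
  have h2 := hf' q m m'
  rw [hf'', Finsupp.sum_single_index (by rw [map_zero, smul_zero])] at h2
  rw [h2, smul_smul, ← Units.val_mul, chi_mul_mul, chi_inv_inv, chi_neg, chi_neg, inv_inv,
    mul_inv_cancel_left]

end chart

end GaugedQuotient

/-! ### A universal semistable point and universal pairs of morphisms -/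

namespace GaugedQuotient

open CategoryTheory MvPolynomial GradedResolution

variable {n : ℕ} {a r : Fin n → ℤ}

section adjoin

variable {R : Type} [CommRing R] [Algebra ℂ R] {v : Fin n → R}

/-- The ring of the universal expression of `1` as a combination of the coordinates of positive
weight. -/
def AdjoinRing (a : Fin n → ℤ) (v : Fin n → R) : Type :=
  MvPolynomial (Fin n) R ⧸ Ideal.span {∑ i with 0 < a i, X i * C (v i) - (1 : MvPolynomial (Fin n) R)}

noncomputable instance : CommRing (AdjoinRing a v) :=
  inferInstanceAs (CommRing (MvPolynomial (Fin n) R ⧸ _))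

noncomputable instance : Algebra ℂ (AdjoinRing a v) :=
  inferInstanceAs (Algebra ℂ (MvPolynomial (Fin n) R ⧸ _))

namespace AdjoinRing

/-- The structure map. -/
noncomputable def of : R →ₐ[ℂ] AdjoinRing a v :=
  (Ideal.Quotient.mkₐ ℂ (Ideal.span
    {∑ i with 0 < a i, X i * C (v i) - (1 : MvPolynomial (Fin n) R)})).comp
    (IsScalarTower.toAlgHom ℂ R (MvPolynomial (Fin n) R))

/-- The universal coefficients. -/
noncomputable def coeff (i : Fin n) : AdjoinRing a v :=
  Ideal.Quotient.mk (Ideal.span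
    {∑ i with 0 < a i, X i * C (v i) - (1 : MvPolynomial (Fin n) R)}) (X i)

theorem sum_coeff_mul : ∑ i with 0 < a i, (coeff i : AdjoinRing a v) * of (v i) = 1 := by
  have h := (Ideal.Quotient.eq (I := Ideal.span
    {∑ i with 0 < a i, X i * C (v i) - (1 : MvPolynomial (Fin n) R)})
    (x := ∑ i with 0 < a i, X i * C (v i)) (y := 1)).mpr (Ideal.subset_span rfl)
  rw [map_sum, map_one] at h
  refine Eq.trans (Finset.sum_congr rfl fun i _ => ?_) h
  exact (map_mul (Ideal.Quotient.mk _) _ _).symm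

variable {B : Type} [CommRing B] [Algebra ℂ B]

/-- The universal property. -/
noncomputable def lift (φ : R →ₐ[ℂ] B) (u : Fin n → B)
    (h : ∑ i with 0 < a i, u i * φ (v i) = 1) : AdjoinRing a v →ₐ[ℂ] B :=
  Ideal.Quotient.liftₐ _ (aevalTower φ u) (by
    intro x hx
    have hle : Ideal.span {∑ i with 0 < a i, X i * C (v i) - (1 : MvPolynomial (Fin n) R)} ≤
        RingHom.ker (aevalTower φ u) := by
      rw [Ideal.span_le, Set.singleton_subset_iff]
      change aevalTower φ u _ = 0
      simp [h]
    exact hle hx)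

@[simp]
theorem lift_of (φ : R →ₐ[ℂ] B) (u : Fin n → B)
    (h : ∑ i with 0 < a i, u i * φ (v i) = 1) (b : R) : lift φ u h (of b) = φ b :=
  aevalTower_C _ _ _

@[simp]
theorem lift_coeff (φ : R →ₐ[ℂ] B) (u : Fin n → B)
    (h : ∑ i with 0 < a i, u i * φ (v i) = 1) (i : Fin n) : lift φ u h (coeff i) = u i :=
  aevalTower_X _ _ _

theorem algHom_ext {f g : AdjoinRing a v →ₐ[ℂ] B} (h : ∀ b : R, f (of b) = g (of b))
    (h' : ∀ i, f (coeff i) = g (coeff i)) : f = g := by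
  refine Ideal.Quotient.algHom_ext ℂ (AlgHom.ext fun x => ?_)
  induction x using MvPolynomial.induction_on with
  | C b => exact h b
  | add x y hx hy => rw [map_add, map_add, hx, hy]
  | mul_X x i hx =>
    rw [map_mul, map_mul, hx]
    exact congrArg _ (h' i)

end AdjoinRing

/-- The universal point over a given point of `V` with an expression of `1` as a combination of
the coordinates of positive weight. -/
noncomputable def Pt.adjoin (a : Fin n → ℤ) (v : Fin n → R) : Pt a where
  R := AdjoinRing a v
  v i := AdjoinRing.of (v i)
  semistable := by
    rw [isSemistable_iff, Ideal.eq_top_iff_one, ← AdjoinRing.sum_coeff_mul]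
    refine sum_mem fun i hi => Ideal.mul_mem_left _ _ (Ideal.subset_span ?_)
    exact Set.mem_image_of_mem _ (show i ∈ {i | 0 < a i} by simpa using hi)

/-- Morphisms from the universal point. -/
noncomputable def PtHom.ofAdjoin {q : Pt a} (φ : R →ₐ[ℂ] q.R) (l s : q.Rˣ)
    (hφ : act a r l s (fun i => φ (v i)) = q.v) (u : Fin n → q.R)
    (hu : ∑ i with 0 < a i, u i * φ (v i) = 1) : PtHom r (Pt.adjoin a v) q where
  φ := AdjoinRing.lift φ u hu
  l := l
  s := s
  act_eq := by
    rw [← hφ]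
    congr 1
    funext i
    exact AdjoinRing.lift_of _ _ _ _

end adjoin

section generic

/-- The universal semistable point with an expression of `1` as a combination of the coordinates of
positive weight. -/
noncomputable def Pt.generic (a : Fin n → ℤ) : Pt a :=
  Pt.adjoin a (X : Fin n → MvPolynomial (Fin n) ℂ)

/-- The semistable locus need not be affine, so its points are covered by an affine ring that also
records coefficients `u` expressing `1` in the positive coordinates. Such coefficients exist at
every semistable point but are not unique. -/
theorem exists_ofGeneric (r : Fin n → ℤ) (q : Pt a) :
    ∃ m : PtHom r (Pt.generic a) q, m.l = 1 ∧ m.s = 1 := by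
  obtain ⟨u, hu⟩ := exists_sum_eq_one q
  exact ⟨PtHom.ofAdjoin (aeval q.v) 1 1 (by funext i; simp [act]) u (by simpa using hu), rfl, rfl⟩

/-- A morphism from the universal semistable point that does not act. -/
noncomputable def PtHom.ofGeneric (r : Fin n → ℤ) (q : Pt a) : PtHom r (Pt.generic a) q :=
  (exists_ofGeneric r q).choose

@[simp]
theorem PtHom.ofGeneric_l (q : Pt a) : (PtHom.ofGeneric r q).l = 1 :=
  (exists_ofGeneric r q).choose_spec.1

@[simp]
theorem PtHom.ofGeneric_s (q : Pt a) : (PtHom.ofGeneric r q).s = 1 :=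
  (exists_ofGeneric r q).choose_spec.2

/-- The universal point with two morphisms from the universal semistable point. -/
noncomputable def Pt.genericPair (a r : Fin n → ℤ) : Pt a :=
  Pt.adjoin a ((Pt.generic a).translate r).v

/-- The forgetful morphism. -/
noncomputable def PtHom.toAdjoin (r : Fin n → ℤ) (q : Pt a) : PtHom r q (Pt.adjoin a q.v) :=
  PtHom.ofAlgHom r AdjoinRing.of fun _ => rfl

/-- The first morphism to the universal pair. -/
noncomputable def PtHom.toGenericPair₁ (a r : Fin n → ℤ) :
    PtHom r (Pt.generic a) (Pt.genericPair a r) :=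
  (PtHom.toTranslate r _).comp (PtHom.toAdjoin r _)

theorem sum_coeff_genericPair (a r : Fin n → ℤ) : ∑ i with 0 < a i,
    (show (Pt.genericPair a r).R from AdjoinRing.coeff i) *
      aeval (Pt.genericPair a r).v (X i : MvPolynomial (Fin n) ℂ) = 1 := by
  simp only [aeval_X]
  exact AdjoinRing.sum_coeff_mul

/-- The second morphism to the universal pair. -/
noncomputable def PtHom.toGenericPair₂ (a r : Fin n → ℤ) :
    PtHom r (Pt.generic a) (Pt.genericPair a r) :=
  PtHom.ofAdjoin (aeval (Pt.genericPair a r).v) 1 1 (by funext i; simp [act])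
    (AdjoinRing.coeff (v := ((Pt.generic a).translate r).v)) (sum_coeff_genericPair a r)

theorem PtHom.toGenericPair₂_coeff (i : Fin n) :
    (PtHom.toGenericPair₂ a r).φ (AdjoinRing.coeff i) =
      (AdjoinRing.coeff i : AdjoinRing a ((Pt.generic a).translate r).v) :=
  AdjoinRing.lift_coeff (a := a) (v := (X : Fin n → MvPolynomial (Fin n) ℂ)) _ _
    (sum_coeff_genericPair a r) _

theorem PtHom.comp_assoc {p q q' q'' : Pt a} (h : PtHom r p q) (h' : PtHom r q q')
    (h'' : PtHom r q' q'') : (h.comp h').comp h'' = h.comp (h'.comp h'') := by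
  refine PtHom.ext rfl (Units.ext ?_) (Units.ext ?_) <;> simp [PtHom.comp, mul_assoc]

theorem PtHom.generic_ext {q : Pt a} {m m' : PtHom r (Pt.generic a) q} (hl : m.l = m'.l)
    (hs : m.s = m'.s) (h : ∀ i, m.φ (AdjoinRing.coeff i) = m'.φ (AdjoinRing.coeff i)) : m = m' := by
  refine PtHom.ext (AdjoinRing.algHom_ext (fun b => ?_) h) hl hs
  have h1 : m.φ.comp AdjoinRing.of = m'.φ.comp AdjoinRing.of :=
    MvPolynomial.algHom_ext fun j => PtHom.φ_v_eq m m' hl hs j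
  exact DFunLike.congr_fun h1 b

/-- A pair of morphisms from the universal point amounts to one morphism, the torus element of the
other, and a second set of coefficients. The pair ring adjoins exactly these, so homogeneity can be
tested over this one point. -/
theorem PtHom.exists_genericPair (q : Pt a) (m m' : PtHom r (Pt.generic a) q) :
    ∃ h : PtHom r (Pt.genericPair a r) q, (PtHom.toGenericPair₁ a r).comp h = m ∧
      (PtHom.toGenericPair₂ a r).comp h = m' := by
  have hu : ∑ i with 0 < a i, m'.φ (AdjoinRing.coeff i) *
      (m.ofTranslate m'.l m'.s).φ (((Pt.generic a).translate r).v i) = 1 := by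
    have h0 : ∑ i with 0 < a i, (show (Pt.generic a).R from AdjoinRing.coeff i) *
        (Pt.generic a).v i = 1 :=
      AdjoinRing.sum_coeff_mul
    have h1 := congrArg m'.φ h0
    rw [map_one] at h1
    refine Eq.trans ?_ h1
    rw [map_sum]
    refine Finset.sum_congr rfl fun i _ => ?_
    rw [map_mul]
    congr 1
    exact PtHom.φ_v_eq (m.ofTranslate m'.l m'.s) m' rfl rfl i
  let h : PtHom r (Pt.genericPair a r) q := PtHom.ofAdjoin (m.ofTranslate m'.l m'.s).φ m'.l m'.s
    (m.ofTranslate m'.l m'.s).act_eq _ hu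
  refine ⟨h, ?_, ?_⟩
  · have h1 : (PtHom.toAdjoin r _).comp h = m.ofTranslate m'.l m'.s := by
      refine PtHom.ext (AlgHom.ext fun b => AdjoinRing.lift_of _ _ hu b) (Units.ext ?_) (Units.ext ?_)
      · simp [PtHom.comp, PtHom.toAdjoin, PtHom.ofAlgHom]; rfl
      · simp [PtHom.comp, PtHom.toAdjoin, PtHom.ofAlgHom]; rfl
    exact (PtHom.comp_assoc _ _ _).trans
      ((congrArg _ h1).trans (m.toTranslate_comp_ofTranslate _ _))
  · refine PtHom.generic_ext (Units.ext ?_) (Units.ext ?_) fun i => ?_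
    · simp [PtHom.comp, PtHom.toGenericPair₂, PtHom.ofAdjoin, h]
    · simp [PtHom.comp, PtHom.toGenericPair₂, PtHom.ofAdjoin, h]
    · exact (congrArg h.φ (PtHom.toGenericPair₂_coeff i)).trans (AdjoinRing.lift_coeff _ _ hu i)

end generic

end GaugedQuotient

/-! ### Extension and independence of homogeneous sections -/

namespace GaugedQuotient

open CategoryTheory MvPolynomial GradedResolution

variable {n : ℕ} {a r : Fin n → ℤ} {E : EqBundle a r}

theorem isWeightedHomogeneous_X_pow (i : Fin n) (k : ℕ) :
    IsWeightedHomogeneous (weights a r) (X i ^ k : MvPolynomial (Fin n) ℂ) (k • weights a r i) :=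
  (isWeightedHomogeneous_X ℂ (weights a r) i).pow k

theorem PtHom.isUnit_φ_v {p q : Pt a} (m : PtHom r p q) {i : Fin n} (h : IsUnit (q.v i)) :
    IsUnit (m.φ (p.v i)) := by
  rw [← congrFun m.act_eq i, act] at h
  exact isUnit_of_mul_isUnit_right h

theorem Pt.isUnit_away_v (p : Pt a) (i : Fin n) : IsUnit ((p.away (p.v i)).v i) :=
  IsLocalization.Away.algebraMap_isUnit (S := (p.away (p.v i)).R) (p.v i)

/-- Homogeneous sections over a chart extend after multiplication by a power of the coordinate. -/
theorem IsHom.exists_generic {i : Fin n} {hi : 0 < a i} {g : ℤ × ℤ} {e : E.M (Pt.chart a i hi)}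
    (he : IsHom E g e) : ∃ (N : ℕ) (γ : E.M (Pt.generic a)), IsHom E (g - N • weights a r i) γ ∧
      E.map (PtHom.ofGeneric r _) γ = (Pt.chart a i hi).v i ^ N • e := by
  have hb := Pt.isUnit_away_v (Pt.generic a) i
  -- A power of the coordinate clears the denominators of the section `e`; the lift `m` is not yet
  -- homogeneous.
  obtain ⟨k, m, hm⟩ := E.exists_pow_smul_eq (E.map (PtHom.ofChart r i hi hb) e)
  have hk : IsHom E (g - k • weights a r i) ((Pt.chart a i hi).v i ^ k • e) := by
    simpa using he.aeval_smul (isWeightedHomogeneous_X_pow i k)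
  -- Wherever the coordinate is invertible, `m` agrees with the homogeneous section `x_i ^ k • e`
  -- coming from the chart.
  have hμ : ∀ (q : Pt a) (μ : PtHom r (Pt.generic a) q), IsUnit (q.v i) →
      ∃ ν : PtHom r (Pt.chart a i hi) q, ν.l = μ.l ∧ ν.s = μ.s ∧
        E.map μ m = E.map ν ((Pt.chart a i hi).v i ^ k • e) := by
    intro q μ hq
    have hl : ((PtHom.ofChart r i hi hb).comp (μ.ofAway (μ.isUnit_φ_v hq))).l = μ.l := by
      simp [PtHom.comp, PtHom.ofChart, PtHom.ofAlgHom, PtHom.ofAway]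
    have hs : ((PtHom.ofChart r i hi hb).comp (μ.ofAway (μ.isUnit_φ_v hq))).s = μ.s := by
      simp [PtHom.comp, PtHom.ofChart, PtHom.ofAlgHom, PtHom.ofAway]
    refine ⟨_, hl, hs, ?_⟩
    conv_lhs => rw [← μ.toAway_comp_ofAway (μ.isUnit_φ_v hq), E.map_comp, hm,
      (E.map _).map_smulₛₗ, ← E.map_comp]
    rw [(E.map _).map_smulₛₗ]
    congr 1
    simp only [RingHom.coe_coe, map_pow]
    congr 1
    rw [PtHom.φ_v_eq _ μ hl hs]
    exact DFunLike.congr_fun (congrArg PtHom.φ (μ.toAway_comp_ofAway (μ.isUnit_φ_v hq))) _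
  set k₁ := PtHom.toGenericPair₁ a r
  set k₂ := PtHom.toGenericPair₂ a r
  -- Hence the homogeneity defect of `m` on the universal pair vanishes after inverting the
  -- coordinate, so a further power of the coordinate annihilates it.
  obtain ⟨j, hj⟩ : ∃ j : ℕ, (Pt.genericPair a r).v i ^ j •
      ((chi k₂.l k₂.s (g - k • weights a r i) : (Pt.genericPair a r).R) • E.map k₁ m -
      (chi k₁.l k₁.s (g - k • weights a r i) : (Pt.genericPair a r).R) • E.map k₂ m) = 0 := by
    refine E.exists_pow_smul_eq_zero ?_
    have hZ := Pt.isUnit_away_v (Pt.genericPair a r) i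
    obtain ⟨ν₁, hl₁, hs₁, h₁⟩ := hμ _ (k₁.comp (PtHom.toAway r _ _)) hZ
    obtain ⟨ν₂, hl₂, hs₂, h₂⟩ := hμ _ (k₂.comp (PtHom.toAway r _ _)) hZ
    have h := hk _ ν₁ ν₂
    rw [hl₁, hs₁, hl₂, hs₂, ← h₁, ← h₂, E.map_comp, E.map_comp] at h
    rw [map_sub, (E.map _).map_smulₛₗ, (E.map _).map_smulₛₗ, sub_eq_zero]
    simpa [PtHom.comp, PtHom.toAway, PtHom.ofAlgHom, chi_map] using h
  refine ⟨k + j, (Pt.generic a).v i ^ j • m, ?_, ?_⟩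
  · rw [add_smul, ← sub_sub]
    refine IsHom.of_pair PtHom.exists_genericPair ?_
    have h := map_aeval_smul_sub k₁ k₂ (g - k • weights a r i) m (isWeightedHomogeneous_X_pow i j)
    simp only [map_pow, aeval_X] at h
    rw [mul_smul, hj, smul_zero, sub_eq_zero] at h
    exact h
  · obtain ⟨ν, hl, hs, h⟩ := hμ _ (PtHom.ofGeneric r _) (Pt.isUnit_chart_v (hi := hi))
    rw [PtHom.ofGeneric_l] at hl
    rw [PtHom.ofGeneric_s] at hs
    have hν : ν = PtHom.id r _ :=
      PtHom.ext (Pt.chart_algHom_ext fun j => PtHom.φ_v_eq _ (PtHom.id r _) hl hs j) hl hs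
    rw [(E.map _).map_smulₛₗ, h, hν, E.map_id, smul_smul, add_comm, pow_add, map_pow]
    congr 3
    exact PtHom.φ_v _ (PtHom.ofGeneric_l _) (PtHom.ofGeneric_s _) i

theorem IsHom.map_ofActPt {p : Pt a} {g : ℤ × ℤ} {e : E.M p} (h : IsHom E g e) (l s : p.Rˣ)
    (m : PtHom r p (p.actPt r l s)) (hl : m.l = 1) (hs : m.s = 1) :
    E.map (PtHom.ofActPt r p l s) (E.map m e) = (chi l s (-g) : p.R) • e := by
  have h2 := h _ m (PtHom.toActPt r p l s)
  rw [hl, hs, chi_one_one, Units.val_one, one_smul] at h2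
  have h3 := congrArg (E.map (PtHom.ofActPt r p l s)) h2
  rw [(E.map _).map_smulₛₗ, ← E.map_comp (PtHom.toActPt r p l s), PtHom.toActPt_comp_ofActPt,
    E.map_id] at h3
  have h4 : (chi l s g : p.R) • E.map (PtHom.ofActPt r p l s) (E.map m e) = e := h3
  conv_rhs => rw [← h4]
  rw [smul_smul, chi_neg, Units.inv_mul, one_smul]

/-- Homogeneous elements of different degrees are independent. -/
theorem IsHom.eq_zero_of_sum {s : Finset (ℤ × ℤ)} {f : ℤ × ℤ → E.M (Pt.generic a)}
    (hf : ∀ g, IsHom E (-g) (f g)) (h : ∑ g ∈ s, f g = 0) : ∀ g ∈ s, f g = 0 := by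
  refine eq_zero_of_forall_sum_chi_smul (R := (Pt.generic a).R) fun t => ?_
  have h1 := congrArg (E.map (PtHom.ofActPt r (Pt.generic a) (Pt.scalar _ t.1) (Pt.scalar _ t.2)))
    (congrArg (E.map (PtHom.ofGeneric r _)) h)
  rw [map_sum, map_sum, map_zero, map_zero] at h1
  rw [← h1]
  refine Finset.sum_congr rfl fun g _ => ?_
  rw [(hf g).map_ofActPt _ _ _ (PtHom.ofGeneric_l _) (PtHom.ofGeneric_s _), neg_neg, Pt.chi_scalar]

end GaugedQuotient

/-! ### Finitely many homogeneous global generators -/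

namespace GaugedQuotient

open CategoryTheory MvPolynomial GradedResolution

variable {n : ℕ} {a r : Fin n → ℤ} (E : EqBundle a r)

/-- The fibres of a bundle as modules over the polynomial functions. -/
noncomputable instance (p : Pt a) : Module (MvPolynomial (Fin n) ℂ) (E.M p) :=
  Module.compHom _ (aeval p.v : MvPolynomial (Fin n) ℂ →ₐ[ℂ] p.R).toRingHom

variable {E}

theorem poly_smul_def {p : Pt a} (f : MvPolynomial (Fin n) ℂ) (e : E.M p) :
    f • e = aeval p.v f • e := rfl

theorem PtHom.φ_aeval {p q : Pt a} (m : PtHom r p q) (hl : m.l = 1) (hs : m.s = 1)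
    (f : MvPolynomial (Fin n) ℂ) : m.φ (aeval p.v f) = aeval q.v f := by
  rw [comp_aeval_apply]
  congr 2
  funext i
  exact m.φ_v hl hs i

theorem EqBundle.map_poly_smul {p q : Pt a} (m : PtHom r p q) (hl : m.l = 1) (hs : m.s = 1)
    (f : MvPolynomial (Fin n) ℂ) (e : E.M p) : E.map m (f • e) = f • E.map m e := by
  rw [poly_smul_def, (E.map m).map_smulₛₗ, poly_smul_def]
  congr 1
  exact m.φ_aeval hl hs f

/-- Homogeneity includes descent: the image depends only on the torus element, not on the
coefficients chosen for the morphism. Homogeneous elements over the universal point thus behave as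
sections over the semistable locus. -/
theorem IsHom.map_eq {p q : Pt a} {g : ℤ × ℤ} {e : E.M p} (h : IsHom E g e) {m m' : PtHom r p q}
    (hl : m.l = m'.l) (hs : m.s = m'.s) : E.map m e = E.map m' e := by
  have := h q m m'
  rw [hl, hs] at this
  have h2 := congrArg (((chi m'.l m'.s g)⁻¹ : q.Rˣ) • ·) this
  simpa [smul_smul, Units.smul_def] using h2

/-- The homogeneous components of a section over the chart extend after multiplication by a power of
the coordinate, and this power is a unit on the chart. -/
theorem EqBundle.span_map_chart (E : EqBundle a r) (i : Fin n) (hi : 0 < a i) :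
    Submodule.span (Pt.chart a i hi).R (E.map (PtHom.ofGeneric r (Pt.chart a i hi)) ''
      {γ : E.M (Pt.generic a) | ∃ g, IsHom E g γ}) = ⊤ := by
  rw [eq_top_iff]
  rintro e -
  obtain ⟨f, rfl, hf⟩ := E.exists_isHom_chart e
  refine sum_mem fun g _ => ?_
  obtain ⟨N, γ, hγ, h⟩ := (hf g).exists_generic
  obtain ⟨u, hu⟩ := (Pt.isUnit_chart_v (hi := hi)).pow N
  have h1 : f g = ((u⁻¹ : (Pt.chart a i hi).Rˣ) : (Pt.chart a i hi).R) •
      E.map (PtHom.ofGeneric r (Pt.chart a i hi)) γ := by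
    rw [h, ← hu, smul_smul, Units.inv_mul, one_smul]
  rw [h1]
  exact Submodule.smul_mem _ _ (Submodule.subset_span ⟨γ, ⟨_, hγ⟩, rfl⟩)

/-- A bundle has finitely many homogeneous global sections that generate it over the charts. -/
theorem EqBundle.exists_generators (E : EqBundle a r) :
    ∃ Γ : Set (E.M (Pt.generic a)), Γ.Finite ∧ (∀ γ ∈ Γ, ∃ g, IsHom E g γ) ∧
      ∀ (i : Fin n) (hi : 0 < a i), Submodule.span (Pt.chart a i hi).R
        (E.map (PtHom.ofGeneric r (Pt.chart a i hi)) '' Γ) = ⊤ := by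
  have h : ∀ (i : Fin n), ∃ Γ : Set (E.M (Pt.generic a)), Γ.Finite ∧
      (∀ γ ∈ Γ, ∃ g, IsHom E g γ) ∧ ∀ (hi : 0 < a i), Submodule.span (Pt.chart a i hi).R
        (E.map (PtHom.ofGeneric r (Pt.chart a i hi)) '' Γ) = ⊤ := by
    intro i
    by_cases hi : 0 < a i
    · have h1 := E.span_map_chart i hi
      have h2 : (Submodule.span (Pt.chart a i hi).R (E.map (PtHom.ofGeneric r (Pt.chart a i hi)) ''
          {γ : E.M (Pt.generic a) | ∃ g, IsHom E g γ})).FG := by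
        rw [h1]; exact Module.Finite.fg_top
      rw [Submodule.fg_span_iff_fg_span_finset_subset] at h2
      obtain ⟨s, hs, hs'⟩ := h2
      classical
      obtain ⟨Γ, hΓ, rfl⟩ := Finset.subset_set_image_iff.mp hs
      rw [Finset.coe_image] at hs'
      exact ⟨Γ, Γ.finite_toSet, hΓ, fun _ => by rw [← hs', h1]⟩
    · exact ⟨∅, Set.finite_empty, by simp, fun h => (hi h).elim⟩
  choose Γ h1 h2 h3 using h
  refine ⟨⋃ i, Γ i, Set.finite_iUnion h1, ?_, fun i hi => ?_⟩
  · intro γ hγ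
    obtain ⟨i, hi⟩ := Set.mem_iUnion.mp hγ
    exact h2 i γ hi
  · rw [eq_top_iff, ← h3 i hi]
    exact Submodule.span_mono (Set.image_mono (Set.subset_iUnion Γ i))

/-- The homogeneous elements, by the degree for which polynomials act additively. -/
def homSubgroup (E : EqBundle a r) (p : Pt a) (g : ℤ × ℤ) : AddSubgroup (E.M p) where
  carrier := {e | IsHom E (-g) e}
  zero_mem' := IsHom.zero
  add_mem' := IsHom.add
  neg_mem' := IsHom.neg

/-- Homogeneous generators of a bundle, whose relations have a finite graded resolution. -/
theorem EqBundle.exists_hasRes (E : EqBundle a r) :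
    ∃ (k : ℕ) (ι : Type) (_ : Fintype ι) (d : ι → ℤ × ℤ) (γ : ι → E.M (Pt.generic a)),
      (∀ j, IsHom E (-d j) (γ j)) ∧
      (∀ (i : Fin n) (hi : 0 < a i), Submodule.span (Pt.chart a i hi).R (Set.range fun j =>
        E.map (PtHom.ofGeneric r (Pt.chart a i hi)) (γ j)) = ⊤) ∧
      HasRes (mvGr (weights a r)) k
        (LinearMap.ker (Fintype.linearCombination (MvPolynomial (Fin n) ℂ) γ))
        fun g => (freeGr (mvGr (weights a r)) d g).comap
          (LinearMap.ker (Fintype.linearCombination (MvPolynomial (Fin n) ℂ) γ)).toAddSubgroup.subtype := by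
  obtain ⟨Γ, hΓ, hhom, hspan⟩ := E.exists_generators
  -- The polynomial submodule generated by the sections `Γ` is graded by negated degrees, since
  -- polynomials lower the degree in `IsHom`.
  have hM : IsGr (mvGr (weights a r)) (fun g => (homSubgroup E (Pt.generic a) g).comap
      (Submodule.span (MvPolynomial (Fin n) ℂ) Γ).toAddSubgroup.subtype :
      ℤ × ℤ → AddSubgroup (Submodule.span (MvPolynomial (Fin n) ℂ) Γ)) := by
    refine isGr_span (ℳ := homSubgroup E (Pt.generic a)) (isGr_mvGr _) ?_ ?_ Γ ?_
    · intro g h f e hf he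
      have := IsHom.aeval_smul (show IsHom E (-h) e from he) (mem_mvGr.mp hf)
      rw [← neg_add', add_comm] at this
      exact this
    · intro s f hf h
      exact IsHom.eq_zero_of_sum hf h
    · intro γ hγ
      obtain ⟨g, hg⟩ := hhom γ hγ
      exact ⟨-g, by simpa [homSubgroup] using hg⟩
  have hfin : Module.Finite (MvPolynomial (Fin n) ℂ)
    (Submodule.span (MvPolynomial (Fin n) ℂ) Γ) := Module.Finite.span_of_finite _ hΓ
  obtain ⟨k, hk⟩ := exists_hasRes_mvPolynomial n _ _ _ hM hfin
  -- Padding to length `k + 1` ensures that there is a first cover; its relations then have a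
  -- resolution of length `k`.
  obtain ⟨ι, _, d, x, hx, hsurj, hres⟩ := HasRes.succ k hk
  have hker : LinearMap.ker (Fintype.linearCombination (MvPolynomial (Fin n) ℂ) x) =
      LinearMap.ker (Fintype.linearCombination (MvPolynomial (Fin n) ℂ) fun j =>
        (x j : E.M (Pt.generic a))) := by
    ext c
    simp only [LinearMap.mem_ker, Fintype.linearCombination_apply]
    rw [← Submodule.coe_eq_zero]
    simp
  refine ⟨k, ι, inferInstance, d, fun j => (x j : E.M (Pt.generic a)), hx, fun i hi => ?_, ?_⟩
  · rw [eq_top_iff, ← hspan i hi, Submodule.span_le]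
    rintro _ ⟨γ, hγ, rfl⟩
    obtain ⟨c, hc⟩ := hsurj ⟨γ, Submodule.subset_span hγ⟩
    have hc' := congrArg (Submodule.subtype _) hc
    rw [Fintype.linearCombination_apply, map_sum] at hc'
    have hc2 : γ = ∑ j, c j • (x j : E.M (Pt.generic a)) := hc'.symm
    rw [hc2, map_sum]
    refine sum_mem fun j _ => ?_
    rw [EqBundle.map_poly_smul _ (PtHom.ofGeneric_l _) (PtHom.ofGeneric_s _)]
    exact Submodule.smul_mem _ (aeval (Pt.chart a i hi).v (c j)) (Submodule.subset_span ⟨j, rfl⟩)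
  · rw [← hker]
    exact hres

end GaugedQuotient

/-! ### Local splittings of the presentation by global sections -/

namespace GaugedQuotient

open CategoryTheory MvPolynomial GradedResolution

variable {n : ℕ}

section evalLin

variable {R : Type} [CommRing R] [Algebra ℂ R] (v : Fin n → R) {κ ι : Type} [Fintype κ]

open Classical in
/-- The evaluation at a point of a matrix of polynomials. -/
noncomputable def evalLin
    (B : (κ → MvPolynomial (Fin n) ℂ) →ₗ[MvPolynomial (Fin n) ℂ] (ι → MvPolynomial (Fin n) ℂ)) :
    (κ → R) →ₗ[R] (ι → R) :=
  Fintype.linearCombination R fun j i => aeval v (B (Pi.single j 1) i)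

theorem evalLin_aeval
    (B : (κ → MvPolynomial (Fin n) ℂ) →ₗ[MvPolynomial (Fin n) ℂ] (ι → MvPolynomial (Fin n) ℂ))
    (c : κ → MvPolynomial (Fin n) ℂ) :
    evalLin v B (fun j => aeval v (c j)) = fun i => aeval v (B c i) := by
  classical
  funext i
  conv_rhs => rw [pi_eq_sum_univ' c]
  rw [evalLin, Fintype.linearCombination_apply, map_sum, Finset.sum_apply, Finset.sum_apply,
    map_sum]
  refine Finset.sum_congr rfl fun j _ => ?_
  simp

variable {v}

theorem hom_ext_aeval {Q : Type} [AddCommGroup Q] [Module R Q] {f g : (κ → R) →ₗ[R] Q}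
    (h : ∀ c : κ → MvPolynomial (Fin n) ℂ, f (fun j => aeval v (c j)) = g (fun j => aeval v (c j))) :
    f = g := by
  classical
  refine LinearMap.pi_ext' fun j => LinearMap.ext_ring ?_
  have := h (Pi.single j 1)
  have h2 : (fun k => aeval v ((Pi.single j 1 : κ → MvPolynomial (Fin n) ℂ) k)) =
      Pi.single j (1 : R) := by
    funext k
    by_cases hk : k = j
    · subst hk; simp
    · simp [hk]
  rwa [h2] at this

variable (v)

/-- The submodule generated by the values at a point of the elements of a submodule of a free
module. -/
def valueSpan (K : Submodule (MvPolynomial (Fin n) ℂ) (κ → MvPolynomial (Fin n) ℂ)) :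
    Submodule R (κ → R) :=
  Submodule.span R ((fun c j => aeval v (c j)) '' (K : Set (κ → MvPolynomial (Fin n) ℂ)))

variable {v}

theorem evalLin_mem_valueSpan
    {K : Submodule (MvPolynomial (Fin n) ℂ) (ι → MvPolynomial (Fin n) ℂ)} [Fintype ι]
    {B : (κ → MvPolynomial (Fin n) ℂ) →ₗ[MvPolynomial (Fin n) ℂ] (ι → MvPolynomial (Fin n) ℂ)}
    (hB : ∀ c, B c ∈ K) (x : κ → R) : evalLin v B x ∈ valueSpan v K := by
  rw [evalLin, Fintype.linearCombination_apply]
  refine sum_mem fun j _ => Submodule.smul_mem _ _ (Submodule.subset_span ⟨_, hB _, rfl⟩)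

theorem evalLin_smul_sub (f : MvPolynomial (Fin n) ℂ)
    (B : (κ → MvPolynomial (Fin n) ℂ) →ₗ[MvPolynomial (Fin n) ℂ] (κ → MvPolynomial (Fin n) ℂ))
    (x : κ → R) : evalLin v (f • LinearMap.id - B) x = aeval v f • x - evalLin v B x := by
  have : evalLin v (f • LinearMap.id - B) = aeval v f • LinearMap.id - evalLin v B := by
    refine hom_ext_aeval (v := v) fun c => ?_
    change _ = aeval v f • _ - evalLin v B _
    rw [evalLin_aeval, evalLin_aeval]
    funext i
    simp
  rw [this]; rfl

end evalLin

variable {a r : Fin n → ℤ} {E : EqBundle a r} {ι : Type} [Fintype ι] {d : ι → ℤ × ℤ}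
  {γ : ι → E.M (Pt.generic a)}

theorem map_sum_smul {q : Pt a} (m : PtHom r (Pt.generic a) q) (hl : m.l = 1) (hs : m.s = 1)
    (c : ι → MvPolynomial (Fin n) ℂ) : E.map m (Fintype.linearCombination _ γ c) =
      ∑ j, aeval q.v (c j) • E.map m (γ j) := by
  rw [Fintype.linearCombination_apply, map_sum]
  exact Finset.sum_congr rfl fun j _ => EqBundle.map_poly_smul m hl hs _ _

variable (hγ : ∀ j, IsHom E (-d j) (γ j))

include hγ

omit [Fintype ι] in
theorem map_ofGeneric_eq {p q : Pt a} (m : PtHom r p q) (hl : m.l = 1) (hs : m.s = 1) (j : ι) :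
    E.map m (E.map (PtHom.ofGeneric r p) (γ j)) = E.map (PtHom.ofGeneric r q) (γ j) := by
  rw [← E.map_comp]
  exact (hγ j).map_eq (by simp [PtHom.comp, hl]) (by simp [PtHom.comp, hs])

/-- A combination of global sections that vanishes on a chart is killed by a power of the
coordinate. -/
theorem exists_pow_smul_eq_zero_of_chart {i : Fin n} (hi : 0 < a i)
    {c : ι → MvPolynomial (Fin n) ℂ} (hc : ∑ j, aeval (Pt.chart a i hi).v (c j) •
      E.map (PtHom.ofGeneric r (Pt.chart a i hi)) (γ j) = 0) :
    ∃ N : ℕ, (X i ^ N : MvPolynomial (Fin n) ℂ) • Fintype.linearCombination _ γ c = 0 := by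
  have h1 : E.map (PtHom.toAway r _ ((Pt.generic a).v i)) (Fintype.linearCombination _ γ c) = 0 := by
    rw [map_sum_smul _ rfl rfl]
    have h2 := congrArg (E.map (PtHom.ofChart r i hi (Pt.isUnit_away_v (Pt.generic a) i))) hc
    rw [map_zero, map_sum] at h2
    rw [← h2]
    refine Finset.sum_congr rfl fun j _ => ?_
    rw [← poly_smul_def, ← poly_smul_def, EqBundle.map_poly_smul _ rfl rfl,
      map_ofGeneric_eq hγ _ rfl rfl]
    congr 1
    exact (hγ j).map_eq (by rw [PtHom.ofGeneric_l]; rfl) (by rw [PtHom.ofGeneric_s]; rfl)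
  obtain ⟨N, hN⟩ := E.exists_pow_smul_eq_zero h1
  refine ⟨N, ?_⟩
  rw [poly_smul_def, map_pow, aeval_X, hN]

variable (hspan : ∀ (i : Fin n) (hi : 0 < a i), Submodule.span (Pt.chart a i hi).R
  (Set.range fun j => E.map (PtHom.ofGeneric r (Pt.chart a i hi)) (γ j)) = ⊤)

include hspan

/-- The global sections generate the fibres. -/
theorem span_range_map_ofGeneric (p : Pt a) :
    Submodule.span p.R (Set.range fun j => E.map (PtHom.ofGeneric r p) (γ j)) = ⊤ := by
  rw [eq_top_iff]
  rintro y -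
  refine mem_of_pow_smul_mem p fun i hi => ?_
  set q := p.away (p.v i)
  have hq : E.map (PtHom.toAway r p (p.v i)) y ∈
      Submodule.span q.R (Set.range fun j => E.map (PtHom.ofGeneric r q) (γ j)) := by
    have h1 : E.map (PtHom.toAway r p (p.v i)) y ∈ Submodule.span q.R
        (Set.range (E.map (PtHom.ofChart r i hi (Pt.isUnit_away_v p i)))) := by
      rw [(E.isBaseChange _).span_range]; trivial
    refine Submodule.span_le.mpr ?_ h1
    rintro _ ⟨e, rfl⟩
    have he : e ∈ Submodule.span (Pt.chart a i hi).R
        (Set.range fun j => E.map (PtHom.ofGeneric r (Pt.chart a i hi)) (γ j)) := by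
      rw [hspan]; trivial
    induction he using Submodule.span_induction with
    | mem x hx =>
      obtain ⟨j, rfl⟩ := hx
      refine Submodule.subset_span ⟨j, ?_⟩
      exact (map_ofGeneric_eq hγ _ rfl rfl j).symm
    | zero => rw [map_zero]; exact zero_mem _
    | add x x' _ _ h h' => rw [map_add]; exact add_mem h h'
    | smul c x _ h => rw [(E.map _).map_smulₛₗ]; exact Submodule.smul_mem _ _ h
  obtain ⟨c, hc⟩ := (Submodule.mem_span_range_iff_exists_fun q.R).mp hq
  obtain ⟨⟨_, k, rfl⟩, hk⟩ := IsLocalization.exist_integer_multiples_of_finite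
    (Submonoid.powers (p.v i)) c
  choose c' hc' using hk
  have h2 : E.map (PtHom.toAway r p (p.v i)) (p.v i ^ k • y -
      ∑ j, c' j • E.map (PtHom.ofGeneric r p) (γ j)) = 0 := by
    rw [map_sub, (E.map _).map_smulₛₗ, ← hc, map_sum, sub_eq_zero, Finset.smul_sum]
    refine Finset.sum_congr rfl fun j _ => ?_
    rw [(E.map _).map_smulₛₗ, map_ofGeneric_eq hγ _ rfl rfl, smul_smul]
    congr 1
    refine Eq.trans ?_ (hc' j).symm
    exact (Algebra.smul_def (p.v i ^ k) (c j)).symm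
  obtain ⟨l, hl⟩ := E.exists_pow_smul_eq_zero h2
  refine ⟨l + k, ?_⟩
  rw [smul_sub, smul_smul, sub_eq_zero, ← pow_add] at hl
  rw [hl]
  exact Submodule.smul_mem _ _ (sum_mem fun j _ => Submodule.smul_mem _ _
    (Submodule.subset_span ⟨j, rfl⟩))

/-- After multiplication by a power of a coordinate, the presentation by global sections splits. -/
theorem exists_splitting {i : Fin n} (hi : 0 < a i) :
    ∃ (N : ℕ) (B : (ι → MvPolynomial (Fin n) ℂ) →ₗ[MvPolynomial (Fin n) ℂ]
      (ι → MvPolynomial (Fin n) ℂ)),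
      (∀ c, (X i ^ N : MvPolynomial (Fin n) ℂ) • c - B c ∈
        LinearMap.ker (Fintype.linearCombination (MvPolynomial (Fin n) ℂ) γ)) ∧
      (∀ c ∈ LinearMap.ker (Fintype.linearCombination (MvPolynomial (Fin n) ℂ) γ), B c = 0) ∧
      ∀ (p : Pt a) (c : ι → p.R), ∑ j, c j • E.map (PtHom.ofGeneric r p) (γ j) = 0 →
        ∃ k : ℕ, p.v i ^ k • evalLin p.v B c = 0 := by
  classical
  -- On the chart the fibre of `E` is projective, so the surjection given by the global sections has
  -- a section `σ`.
  obtain ⟨σ, hσ⟩ := Module.projective_lifting_property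
    (Fintype.linearCombination (Pt.chart a i hi).R fun j =>
      E.map (PtHom.ofGeneric r (Pt.chart a i hi)) (γ j)) LinearMap.id (by
      rw [← LinearMap.range_eq_top, Fintype.range_linearCombination, hspan])
  -- `X i ^ N₀` is a common denominator of the finitely many entries of `σ` on the generators; `B₀`
  -- has polynomial entries.
  obtain ⟨⟨_, N₀, rfl⟩, hN₀⟩ := IsLocalization.exist_integer_multiples_of_finite
    (Submonoid.powers (X i : MvPolynomial (Fin n) ℂ)) fun jk : ι × ι =>
      σ (E.map (PtHom.ofGeneric r (Pt.chart a i hi)) (γ jk.1)) jk.2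
  choose B₀ hB₀ using fun j k => hN₀ (j, k)
  have hB₁ : ∀ j, (fun k => aeval (Pt.chart a i hi).v (B₀ j k)) = (Pt.chart a i hi).v i ^ N₀ •
      σ (E.map (PtHom.ofGeneric r (Pt.chart a i hi)) (γ j)) := fun j => by
    funext k
    rw [Pt.chart_aeval, hB₀, Pi.smul_apply, Pt.chart_v, ← map_pow]
    exact Algebra.smul_def _ _
  -- That `σ` is a section yields relations on the chart, which hold over the universal point only
  -- after a further power of `X i`.
  have h1 : ∀ j, ∃ N : ℕ, (X i ^ N : MvPolynomial (Fin n) ℂ) • Fintype.linearCombination _ γ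
      ((X i ^ N₀ : MvPolynomial (Fin n) ℂ) • Pi.single j 1 - B₀ j) = 0 := fun j => by
    refine exists_pow_smul_eq_zero_of_chart hγ hi ?_
    have h2 := LinearMap.congr_fun hσ (E.map (PtHom.ofGeneric r (Pt.chart a i hi)) (γ j))
    have h3 : ∀ x, aeval (Pt.chart a i hi).v (B₀ j x) = (Pt.chart a i hi).v i ^ N₀ *
        σ (E.map (PtHom.ofGeneric r (Pt.chart a i hi)) (γ j)) x := congrFun (hB₁ j)
    rw [LinearMap.comp_apply, Fintype.linearCombination_apply, LinearMap.id_apply] at h2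
    simp only [Pi.sub_apply, map_sub, sub_smul, Finset.sum_sub_distrib, h3, mul_smul]
    rw [← Finset.smul_sum, h2]
    rw [Finset.sum_eq_single j]
    · simp
    · intro k _ hk
      simp [hk]
    · simp
  choose N₁ hN₁ using h1
  have hle : ∀ j, N₁ j ≤ ∑ j, N₁ j := fun j => Finset.single_le_sum (fun _ _ => Nat.zero_le _)
    (Finset.mem_univ j)
  -- The sum of the exponents `N₁ j` serves all generators at once.
  refine ⟨(∑ j, N₁ j) + N₀, Fintype.linearCombination _ fun j =>
    (X i ^ (∑ j, N₁ j) : MvPolynomial (Fin n) ℂ) • B₀ j, fun c => ?_, fun c hc => ?_,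
    fun p c hc => ?_⟩
  · have h2 : (X i ^ ((∑ j, N₁ j) + N₀) : MvPolynomial (Fin n) ℂ) • c -
        Fintype.linearCombination _ (fun j => (X i ^ (∑ j, N₁ j) : MvPolynomial (Fin n) ℂ) • B₀ j) c
        = ∑ j, c j • ((X i ^ (∑ j, N₁ j) : MvPolynomial (Fin n) ℂ) •
          ((X i ^ N₀ : MvPolynomial (Fin n) ℂ) • Pi.single j 1 - B₀ j)) := by
      rw [Fintype.linearCombination_apply]
      simp only [smul_sub, Finset.sum_sub_distrib]
      congr 1
      funext k
      simp [Finset.sum_apply, Pi.single_apply, pow_add, mul_comm]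
    rw [h2]
    refine sum_mem fun j _ => Submodule.smul_mem _ _ ?_
    rw [LinearMap.mem_ker, map_smul]
    obtain ⟨e, he⟩ := Nat.exists_eq_add_of_le (hle j)
    rw [he, pow_add, mul_comm, mul_smul, hN₁, smul_zero]
  · have h2 : Function.Injective (algebraMap (MvPolynomial (Fin n) ℂ) (Pt.chart a i hi).R) :=
      IsLocalization.injective _ (powers_le_nonZeroDivisors_of_noZeroDivisors (X_ne_zero i))
    have h3 : ∑ j, aeval (Pt.chart a i hi).v (c j) •
        E.map (PtHom.ofGeneric r (Pt.chart a i hi)) (γ j) = 0 := by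
      rw [← map_sum_smul _ (PtHom.ofGeneric_l _) (PtHom.ofGeneric_s _), LinearMap.mem_ker.mp hc,
        map_zero]
    have h4 := congrArg σ h3
    rw [map_sum, map_zero] at h4
    simp only [map_smul] at h4
    funext k
    refine h2 ?_
    rw [← Pt.chart_aeval, Fintype.linearCombination_apply, Finset.sum_apply, map_sum, Pi.zero_apply,
      map_zero]
    have h5 := congrFun (congrArg ((Pt.chart a i hi).v i ^ ((∑ j, N₁ j) + N₀) • ·) h4) k
    simp only [Pi.smul_apply, smul_zero, Pi.zero_apply, Finset.sum_apply, Finset.smul_sum] at h5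
    rw [← h5]
    refine Finset.sum_congr rfl fun j _ => ?_
    have h6 := congrFun (hB₁ j) k
    simp only [Pi.smul_apply, smul_eq_mul, map_mul, map_pow, aeval_X] at h6 ⊢
    rw [h6]
    ring
  · set q := p.away (p.v i)
    set ν := PtHom.ofChart r i hi (Pt.isUnit_away_v p i)
    let g : E.M (Pt.chart a i hi) →ₛₗ[(ν.φ : (Pt.chart a i hi).R →+* q.R)] (ι → q.R) :=
      { toFun := fun e j => ν.φ (σ e j)
        map_add' := fun e e' => by funext j; simp
        map_smul' := fun c e => by funext j; simp }
    -- The section `σ` is transported to the point where `p.v i` is inverted by the universal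
    -- property of base change. Applied to the relation `c`, it shows that `B c` vanishes there.
    obtain ⟨σ', hσ', -⟩ := E.isBaseChange ν _ g
    have h2 := congrArg (fun y => σ' (E.map (PtHom.toAway r p (p.v i)) y)) hc
    simp only [map_sum, map_zero, (E.map _).map_smulₛₗ, map_smul,
      map_ofGeneric_eq hγ (PtHom.toAway r p (p.v i)) rfl rfl] at h2
    simp only [← map_ofGeneric_eq hγ ν rfl rfl, hσ'] at h2
    have h3 : ∀ k, algebraMap p.R q.R (evalLin p.v (Fintype.linearCombination _ fun j =>
        (X i ^ (∑ j, N₁ j) : MvPolynomial (Fin n) ℂ) • B₀ j) c k) = 0 := by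
      intro k
      have h5 := congrFun (congrArg (q.v i ^ ((∑ j, N₁ j) + N₀) • ·) h2) k
      simp only [Pi.smul_apply, smul_zero, Pi.zero_apply, Finset.sum_apply, Finset.smul_sum] at h5
      rw [← h5, evalLin, Fintype.linearCombination_apply, Finset.sum_apply, map_sum]
      refine Finset.sum_congr rfl fun j _ => ?_
      have h6 := congrArg ν.φ (congrFun (hB₁ j) k)
      rw [ν.φ_aeval rfl rfl, Pi.smul_apply, smul_eq_mul, map_mul, map_pow, ν.φ_v rfl rfl] at h6
      have h7 := (PtHom.toAway r p (p.v i)).φ_aeval rfl rfl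
        (X i ^ (∑ j, N₁ j) * B₀ j k)
      rw [Pi.smul_apply, smul_eq_mul, map_mul, Fintype.linearCombination_apply_single, one_smul,
        Pi.smul_apply, smul_eq_mul]
      refine (congrArg _ h7).trans ?_
      rw [map_mul, h6, map_pow, aeval_X]
      simp only [g, LinearMap.coe_mk, AddHom.coe_mk, smul_eq_mul]
      rw [pow_add]
      change algebraMap p.R q.R (c j) * _ = _ * (algebraMap p.R q.R (c j) * _)
      ring
    have h8 : ∀ k, ∃ l : ℕ, p.v i ^ l * (evalLin p.v (Fintype.linearCombination _ fun j =>
        (X i ^ (∑ j, N₁ j) : MvPolynomial (Fin n) ℂ) • B₀ j) c k) = 0 := by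
      intro k
      obtain ⟨⟨_, l, rfl⟩, hl⟩ := (IsLocalization.map_eq_zero_iff (Submonoid.powers (p.v i)) _ _).mp
        (h3 k)
      exact ⟨l, hl⟩
    choose l hl using h8
    refine ⟨∑ k, l k, funext fun k => ?_⟩
    obtain ⟨e, he⟩ := Nat.exists_eq_add_of_le (Finset.single_le_sum (f := l)
      (fun _ _ => Nat.zero_le _) (Finset.mem_univ k))
    rw [Pi.smul_apply, smul_eq_mul, he, pow_add, mul_comm (p.v i ^ l k), mul_assoc, hl, mul_zero]
    rfl

/-- After multiplication by a power of a coordinate, the relations are a direct summand. -/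
theorem exists_retraction_ker (i : Fin n) (hi : 0 < a i) :
    ∃ (N : ℕ) (ρ : (ι → MvPolynomial (Fin n) ℂ) →ₗ[MvPolynomial (Fin n) ℂ]
      (ι → MvPolynomial (Fin n) ℂ)),
      (∀ c, ρ c ∈ LinearMap.ker (Fintype.linearCombination (MvPolynomial (Fin n) ℂ) γ)) ∧
      ∀ c ∈ LinearMap.ker (Fintype.linearCombination (MvPolynomial (Fin n) ℂ) γ),
        ρ c = (X i ^ N : MvPolynomial (Fin n) ℂ) • c := by
  obtain ⟨N, B, h1, h2, -⟩ := exists_splitting hγ hspan hi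
  refine ⟨N, (X i ^ N : MvPolynomial (Fin n) ℂ) • LinearMap.id - B, fun c => ?_, fun c hc => ?_⟩
  · rw [LinearMap.sub_apply, LinearMap.smul_apply, LinearMap.id_apply]
    exact h1 c
  · rw [LinearMap.sub_apply, LinearMap.smul_apply, LinearMap.id_apply, h2 c hc, sub_zero]

/-- The relations between the global sections in the fibres come from the global relations. -/
theorem mem_valueSpan_ker {p : Pt a} {c : ι → p.R}
    (hc : ∑ j, c j • E.map (PtHom.ofGeneric r p) (γ j) = 0) :
    c ∈ valueSpan p.v (LinearMap.ker (Fintype.linearCombination (MvPolynomial (Fin n) ℂ) γ)) := by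
  refine mem_of_pow_smul_mem p fun i hi => ?_
  obtain ⟨N, B, h1, -, h3⟩ := exists_splitting hγ hspan hi
  obtain ⟨k, hk⟩ := h3 p c hc
  refine ⟨k + N, ?_⟩
  -- Decompose `x_i ^ N • c` as `(x_i ^ N - B) c + B c`: the first part comes from global relations,
  -- and the second is annihilated by a power of the coordinate.
  have h4 := evalLin_smul_sub (v := p.v) (X i ^ N) B c
  rw [map_pow, aeval_X] at h4
  rw [pow_add, mul_smul, eq_add_of_sub_eq h4.symm, smul_add, hk, add_zero]
  refine Submodule.smul_mem _ _ (evalLin_mem_valueSpan (fun c => ?_) c)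
  rw [LinearMap.sub_apply, LinearMap.smul_apply, LinearMap.id_apply]
  exact h1 c

end GaugedQuotient

/-! ### Mapping cones in terms of elements -/

namespace GaugedQuotient

open CategoryTheory MvPolynomial GradedResolution CochainComplex

section cone

variable {G : Type} [AddCommGroup G] {n : ℕ} {w : Fin n → G} {R : Type} [CommRing R] [Algebra ℂ R]
  (v : Fin n → R)

theorem evalMat_neg {P Q : Mat_ (Twist w)} (f : P ⟶ Q) : evalMat v (-f) = -evalMat v f :=
  eq_neg_of_add_eq_zero_left (by rw [← evalMat_add, neg_add_cancel, evalMat_zero])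

theorem evalMat_d_d (K : CochainComplex (Mat_ (Twist w)) ℤ) (i j k : ℤ) (x : (K.X i).ι → R) :
    evalMat v (K.d j k) (evalMat v (K.d i j) x) = 0 := by
  have := LinearMap.congr_fun (evalMat_comp v (K.d i j) (K.d j k)) x
  rw [K.d_comp_d, evalMat_zero] at this
  exact this.symm

theorem evalMat_hom_comm {K L : CochainComplex (Mat_ (Twist w)) ℤ} (φ : K ⟶ L) (i j : ℤ)
    (x : (K.X i).ι → R) :
    evalMat v (φ.f j) (evalMat v (K.d i j) x) = evalMat v (L.d i j) (evalMat v (φ.f i) x) := by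
  have := congrArg (fun f => evalMat v f x) (φ.comm i j)
  simp only [evalMat_comp] at this
  exact this.symm

theorem subsingleton_of_isZero {P : Mat_ (Twist w)} (h : Limits.IsZero P) :
    Subsingleton (P.ι → R) := by
  have h1 : (evalMat (fun _ => 0 : Fin n → R) (𝟙 P)) = 0 := by
    rw [h.eq_of_src (𝟙 P) 0, evalMat_zero]
  rw [evalMat_id] at h1
  exact ⟨fun x y => (LinearMap.congr_fun h1 x).trans (LinearMap.congr_fun h1 y).symm⟩

variable {K L : CochainComplex (Mat_ (Twist w)) ℤ} (φ : K ⟶ L)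

/-- The first component of an element of a mapping cone. -/
noncomputable def coneFst (j k : ℤ) (h : j + 1 = k) :
    (((mappingCone φ).X j).ι → R) →ₗ[R] ((K.X k).ι → R) :=
  evalMat v ((mappingCone.fst φ).1.v j k h)

/-- The second component of an element of a mapping cone. -/
noncomputable def coneSnd (j : ℤ) : (((mappingCone φ).X j).ι → R) →ₗ[R] ((L.X j).ι → R) :=
  evalMat v ((mappingCone.snd φ).v j j (add_zero j))

theorem cone_ext {j k : ℤ} (h : j + 1 = k) {z z' : ((mappingCone φ).X j).ι → R}
    (h₁ : coneFst v φ j k h z = coneFst v φ j k h z') (h₂ : coneSnd v φ j z = coneSnd v φ j z') :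
    z = z' := by
  have key : ∀ z, z = evalMat v ((mappingCone.inl φ).v k j (by lia)) (coneFst v φ j k h z) +
      evalMat v ((mappingCone.inr φ).f j) (coneSnd v φ j z) := fun z => by
    have := congrArg (fun f => evalMat v f z) (mappingCone.id_X φ j k h)
    simp only [evalMat_add, evalMat_comp, evalMat_id] at this
    exact this.symm
  rw [key z, key z', h₁, h₂]

theorem exists_cone {j k : ℤ} (h : j + 1 = k) (x : (K.X k).ι → R) (y : (L.X j).ι → R) :
    ∃ z, coneFst v φ j k h z = x ∧ coneSnd v φ j z = y := by
  refine ⟨evalMat v ((mappingCone.inl φ).v k j (by lia)) x +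
    evalMat v ((mappingCone.inr φ).f j) y, ?_, ?_⟩
  · have h1 := congrArg (fun f => evalMat v f x) (mappingCone.inl_v_fst_v φ k j h)
    have h2 := congrArg (fun f => evalMat v f y) (mappingCone.inr_f_fst_v φ j k h)
    simp only [evalMat_comp, evalMat_id, evalMat_zero] at h1 h2
    rw [map_add]
    exact (congrArg₂ (· + ·) h1 h2).trans (add_zero x)
  · have h1 := congrArg (fun f => evalMat v f x) (mappingCone.inl_v_snd_v φ k j (by lia))
    have h2 := congrArg (fun f => evalMat v f y) (mappingCone.inr_f_snd_v φ j)
    simp only [evalMat_comp, evalMat_id, evalMat_zero] at h1 h2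
    rw [map_add]
    exact (congrArg₂ (· + ·) h1 h2).trans (zero_add y)

theorem coneFst_d {i j k : ℤ} (hij : i + 1 = j) (hjk : j + 1 = k)
    (z : ((mappingCone φ).X i).ι → R) :
    coneFst v φ j k hjk (evalMat v ((mappingCone φ).d i j) z) =
      -evalMat v (K.d j k) (coneFst v φ i j hij z) := by
  have := congrArg (fun f => evalMat v f z) (mappingCone.d_fst_v φ i j k hij hjk)
  simp only [evalMat_comp, evalMat_neg] at this
  exact this

theorem coneSnd_d {i j : ℤ} (hij : i + 1 = j) (z : ((mappingCone φ).X i).ι → R) :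
    coneSnd v φ j (evalMat v ((mappingCone φ).d i j) z) =
      evalMat v (φ.f j) (coneFst v φ i j hij z) + evalMat v (L.d i j) (coneSnd v φ i z) := by
  have := congrArg (fun f => evalMat v f z) (mappingCone.d_snd_v φ i j hij)
  simp only [evalMat_comp, evalMat_add] at this
  exact this

theorem mem_range_d_cone_iff {i j k : ℤ} (hij : i + 1 = j) (hjk : j + 1 = k)
    (z : ((mappingCone φ).X j).ι → R) :
    z ∈ Set.range (evalMat v ((mappingCone φ).d i j)) ↔ ∃ (x' : (K.X j).ι → R) (y' : (L.X i).ι → R),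
      coneFst v φ j k hjk z = -evalMat v (K.d j k) x' ∧
        coneSnd v φ j z = evalMat v (φ.f j) x' + evalMat v (L.d i j) y' := by
  constructor
  · rintro ⟨z', rfl⟩
    exact ⟨coneFst v φ i j hij z', coneSnd v φ i z', coneFst_d v φ hij hjk z', coneSnd_d v φ hij z'⟩
  · rintro ⟨x', y', h₁, h₂⟩
    obtain ⟨z', h₃, h₄⟩ := exists_cone v φ hij x' y'
    refine ⟨z', cone_ext v φ hjk ?_ ?_⟩
    · rw [coneFst_d v φ hij hjk, h₃, h₁]
    · rw [coneSnd_d v φ hij, h₃, h₄, h₂]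

theorem d_cone_eq_zero_iff {j k l : ℤ} (hjk : j + 1 = k) (hkl : k + 1 = l)
    (z : ((mappingCone φ).X j).ι → R) :
    evalMat v ((mappingCone φ).d j k) z = 0 ↔ evalMat v (K.d k l) (coneFst v φ j k hjk z) = 0 ∧
      evalMat v (φ.f k) (coneFst v φ j k hjk z) + evalMat v (L.d j k) (coneSnd v φ j z) = 0 := by
  rw [← coneSnd_d v φ hjk, ← neg_eq_zero (a := evalMat v (K.d k l) _), ← coneFst_d v φ hjk hkl]
  constructor
  · intro h
    rw [h, map_zero, map_zero]
    exact ⟨rfl, rfl⟩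
  · rintro ⟨h₁, h₂⟩
    refine cone_ext v φ hkl ?_ ?_
    · rw [h₁, map_zero]
    · rw [h₂, map_zero]

/-- Exactness of a mapping cone, in terms of elements. -/
theorem exact_cone_iff {i j k l : ℤ} (hij : i + 1 = j) (hjk : j + 1 = k) (hkl : k + 1 = l) :
    Function.Exact (evalMat v ((mappingCone φ).d i j)) (evalMat v ((mappingCone φ).d j k)) ↔
      ∀ (x : (K.X k).ι → R) (y : (L.X j).ι → R), evalMat v (K.d k l) x = 0 →
        evalMat v (φ.f k) x + evalMat v (L.d j k) y = 0 → ∃ (x' : (K.X j).ι → R) (y' : (L.X i).ι → R),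
          x = -evalMat v (K.d j k) x' ∧ y = evalMat v (φ.f j) x' + evalMat v (L.d i j) y' := by
  constructor
  · intro h x y hx hy
    obtain ⟨z, rfl, rfl⟩ := exists_cone v φ hjk x y
    exact (mem_range_d_cone_iff v φ hij hjk z).mp
      ((h z).mp ((d_cone_eq_zero_iff v φ hjk hkl z).mpr ⟨hx, hy⟩))
  · intro h z
    refine ⟨fun hz => ?_, ?_⟩
    · obtain ⟨h₁, h₂⟩ := (d_cone_eq_zero_iff v φ hjk hkl z).mp hz
      exact (mem_range_d_cone_iff v φ hij hjk z).mpr (h _ _ h₁ h₂)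
    · rintro ⟨z, rfl⟩
      exact evalMat_d_d v _ i j k z

end cone

section bounded

variable {n : ℕ} {a r : Fin n → ℤ}

/-- A formal direct sum of twists, as a complex in degree `0`. -/
theorem exists_single_mem_hull (F : Mat_ (Twist (weights a r))) :
    ∃ lo hi : ℤ, (linesIn a r lo hi).triangulatedHull ((HomotopyCategory.quotient _ _).obj
      ((HomologicalComplex.single _ (ComplexShape.up ℤ) 0).obj F)) := by
  let Φ : Mat_ (Twist (weights a r)) ⥤ HoTwist (weights a r) :=
    CochainComplex.singleFunctor _ 0 ⋙ HomotopyCategory.quotient _ _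
  obtain ⟨lo, hlo⟩ := (Set.finite_range fun i => (F.X i).deg.1).bddBelow
  obtain ⟨hi, hhi⟩ := (Set.finite_range fun i => (F.X i).deg.1).bddAbove
  refine ⟨lo, hi, ?_⟩
  have h1 : (linesIn a r lo hi).triangulatedHull (⨁ fun i => Φ.obj ((Mat_.embedding _).obj (F.X i))) :=
    ObjectProperty.prop_of_isLimit_fan _ (Limits.biproduct.isLimit _) fun i =>
      linesIn_hull (hlo ⟨i, rfl⟩) (hhi ⟨i, rfl⟩)
  have : Φ.Additive := by dsimp only [Φ]; infer_instance
  exact ObjectProperty.prop_of_iso _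
    (Φ.mapIso (Mat_.isoBiproductEmbedding F) ≪≫ Φ.mapBiproduct _).symm h1

theorem linesIn_mono {lo lo' hi hi' : ℤ} (h : lo' ≤ lo) (h' : hi ≤ hi') :
    linesIn a r lo hi ≤ linesIn a r lo' hi' := by
  rintro X ⟨Z, h₁, h₂, rfl⟩
  exact ⟨Z, h.trans h₁, h₂.trans h', rfl⟩

end bounded

end GaugedQuotient

/-! ### From graded free resolutions to complexes of twists -/

namespace GaugedQuotient

open CategoryTheory MvPolynomial GradedResolution CochainComplex
open scoped ZeroObject

section polynomial

variable {G : Type} [AddCommGroup G] {n : ℕ} {w : Fin n → G}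

theorem evalMat_aeval {R : Type} [CommRing R] [Algebra ℂ R] (v : Fin n → R) {P Q : Mat_ (Twist w)}
    (f : P ⟶ Q) (c : P.ι → MvPolynomial (Fin n) ℂ) :
    evalMat v f (fun i => aeval v (c i)) = fun j => aeval v (evalMat X f c j) := by
  have := evalMat_map (aeval v : MvPolynomial (Fin n) ℂ →ₐ[ℂ] R) X f c
  simpa using this

theorem eq_zero_of_evalMat_X {P Q : Mat_ (Twist w)} {f : P ⟶ Q}
    (h : evalMat (X : Fin n → MvPolynomial (Fin n) ℂ) f = 0) : f = 0 := by
  classical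
  funext i j
  refine Twist.hom_ext ?_
  have h1 := congrFun (LinearMap.congr_fun h (Pi.single i 1)) j
  rw [evalMat_apply, Finset.sum_eq_single i] at h1
  · have h2 : Twist.poly (f i j) = 0 := by simpa using h1
    exact h2
  · intro k _ hk; simp [hk]
  · simp

theorem evalLin_X {κ ι : Type} [Fintype κ]
    (B : (κ → MvPolynomial (Fin n) ℂ) →ₗ[MvPolynomial (Fin n) ℂ] (ι → MvPolynomial (Fin n) ℂ)) :
    evalLin (X : Fin n → MvPolynomial (Fin n) ℂ) B = B := by
  apply LinearMap.ext
  intro c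
  have := evalLin_aeval (X : Fin n → MvPolynomial (Fin n) ℂ) B c
  simpa using this

theorem range_evalLin_subtype_comp {R : Type} [CommRing R] [Algebra ℂ R] (v : Fin n → R)
    {κ ι : Type} [Fintype κ] [Fintype ι]
    {K : Submodule (MvPolynomial (Fin n) ℂ) (ι → MvPolynomial (Fin n) ℂ)}
    {π : (κ → MvPolynomial (Fin n) ℂ) →ₗ[MvPolynomial (Fin n) ℂ] K} (hπ : Function.Surjective π) :
    LinearMap.range (evalLin v (K.subtype ∘ₗ π)) = valueSpan v K := by
  refine le_antisymm ?_ (Submodule.span_le.mpr ?_)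
  · rintro _ ⟨x, rfl⟩
    exact evalLin_mem_valueSpan (fun c => (π c).2) x
  · rintro _ ⟨c, hc, rfl⟩
    obtain ⟨b, hb⟩ := hπ ⟨c, hc⟩
    refine ⟨fun j => aeval v (b j), ?_⟩
    rw [evalLin_aeval, LinearMap.comp_apply, hb]
    rfl

end polynomial

variable {n : ℕ} {a r : Fin n → ℤ}

open Classical in
/-- A complex of sums of twists that resolves a submodule of a free module, also after evaluation
at semistable points. -/
structure IsResolution (P : CochainComplex (Mat_ (Twist (weights a r))) ℤ) {κ : Type} [Fintype κ]
    (K : Submodule (MvPolynomial (Fin n) ℂ) (κ → MvPolynomial (Fin n) ℂ))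
    (𝒦 : ℤ × ℤ → AddSubgroup K)
    (π : ((P.X 0).ι → MvPolynomial (Fin n) ℂ) →ₗ[MvPolynomial (Fin n) ℂ] K) : Prop where
  surjective : Function.Surjective π
  mem : ∀ b, π (Pi.single b 1) ∈ 𝒦 (-((P.X 0).X b).deg)
  map_d : ∀ x, π (evalMat X (P.d (-1) 0) x) = 0
  isZero : ∀ m : ℤ, 0 < m → Limits.IsZero (P.X m)
  hull : ∃ lo hi : ℤ, (linesIn a r lo hi).triangulatedHull ((HomotopyCategory.quotient _ _).obj P)
  exact : ∀ (p : Pt a) (i j k : ℤ), i + 1 = j → j + 1 = k → j < 0 →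
    Function.Exact (evalMat p.v (P.d i j)) (evalMat p.v (P.d j k))
  ker : ∀ (p : Pt a) x, evalLin p.v (K.subtype ∘ₗ π) x = 0 → ∃ y, evalMat p.v (P.d (-1) 0) y = x

/-- The graded free module with generators of given degrees. -/
abbrev freeMat (a r : Fin n → ℤ) {ι : Type} [Fintype ι] (d : ι → ℤ × ℤ) : Mat_ (Twist (weights a r)) where
  ι := ι
  X i := ⟨-d i⟩

/-- A complex of sums of twists with an augmentation to a free module, whose cohomology in degree `0`
has the given relations. -/
structure IsPresentation (P : CochainComplex (Mat_ (Twist (weights a r))) ℤ) {ι : Type} [Fintype ι]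
    {d : ι → ℤ × ℤ} (s : P.X 0 ⟶ freeMat a r d)
    (K : Submodule (MvPolynomial (Fin n) ℂ) (ι → MvPolynomial (Fin n) ℂ)) : Prop where
  surjective : ∀ (R : Type) [CommRing R] [Algebra ℂ R] (v : Fin n → R),
    Function.Surjective (evalMat v s)
  map_d : ∀ x, evalMat X s (evalMat X (P.d (-1) 0) x) ∈ K
  isZero : ∀ m : ℤ, 0 < m → Limits.IsZero (P.X m)
  hull : ∃ lo hi : ℤ, (linesIn a r lo hi).triangulatedHull ((HomotopyCategory.quotient _ _).obj P)
  exact : ∀ (p : Pt a) (i j k : ℤ), i + 1 = j → j + 1 = k → j < 0 →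
    Function.Exact (evalMat p.v (P.d i j)) (evalMat p.v (P.d j k))
  mem_range : ∀ (p : Pt a) z, (∃ y, evalMat p.v (P.d (-1) 0) y = z) ↔
    evalMat p.v s z ∈ valueSpan p.v K

theorem hull_cone {P L : CochainComplex (Mat_ (Twist (weights a r))) ℤ} (φ : P ⟶ L)
    (hP : ∃ lo hi : ℤ, (linesIn a r lo hi).triangulatedHull ((HomotopyCategory.quotient _ _).obj P))
    (hL : ∃ lo hi : ℤ, (linesIn a r lo hi).triangulatedHull ((HomotopyCategory.quotient _ _).obj L)) :
    ∃ lo hi : ℤ, (linesIn a r lo hi).triangulatedHull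
      ((HomotopyCategory.quotient _ _).obj (mappingCone φ)) := by
  obtain ⟨lo, hi, hP⟩ := hP
  obtain ⟨lo', hi', hL⟩ := hL
  refine ⟨min lo lo', max hi hi', ?_⟩
  exact ObjectProperty.ext_of_isTriangulatedClosed₃ _ _
    (HomotopyCategory.mappingCone_triangleh_distinguished φ)
    (ObjectProperty.triangulatedHull_mono (linesIn_mono (min_le_left _ _) (le_max_left _ _)) _ hP)
    (ObjectProperty.triangulatedHull_mono (linesIn_mono (min_le_right _ _) (le_max_right _ _)) _ hL)

/-- The free module containing `K` is appended on the right by taking the cone of `P → F`, with `F`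
in degree `0`: the cone has `F` in degree `0` and moves the terms of `P` one place to the left. The
condition `ker` supplies exactness in the degree where the two meet. -/
theorem IsResolution.exists_isPresentation {P : CochainComplex (Mat_ (Twist (weights a r))) ℤ}
    {ι : Type} [Fintype ι] {d : ι → ℤ × ℤ}
    {K : Submodule (MvPolynomial (Fin n) ℂ) (ι → MvPolynomial (Fin n) ℂ)}
    {π : ((P.X 0).ι → MvPolynomial (Fin n) ℂ) →ₗ[MvPolynomial (Fin n) ℂ] K}
    (h : IsResolution P K
      (fun g => (freeGr (mvGr (weights a r)) d g).comap K.toAddSubgroup.subtype) π) :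
    ∃ (P' : CochainComplex (Mat_ (Twist (weights a r))) ℤ) (s : P'.X 0 ⟶ freeMat a r d),
      IsPresentation P' s K := by
  classical
  -- A generator of degree `d i` corresponds to the twist of degree `-d i`, which is why the degrees
  -- of the matrix entries match.
  let φ₀ : P.X 0 ⟶ freeMat a r d := fun c i => Twist.ofPoly ((π (Pi.single c 1)).1 i) (by
    have := mem_mvGr.mp (h.mem c i)
    rwa [neg_sub_left, add_comm, ← neg_sub_left] at this)
  have hφ₀ : ∀ (R : Type) [CommRing R] [Algebra ℂ R] (v : Fin n → R),
      evalMat v φ₀ = evalLin v (K.subtype ∘ₗ π) := by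
    intro R _ _ v
    apply LinearMap.ext
    intro x
    funext i
    rw [evalMat_apply, evalLin, Fintype.linearCombination_apply, Finset.sum_apply]
    exact Finset.sum_congr rfl fun c _ => mul_comm _ _
  have hφX : ∀ x, evalMat X φ₀ x = (π x : ι → MvPolynomial (Fin n) ℂ) := fun x => by
    rw [hφ₀, evalLin_X]; rfl
  have hd : ∀ i : ℤ, (ComplexShape.up ℤ).Rel i 0 → P.d i 0 ≫ φ₀ = 0 := by
    intro i hi
    obtain rfl : i = -1 := by
      have : i + 1 = 0 := hi
      lia
    refine eq_zero_of_evalMat_X (LinearMap.ext fun x => ?_)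
    rw [evalMat_comp, LinearMap.comp_apply, hφX, h.map_d]
    rfl
  let L := (HomologicalComplex.single (Mat_ (Twist (weights a r))) (ComplexShape.up ℤ) 0).obj
    (freeMat a r d)
  let φ : P ⟶ L := HomologicalComplex.mkHomToSingle φ₀ hd
  let e : L.X 0 ≅ freeMat a r d := HomologicalComplex.singleObjXSelf _ _ _
  have hφe : φ.f 0 = φ₀ ≫ e.inv := HomologicalComplex.mkHomToSingle_f _ _
  have hL : ∀ m : ℤ, m ≠ 0 → Limits.IsZero (L.X m) := fun m hm =>
    HomologicalComplex.isZero_single_obj_X _ _ _ _ hm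
  have he : ∀ (R : Type) [CommRing R] [Algebra ℂ R] (v : Fin n → R) x,
      evalMat v e.hom (evalMat v e.inv x) = x := by
    intro R _ _ v x
    have := congrArg (fun f => evalMat v f x) e.inv_hom_id
    simpa only [evalMat_comp, evalMat_id, LinearMap.comp_apply, LinearMap.id_apply] using this
  have he' : ∀ (R : Type) [CommRing R] [Algebra ℂ R] (v : Fin n → R) x,
      evalMat v e.inv (evalMat v e.hom x) = x := by
    intro R _ _ v x
    have := congrArg (fun f => evalMat v f x) e.hom_inv_id
    simpa only [evalMat_comp, evalMat_id, LinearMap.comp_apply, LinearMap.id_apply] using this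
  have hφx : ∀ (R : Type) [CommRing R] [Algebra ℂ R] (v : Fin n → R) x,
      evalMat v (φ.f 0) x = evalMat v e.inv (evalMat v φ₀ x) := by
    intro R _ _ v x
    rw [hφe, evalMat_comp]; rfl
  let s : (mappingCone φ).X 0 ⟶ freeMat a r d := (mappingCone.snd φ).v 0 0 (add_zero 0) ≫ e.hom
  have hs : ∀ (R : Type) [CommRing R] [Algebra ℂ R] (v : Fin n → R) z,
      evalMat v s z = evalMat v e.hom (coneSnd v φ 0 z) := by
    intro R _ _ v z
    exact LinearMap.congr_fun (evalMat_comp _ _ _) z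
  refine ⟨mappingCone φ, s, ⟨?_, ?_, ?_, ?_, ?_, ?_⟩⟩
  · intro R _ _ v y
    obtain ⟨z, -, hz⟩ := exists_cone v φ (zero_add 1) 0 (evalMat v e.inv y)
    exact ⟨z, by rw [hs, hz, he]⟩
  · intro x
    have := subsingleton_of_isZero (R := MvPolynomial (Fin n) ℂ) (hL (-1) (by simp))
    rw [hs, coneSnd_d _ φ (neg_add_cancel 1), Subsingleton.elim (coneSnd _ φ (-1) x) 0, map_zero,
      add_zero, hφx, he, hφX]
    exact Subtype.property _
  · intro m hm
    rw [mappingCone.isZero_X_iff]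
    exact ⟨h.isZero _ (by lia), hL m (by lia)⟩
  · exact hull_cone φ h.hull (exists_single_mem_hull _)
  · intro p i j k hij hjk hj
    rw [exact_cone_iff p.v φ hij hjk rfl]
    intro x y hx hy
    have := subsingleton_of_isZero (R := p.R) (hL j (by lia))
    have hy0 : y = 0 := Subsingleton.elim _ _
    rw [hy0, map_zero, add_zero] at hy
    suffices ∃ x', evalMat p.v (P.d j k) x' = x by
      obtain ⟨x', rfl⟩ := this
      exact ⟨-x', 0, by rw [map_neg, neg_neg], Subsingleton.elim _ _⟩
    by_cases hk : k < 0
    · exact (h.exact p j k (k + 1) hjk rfl hk x).mp hx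
    · obtain rfl : k = 0 := by lia
      obtain rfl : j = -1 := by lia
      refine h.ker p x ?_
      rw [← hφ₀, ← he p.R p.v (evalMat p.v φ₀ x), ← hφx, hy, map_zero]
  · intro p z
    have h1 := subsingleton_of_isZero (R := p.R) (hL (-1) (by simp))
    have h2 := subsingleton_of_isZero (R := p.R) (h.isZero 1 one_pos)
    rw [← range_evalLin_subtype_comp p.v h.surjective, ← hφ₀, hs]
    refine (mem_range_d_cone_iff p.v φ (neg_add_cancel 1) (zero_add 1) z).trans ⟨?_, ?_⟩
    · rintro ⟨x', y', -, h4⟩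
      refine ⟨x', ?_⟩
      rw [h4, Subsingleton.elim y' 0, map_zero, add_zero, hφx, he]
    · rintro ⟨x', hx'⟩
      refine ⟨x', 0, Subsingleton.elim _ _, ?_⟩
      rw [map_zero, add_zero, hφx, hx', he']

/-- Finite graded free resolutions of submodules that are locally direct summands, as complexes of
sums of twists. -/
theorem exists_isResolution (k : ℕ) : ∀ {κ : Type} [Fintype κ]
    {K : Submodule (MvPolynomial (Fin n) ℂ) (κ → MvPolynomial (Fin n) ℂ)}
    {𝒦 : ℤ × ℤ → AddSubgroup K}, (∀ {g h : ℤ × ℤ} {f : MvPolynomial (Fin n) ℂ} {m : K},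
      f ∈ mvGr (weights a r) g → m ∈ 𝒦 h → f • m ∈ 𝒦 (g + h)) →
    HasRes (mvGr (weights a r)) k K 𝒦 →
    (∀ i, 0 < a i → ∃ (N : ℕ) (ρ : (κ → MvPolynomial (Fin n) ℂ) →ₗ[MvPolynomial (Fin n) ℂ]
      (κ → MvPolynomial (Fin n) ℂ)), (∀ c, ρ c ∈ K) ∧ ∀ c ∈ K,
        ρ c = (X i ^ N : MvPolynomial (Fin n) ℂ) • c) →
    ∃ (P : CochainComplex (Mat_ (Twist (weights a r))) ℤ) (π : _), IsResolution P K 𝒦 π := by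
  classical
  induction k with
  | zero =>
    intro κ _ K 𝒦 _ hK _
    have : Subsingleton K := hK
    have hz : ∀ m, Limits.IsZero ((0 : CochainComplex (Mat_ (Twist (weights a r))) ℤ).X m) :=
      fun m => (HomologicalComplex.eval _ _ m).map_isZero (Limits.isZero_zero _)
    refine ⟨0, 0, ⟨fun x => ⟨0, Subsingleton.elim _ _⟩, fun b => zero_mem _, fun x => rfl,
      fun m _ => hz m, ⟨0, 0, ?_⟩, fun p i j k _ _ _ x => ?_, fun p x _ => ⟨0, ?_⟩⟩⟩
    · exact ObjectProperty.prop_of_isZero _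
        ((HomotopyCategory.quotient _ _).map_isZero (Limits.isZero_zero _))
    · have := subsingleton_of_isZero (R := p.R) (hz j)
      have := subsingleton_of_isZero (R := p.R) (hz k)
      exact ⟨fun _ => ⟨0, Subsingleton.elim _ _⟩, fun _ => Subsingleton.elim _ _⟩
    · have := subsingleton_of_isZero (R := p.R) (hz 0)
      exact Subsingleton.elim _ _
  | succ k ih =>
    rintro κ _ K 𝒦 hsmul ⟨ι, _, d, x, hx, hsurj, hres⟩ hρ
    set D := Fintype.linearCombination (MvPolynomial (Fin n) ℂ) x
    -- The almost-retraction onto `K` lifts along the cover `D`, giving a section of `D` up to the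
    -- factor `X i ^ N`.
    have hlift : ∀ i, 0 < a i → ∃ (N : ℕ) (τ : (κ → MvPolynomial (Fin n) ℂ) →ₗ[MvPolynomial (Fin n) ℂ]
        (ι → MvPolynomial (Fin n) ℂ)), ∀ c, (D (τ (D c)) : κ → MvPolynomial (Fin n) ℂ) =
          (X i ^ N : MvPolynomial (Fin n) ℂ) • (D c : κ → MvPolynomial (Fin n) ℂ) := by
      intro i hi
      obtain ⟨N, ρ, h₁, h₂⟩ := hρ i hi
      obtain ⟨τ, hτ⟩ := Module.projective_lifting_property D (ρ.codRestrict K h₁) hsurj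
      refine ⟨N, τ, fun c => ?_⟩
      rw [← h₂ _ (D c).2]
      exact congrArg Subtype.val (LinearMap.congr_fun hτ (D c : κ → MvPolynomial (Fin n) ℂ))
    -- `X i ^ N - τ D` maps into the kernel of `D` and is `X i ^ N` on it, so the summand hypothesis
    -- passes to the next syzygy.
    have hker : ∀ i, 0 < a i → ∃ (N : ℕ) (ρ : (ι → MvPolynomial (Fin n) ℂ) →ₗ[MvPolynomial (Fin n) ℂ]
        (ι → MvPolynomial (Fin n) ℂ)), (∀ c, ρ c ∈ LinearMap.ker D) ∧ ∀ c ∈ LinearMap.ker D,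
        ρ c = (X i ^ N : MvPolynomial (Fin n) ℂ) • c := by
      intro i hi
      obtain ⟨N, τ, hτ⟩ := hlift i hi
      refine ⟨N, (X i ^ N : MvPolynomial (Fin n) ℂ) • LinearMap.id - τ ∘ₗ K.subtype ∘ₗ D,
        fun c => ?_, fun c hc => ?_⟩
      · rw [LinearMap.mem_ker, LinearMap.sub_apply, map_sub, sub_eq_zero]
        exact Subtype.ext ((congrArg Subtype.val (map_smul D _ c)).trans (hτ c).symm)
      · rw [LinearMap.sub_apply, LinearMap.comp_apply, LinearMap.comp_apply, LinearMap.mem_ker.mp hc,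
          map_zero, map_zero, sub_zero]
        rfl
    obtain ⟨P', π', hP'⟩ := ih (fun {g h f m} hf hm => (isGr_freeGr (isGr_mvGr _) d).smul_mem (m := (m : ι → _)) hf hm)
      hres hker
    obtain ⟨P, s, hP⟩ := hP'.exists_isPresentation
    have hDs : ∀ (p : Pt a) z, evalLin p.v (K.subtype ∘ₗ D ∘ₗ evalMat X s) z =
        evalLin p.v (K.subtype ∘ₗ D) (evalMat p.v s z) := by
      intro p z
      refine LinearMap.congr_fun (f := evalLin p.v (K.subtype ∘ₗ D ∘ₗ evalMat X s))
        (g := evalLin p.v (K.subtype ∘ₗ D) ∘ₗ evalMat p.v s) (hom_ext_aeval (v := p.v) fun c => ?_) z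
      rw [LinearMap.comp_apply, evalLin_aeval, evalMat_aeval]
      exact (evalLin_aeval p.v (K.subtype ∘ₗ D) _).symm
    refine ⟨P, D ∘ₗ evalMat X s, ⟨hsurj.comp (hP.surjective _ X), fun b => ?_, fun x => hP.map_d x,
      hP.isZero, hP.hull, hP.exact, fun p z hz => ?_⟩⟩
    · have h1 : ∀ i, evalMat X s (Pi.single b 1) i = Twist.poly (s b i) := fun i => by
        rw [evalMat_apply, Finset.sum_eq_single b]
        · simp
        · intro c _ hc; simp [hc]
        · simp
      rw [LinearMap.comp_apply, Fintype.linearCombination_apply]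
      refine sum_mem fun i _ => ?_
      rw [h1]
      have h2 := hsmul (mem_mvGr.mpr (Twist.poly_mem (s b i))) (hx i)
      rwa [neg_sub_left, neg_add, add_assoc, neg_add_cancel, add_zero] at h2
    · rw [hP.mem_range]
      rw [hDs] at hz
      -- If the value of `D` at `p` annihilates an element, `X i ^ N - τ D` acts on it as `x_i ^ N`
      -- and maps it into the values of global relations. This replaces flatness in keeping the
      -- complex exact at arbitrary points.
      refine mem_of_pow_smul_mem p fun i hi => ?_
      obtain ⟨N, τ, hτ⟩ := hlift i hi
      refine ⟨N, ?_⟩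
      have h1 := evalLin_smul_sub (v := p.v) (X i ^ N) (τ ∘ₗ K.subtype ∘ₗ D) (evalMat p.v s z)
      have h2 : evalLin p.v (τ ∘ₗ K.subtype ∘ₗ D) (evalMat p.v s z) = 0 := by
        have h3 : evalLin p.v (τ ∘ₗ K.subtype ∘ₗ D) =
            evalLin p.v τ ∘ₗ evalLin p.v (K.subtype ∘ₗ D) := by
          refine hom_ext_aeval (v := p.v) fun c => ?_
          rw [LinearMap.comp_apply, evalLin_aeval, evalLin_aeval, evalLin_aeval]
          rfl
        rw [h3, LinearMap.comp_apply, hz, map_zero]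
      rw [h2, sub_zero, map_pow, aeval_X] at h1
      rw [← h1]
      refine evalLin_mem_valueSpan (fun c => ?_) _
      rw [LinearMap.mem_ker, LinearMap.sub_apply, map_sub, sub_eq_zero]
      exact Subtype.ext ((congrArg Subtype.val (map_smul D _ c)).trans (hτ c).symm)

end GaugedQuotient

/-! ### Invariance of resolutions under torsion cones -/

namespace GaugedQuotient

open CategoryTheory MvPolynomial GradedResolution CochainComplex Pretriangulated

variable {n : ℕ} {a r : Fin n → ℤ}

/-- The change of points for sums of twists. -/
def transport (P : Mat_ (Twist (weights a r))) {p q : Pt a} (h : PtHom r p q) (x : P.ι → p.R) :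
    P.ι → q.R := fun i => (chi h.l h.s (P.X i).deg : q.R) * h.φ (x i)

theorem evalMat_transport {P Q : Mat_ (Twist (weights a r))} (f : P ⟶ Q) {p q : Pt a}
    (h : PtHom r p q) (x : P.ι → p.R) :
    evalMat q.v f (transport P h x) = transport Q h (evalMat p.v f x) :=
  EqBundle.Hom.naturality ((toBundle a r).map f) h x

theorem transport_add (P : Mat_ (Twist (weights a r))) {p q : Pt a} (h : PtHom r p q)
    (x y : P.ι → p.R) : transport P h (x + y) = transport P h x + transport P h y :=
  map_add (((toBundle a r).obj P).map h) x y

/-- A relation that identifies the cohomology in degree `0` of a complex of sums of twists with the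
fibres of a bundle. -/
structure IsAugmentation (C : CochainComplex (Mat_ (Twist (weights a r))) ℤ) (E : EqBundle a r)
    (ρ : ∀ p : Pt a, Submodule p.R (((C.X 0).ι → p.R) × E.M p)) : Prop where
  exists_iff : ∀ p z, (∃ e, (z, e) ∈ ρ p) ↔ evalMat p.v (C.d 0 1) z = 0
  surjective : ∀ p e, ∃ z, (z, e) ∈ ρ p
  eq_zero_iff : ∀ p z e, (z, e) ∈ ρ p → (e = 0 ↔ ∃ y, evalMat p.v (C.d (-1) 0) y = z)
  naturality : ∀ (p q : Pt a) (h : PtHom r p q) z e, (z, e) ∈ ρ p →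
    (transport (C.X 0) h z, E.map h e) ∈ ρ q

/-- A complex of sums of twists resolves a bundle. -/
def HasResolution (C : CochainComplex (Mat_ (Twist (weights a r))) ℤ) (E : EqBundle a r) : Prop :=
  (∀ (p : Pt a) (i j k : ℤ), i + 1 = j → j + 1 = k → j ≠ 0 →
    Function.Exact (evalMat p.v (C.d i j)) (evalMat p.v (C.d j k))) ∧ ∃ ρ, IsAugmentation C E ρ

/-- Complexes that are exact at all semistable points. -/
theorem acyclicAt_of_torsionComplexes {X : HoTwist (weights a r)} (hX : torsionComplexes a r X)
    (p : Pt a) : acyclicAt (weights a r) p.v X := by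
  obtain ⟨K, rfl⟩ : ∃ K, X = (HomotopyCategory.quotient _ _).obj K := ⟨X.as, rfl⟩
  rw [acyclicAt_quotient_iff]
  intro i j k hij hjk x
  refine ⟨fun hx => ?_, ?_⟩
  · change x ∈ LinearMap.range (evalMat p.v (K.d i j))
    -- The complex is exact after inverting a positive coordinate; clearing denominators makes a
    -- power multiple of the cocycle a coboundary over `p`.
    refine mem_of_pow_smul_mem p fun m hm => ?_
    set q := p.away (p.v m)
    have h1 := (acyclicAt_quotient_iff q.v K).mp (hX q.R q.v m hm (Pt.isUnit_away_v p m)) i j k hij hjk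
    have hmap : ∀ {P Q : Mat_ (Twist (weights a r))} (f : P ⟶ Q) (y : P.ι → p.R),
        evalMat q.v f (fun b => algebraMap p.R q.R (y b)) =
          fun b => algebraMap p.R q.R (evalMat p.v f y b) := fun f y =>
      evalMat_map (IsScalarTower.toAlgHom ℂ p.R q.R) p.v f y
    obtain ⟨y, hy⟩ := (h1 fun b => algebraMap p.R q.R (x b)).mp (by
      rw [hmap, hx]
      funext b
      exact map_zero _)
    obtain ⟨⟨_, N, rfl⟩, hN⟩ := IsLocalization.exist_integer_multiples_of_finite
      (Submonoid.powers (p.v m)) y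
    choose y' hy' using hN
    have h2 : ∀ b, ∃ l : ℕ, p.v m ^ l * (p.v m ^ N * x b - evalMat p.v (K.d i j) y' b) = 0 := by
      intro b
      have h3 : algebraMap p.R q.R (p.v m ^ N * x b - evalMat p.v (K.d i j) y' b) = 0 := by
        have h4 : (fun b => algebraMap p.R q.R (y' b)) = algebraMap p.R q.R (p.v m ^ N) • y := by
          funext b
          exact (hy' b).trans (Algebra.smul_def _ _)
        have h5 := congrFun (hmap (K.d i j) y') b
        rw [h4, map_smul, hy] at h5
        rw [map_sub, map_mul, ← h5]
        exact sub_self _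
      obtain ⟨⟨_, l, rfl⟩, hl⟩ := (IsLocalization.map_eq_zero_iff (Submonoid.powers (p.v m)) _ _).mp h3
      exact ⟨l, hl⟩
    choose l hl using h2
    refine ⟨(∑ b, l b) + N, ?_⟩
    have h3 : p.v m ^ (∑ b, l b) • (p.v m ^ N • x - evalMat p.v (K.d i j) y') = 0 := by
      funext b
      obtain ⟨e, he⟩ := Nat.exists_eq_add_of_le (Finset.single_le_sum (f := l)
        (fun _ _ => Nat.zero_le _) (Finset.mem_univ b))
      rw [Pi.smul_apply, smul_eq_mul, he, pow_add, mul_comm (p.v m ^ l b), mul_assoc]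
      refine (congrArg _ (hl b)).trans ?_
      rw [mul_zero]; rfl
    rw [smul_sub, smul_smul, ← pow_add, sub_eq_zero] at h3
    rw [h3, ← map_smul]
    exact ⟨_, rfl⟩
  · rintro ⟨y, rfl⟩
    exact evalMat_d_d p.v K i j k y

section transfer

variable {K L : CochainComplex (Mat_ (Twist (weights a r))) ℤ} (f : K ⟶ L)
  (hf : ∀ (p : Pt a) (i j k : ℤ), i + 1 = j → j + 1 = k →
    Function.Exact (evalMat p.v ((mappingCone f).d i j)) (evalMat p.v ((mappingCone f).d j k)))

include hf

/-- Surjectivity on cohomology: `(0, y)` is a cocycle of the exact cone. -/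
theorem exists_cocycle_of_cone (p : Pt a) {i j k : ℤ} (hij : i + 1 = j) (hjk : j + 1 = k)
    {y : (L.X j).ι → p.R} (hy : evalMat p.v (L.d j k) y = 0) :
    ∃ (x : (K.X j).ι → p.R) (y' : (L.X i).ι → p.R), evalMat p.v (K.d j k) x = 0 ∧
      y = evalMat p.v (f.f j) x + evalMat p.v (L.d i j) y' := by
  obtain ⟨x, y', h₁, h₂⟩ := (exact_cone_iff p.v f hij hjk rfl).mp (hf p i j k hij hjk) 0 y
    (map_zero _) (by rw [map_zero, zero_add, hy])
  exact ⟨x, y', neg_eq_zero.mp h₁.symm, h₂⟩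

/-- Injectivity on cohomology: `(x, -y)` is a cocycle of the exact cone. -/
theorem exists_coboundary_of_cone (p : Pt a) {j k l : ℤ} (hjk : j + 1 = k) (hkl : k + 1 = l)
    {x : (K.X k).ι → p.R} (hx : evalMat p.v (K.d k l) x = 0) {y : (L.X j).ι → p.R}
    (hy : evalMat p.v (L.d j k) y = evalMat p.v (f.f k) x) :
    ∃ x', evalMat p.v (K.d j k) x' = x := by
  obtain ⟨x', y', h₁, h₂⟩ := (exact_cone_iff p.v f (sub_add_cancel j 1) hjk hkl).mp
    (hf p _ j k (sub_add_cancel j 1) hjk) x (-y) hx (by rw [map_neg, hy, add_neg_cancel])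
  exact ⟨-x', by rw [map_neg, h₁]⟩

/-- The augmentation is pushed forward: each cocycle of `L` is the image of one of `K` up to a
coboundary. Taking the augmentation to be a relation avoids choosing these representatives, and
makes linearity and naturality immediate. -/
theorem HasResolution.of_source {E : EqBundle a r} (h : HasResolution K E) : HasResolution L E := by
  obtain ⟨hex, ρ, hρ⟩ := h
  refine ⟨fun p i j k hij hjk hj y => ⟨fun hy => ?_, ?_⟩, fun p =>
    { carrier := {ze | ∃ x y, (x, ze.2) ∈ ρ p ∧
        ze.1 = evalMat p.v (f.f 0) x + evalMat p.v (L.d (-1) 0) y}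
      zero_mem' := ⟨0, 0, (ρ p).zero_mem, by rw [map_zero, map_zero, add_zero]; rfl⟩
      add_mem' := ?_
      smul_mem' := ?_ }, ⟨?_, ?_, ?_, ?_⟩⟩
  · obtain ⟨x, y', hx, rfl⟩ := exists_cocycle_of_cone f hf p hij hjk hy
    obtain ⟨x', rfl⟩ := (hex p i j k hij hjk hj x).mp hx
    exact ⟨evalMat p.v (f.f i) x' + y', by rw [map_add, evalMat_hom_comm]⟩
  · rintro ⟨y, rfl⟩
    exact evalMat_d_d p.v L i j k y
  · rintro ⟨z, e⟩ ⟨z', e'⟩ ⟨x, y, h₁, h₂⟩ ⟨x', y', h₁', h₂'⟩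
    refine ⟨x + x', y + y', (ρ p).add_mem h₁ h₁', ?_⟩
    dsimp only at h₂ h₂' ⊢
    rw [Prod.fst_add, h₂, h₂', map_add, map_add, add_add_add_comm]
  · rintro c ⟨z, e⟩ ⟨x, y, h₁, h₂⟩
    refine ⟨c • x, c • y, (ρ p).smul_mem c h₁, ?_⟩
    dsimp only at h₂ ⊢
    rw [Prod.smul_fst, h₂, map_smul, map_smul, smul_add]
  · intro p z
    constructor
    · rintro ⟨e, x, y, h₁, h₂⟩
      dsimp only at h₁ h₂
      rw [h₂, map_add, evalMat_d_d, add_zero, ← evalMat_hom_comm, (hρ.exists_iff p x).mp ⟨e, h₁⟩,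
        map_zero]
    · intro hz
      obtain ⟨x, y, hx, rfl⟩ := exists_cocycle_of_cone f hf p (neg_add_cancel 1) (zero_add 1) hz
      obtain ⟨e, he⟩ := (hρ.exists_iff p x).mpr hx
      exact ⟨e, x, y, he, rfl⟩
  · intro p e
    obtain ⟨x, hx⟩ := hρ.surjective p e
    exact ⟨_, x, 0, hx, rfl⟩
  · rintro p z e ⟨x, y, h₁, h₂⟩
    dsimp only at h₁ h₂
    rw [hρ.eq_zero_iff p x e h₁]
    constructor
    · rintro ⟨x', rfl⟩
      exact ⟨evalMat p.v (f.f (-1)) x' + y, by rw [map_add, h₂, evalMat_hom_comm]⟩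
    · rintro ⟨y', rfl⟩
      refine exists_coboundary_of_cone f hf p (neg_add_cancel 1) (zero_add 1)
        ((hρ.exists_iff p x).mp ⟨e, h₁⟩) (y := y' - y) ?_
      rw [map_sub, h₂, add_sub_cancel_right]
  · rintro p q h z e ⟨x, y, h₁, h₂⟩
    refine ⟨transport _ h x, transport _ h y, hρ.naturality p q h x e h₁, ?_⟩
    dsimp only at h₂ ⊢
    rw [h₂, transport_add, evalMat_transport, evalMat_transport]

/-- The augmentation is pulled back along `f` on cocycles. To represent `e`, a cocycle of `L` is
changed by a coboundary, which is related to zero, until it comes from `K`. -/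
theorem HasResolution.of_target {E : EqBundle a r} (h : HasResolution L E) : HasResolution K E := by
  obtain ⟨hex, ρ, hρ⟩ := h
  have key : ∀ (p : Pt a) (x : (K.X 0).ι → p.R), evalMat p.v (K.d 0 1) x = 0 →
      ((∃ x', evalMat p.v (K.d (-1) 0) x' = x) ↔
        ∃ y, evalMat p.v (L.d (-1) 0) y = evalMat p.v (f.f 0) x) := by
    intro p x hx
    constructor
    · rintro ⟨x', rfl⟩
      exact ⟨evalMat p.v (f.f (-1)) x', (evalMat_hom_comm _ _ _ _ _).symm⟩
    · rintro ⟨y, hy⟩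
      exact exists_coboundary_of_cone f hf p (neg_add_cancel 1) (zero_add 1) hx hy
  refine ⟨fun p i j k hij hjk hj x => ⟨fun hx => ?_, ?_⟩, fun p =>
    { carrier := {ze | evalMat p.v (K.d 0 1) ze.1 = 0 ∧ (evalMat p.v (f.f 0) ze.1, ze.2) ∈ ρ p}
      zero_mem' := ⟨map_zero _, by
        change (evalMat p.v (f.f 0) 0, (0 : E.M p)) ∈ ρ p
        rw [map_zero]
        exact (ρ p).zero_mem⟩
      add_mem' := ?_
      smul_mem' := ?_ }, ⟨?_, ?_, ?_, ?_⟩⟩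
  · obtain ⟨y, hy⟩ := (hex p i j k hij hjk hj (evalMat p.v (f.f j) x)).mp (by
      rw [← evalMat_hom_comm, hx, map_zero])
    exact exists_coboundary_of_cone f hf p hij hjk hx hy
  · rintro ⟨y, rfl⟩
    exact evalMat_d_d p.v K i j k y
  · rintro ⟨z, e⟩ ⟨z', e'⟩ ⟨h₁, h₂⟩ ⟨h₁', h₂'⟩
    dsimp only at h₁ h₁' h₂ h₂'
    refine ⟨by rw [Prod.fst_add, map_add, h₁, h₁', add_zero], ?_⟩
    rw [Prod.fst_add, map_add]
    exact (ρ p).add_mem h₂ h₂'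
  · rintro c ⟨z, e⟩ ⟨h₁, h₂⟩
    dsimp only at h₁ h₂
    refine ⟨by rw [Prod.smul_fst, map_smul, h₁, smul_zero], ?_⟩
    rw [Prod.smul_fst, map_smul]
    exact (ρ p).smul_mem c h₂
  · intro p z
    constructor
    · rintro ⟨e, h₁, -⟩
      exact h₁
    · intro hz
      obtain ⟨e, he⟩ := (hρ.exists_iff p (evalMat p.v (f.f 0) z)).mpr (by
        rw [← evalMat_hom_comm, hz, map_zero])
      exact ⟨e, hz, he⟩
  · intro p e
    obtain ⟨z, hz⟩ := hρ.surjective p e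
    obtain ⟨x, y, hx, rfl⟩ := exists_cocycle_of_cone f hf p (neg_add_cancel 1) (zero_add 1)
      ((hρ.exists_iff p z).mp ⟨e, hz⟩)
    refine ⟨x, hx, ?_⟩
    obtain ⟨e', he'⟩ := (hρ.exists_iff p (evalMat p.v (L.d (-1) 0) y)).mpr (evalMat_d_d _ _ _ _ _ _)
    have h0 : e' = 0 := (hρ.eq_zero_iff p _ e' he').mpr ⟨y, rfl⟩
    have := (ρ p).sub_mem hz he'
    rwa [h0, Prod.mk_sub_mk, sub_zero, add_sub_cancel_right] at this
  · rintro p z e ⟨h₁, h₂⟩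
    rw [hρ.eq_zero_iff p _ e h₂]
    exact (key p z h₁).symm
  · rintro p q h z e ⟨h₁, h₂⟩
    dsimp only at h₁ h₂
    refine ⟨?_, ?_⟩
    · rw [evalMat_transport, h₁]
      exact map_zero (((toBundle a r).obj _).map h)
    · dsimp only
      rw [evalMat_transport]
      exact hρ.naturality p q h _ e h₂

end transfer

/-- Resolutions can be transferred along morphisms in the homotopy category whose cones are exact at
all semistable points. -/
theorem hasResolution_iff_of_distTriang {X Y Z : HoTwist (weights a r)} {f : X ⟶ Y} {g : Y ⟶ Z}
    {h : Z ⟶ X⟦(1 : ℤ)⟧} (hT : Triangle.mk f g h ∈ distTriang _) (hZ : torsionComplexes a r Z)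
    (E : EqBundle a r) : HasResolution X.as E ↔ HasResolution Y.as E := by
  obtain ⟨φ, hφ⟩ := (HomotopyCategory.quotient _ _).map_surjective
    (show (HomotopyCategory.quotient _ _).obj X.as ⟶ (HomotopyCategory.quotient _ _).obj Y.as from f)
  have hT' := HomotopyCategory.mappingCone_triangleh_distinguished φ
  -- The morphism `f` is represented by a chain map `φ`, so the third vertex is isomorphic to the
  -- mapping cone of `φ`, and that cone is exact at all semistable points.
  have e := isoTriangleOfIso₁₂ _ _ hT hT' (Iso.refl _) (Iso.refl _) (by
    refine (Category.comp_id _).trans (Eq.trans ?_ (Category.id_comp _).symm)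
    exact hφ.symm)
  have hcone : torsionComplexes a r ((HomotopyCategory.quotient _ _).obj (mappingCone φ)) :=
    ObjectProperty.prop_of_iso _ (Triangle.π₃.mapIso e) hZ
  have hf : ∀ (p : Pt a) (i j k : ℤ), i + 1 = j → j + 1 = k →
      Function.Exact (evalMat p.v ((mappingCone φ).d i j)) (evalMat p.v ((mappingCone φ).d j k)) :=
    fun p => (acyclicAt_quotient_iff p.v _).mp (acyclicAt_of_torsionComplexes hcone p)
  exact ⟨HasResolution.of_source φ hf, HasResolution.of_target φ hf⟩

end GaugedQuotient

/-! ### Resolving a bundle and moving the weights into the window -/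

namespace GaugedQuotient

open CategoryTheory MvPolynomial GradedResolution CochainComplex Pretriangulated

variable {n : ℕ} {a r : Fin n → ℤ} {E : EqBundle a r} {ι : Type} [Fintype ι] {d : ι → ℤ × ℤ}
  {γ : ι → E.M (Pt.generic a)}

/-- The map from a free module to a bundle given by global sections, on the fibre over a point. -/
noncomputable def sectionsMap (γ : ι → E.M (Pt.generic a)) (p : Pt a) : (ι → p.R) →ₗ[p.R] E.M p :=
  Fintype.linearCombination p.R fun j => E.map (PtHom.ofGeneric r p) (γ j)

theorem sectionsMap_apply (p : Pt a) (c : ι → p.R) :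
    sectionsMap γ p c = ∑ j, c j • E.map (PtHom.ofGeneric r p) (γ j) := rfl

theorem sectionsMap_surjective (hγ : ∀ j, IsHom E (-d j) (γ j))
    (hspan : ∀ i hi, Submodule.span (Pt.chart a i hi).R
      (Set.range fun j => E.map (PtHom.ofGeneric r (Pt.chart a i hi)) (γ j)) = ⊤) (p : Pt a) :
    Function.Surjective (sectionsMap γ p) := by
  rw [← LinearMap.range_eq_top, sectionsMap, Fintype.range_linearCombination]
  exact span_range_map_ofGeneric hγ hspan p

theorem sectionsMap_eq_zero_iff (hγ : ∀ j, IsHom E (-d j) (γ j))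
    (hspan : ∀ i hi, Submodule.span (Pt.chart a i hi).R
      (Set.range fun j => E.map (PtHom.ofGeneric r (Pt.chart a i hi)) (γ j)) = ⊤) {p : Pt a}
    {c : ι → p.R} : sectionsMap γ p c = 0 ↔
      c ∈ valueSpan p.v (LinearMap.ker (Fintype.linearCombination (MvPolynomial (Fin n) ℂ) γ)) := by
  refine ⟨fun h => mem_valueSpan_ker hγ hspan h, fun h => ?_⟩
  have : valueSpan p.v (LinearMap.ker (Fintype.linearCombination (MvPolynomial (Fin n) ℂ) γ)) ≤
      LinearMap.ker (sectionsMap γ p) := by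
    rw [valueSpan, Submodule.span_le]
    rintro _ ⟨c, hc, rfl⟩
    change sectionsMap γ p _ = 0
    rw [sectionsMap_apply, ← map_sum_smul (PtHom.ofGeneric r p) (by simp) (by simp) c]
    rw [LinearMap.mem_ker.mp hc]
    exact map_zero _
  exact this h

/-- The homogeneity of the sections `γ j` cancels the characters in the transition maps of the free
module. -/
theorem sectionsMap_transport (hγ : ∀ j, IsHom E (-d j) (γ j)) {p q : Pt a} (h : PtHom r p q)
    (c : ι → p.R) :
    sectionsMap γ q (transport (freeMat a r d) h c) = E.map h (sectionsMap γ p c) := by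
  rw [sectionsMap_apply, sectionsMap_apply, map_sum]
  refine Finset.sum_congr rfl fun j _ => ?_
  rw [(E.map h).map_smulₛₗ, ← E.map_comp]
  have h1 := hγ j q ((PtHom.ofGeneric r p).comp h) (PtHom.ofGeneric r q)
  have hl : ((PtHom.ofGeneric r p).comp h).l = h.l := by simp [PtHom.comp]
  have hs : ((PtHom.ofGeneric r p).comp h).s = h.s := by simp [PtHom.comp]
  rw [hl, hs] at h1
  have h2 : chi (PtHom.ofGeneric r q).l (PtHom.ofGeneric r q).s (-d j) = 1 := by simp [chi]
  rw [h2, Units.val_one, one_smul] at h1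
  rw [h1, smul_smul, mul_comm]
  rfl

/-- The augmentation is the graph of `s` followed by the map given by global sections. Its kernel
consists of the values of the global relations, by `sectionsMap_eq_zero_iff`. -/
theorem IsPresentation.hasResolution {P : CochainComplex (Mat_ (Twist (weights a r))) ℤ}
    {s : P.X 0 ⟶ freeMat a r d}
    (hP : IsPresentation P s (LinearMap.ker (Fintype.linearCombination (MvPolynomial (Fin n) ℂ) γ)))
    (hγ : ∀ j, IsHom E (-d j) (γ j))
    (hspan : ∀ i hi, Submodule.span (Pt.chart a i hi).R
      (Set.range fun j => E.map (PtHom.ofGeneric r (Pt.chart a i hi)) (γ j)) = ⊤) :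
    HasResolution P E := by
  refine ⟨fun p i j k hij hjk hj => ?_, fun p => (sectionsMap γ p ∘ₗ evalMat p.v s).graph,
    ⟨fun p z => ?_, fun p e => ?_, fun p z e h => ?_, fun p q h z e he => ?_⟩⟩
  · rcases hj.lt_or_gt with hj | hj
    · exact hP.exact p i j k hij hjk hj
    · have := subsingleton_of_isZero (R := p.R) (hP.isZero j hj)
      exact fun x => ⟨fun _ => ⟨0, Subsingleton.elim _ _⟩, fun _ => by
        rw [Subsingleton.elim x 0, map_zero]⟩
  · have := subsingleton_of_isZero (R := p.R) (hP.isZero 1 one_pos)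
    exact ⟨fun _ => Subsingleton.elim _ _, fun _ =>
      ⟨sectionsMap γ p (evalMat p.v s z), (LinearMap.mem_graph_iff _ _).mpr rfl⟩⟩
  · obtain ⟨c, rfl⟩ := sectionsMap_surjective hγ hspan p e
    obtain ⟨z, rfl⟩ := hP.surjective p.R p.v c
    exact ⟨z, (LinearMap.mem_graph_iff _ _).mpr rfl⟩
  · rw [LinearMap.mem_graph_iff] at h
    dsimp only at h
    rw [hP.mem_range, h]
    exact sectionsMap_eq_zero_iff hγ hspan
  · rw [LinearMap.mem_graph_iff] at he ⊢
    dsimp only at he ⊢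
    rw [he]
    change E.map h (sectionsMap γ p (evalMat p.v s z)) =
      sectionsMap γ q (evalMat q.v s (transport _ h z))
    rw [evalMat_transport, sectionsMap_transport hγ]

/-- Every bundle has a resolution by sums of twists. -/
theorem exists_hasResolution (E : EqBundle a r) :
    ∃ (X : HoTwist (weights a r)) (lo hi : ℤ), HasResolution X.as E ∧
      (linesIn a r lo hi).triangulatedHull X := by
  obtain ⟨k, ι, _, d, γ, hγ, hspan, hres⟩ := EqBundle.exists_hasRes E
  obtain ⟨P, π, hP⟩ := exists_isResolution k
    (fun {g h f m} hf hm => (isGr_freeGr (isGr_mvGr _) d).smul_mem (m := (m : ι → _)) hf hm) hres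
    (fun i hi => exists_retraction_ker hγ hspan i hi)
  obtain ⟨P', s, hP'⟩ := hP.exists_isPresentation
  obtain ⟨lo, hi, h⟩ := hP'.hull
  exact ⟨_, lo, hi, hP'.hasResolution hγ hspan, h⟩

/-- Each use of `lower_window` drops the highest weight at the cost of a torsion third vertex. It
applies while `hi` is above the top of the window, since then `lo ≤ t` makes the interval longer
than the sum of the positive weights. -/
theorem exists_hasResolution_of_le (E : EqBundle a r) {lo hi t : ℤ} (m : ℕ) :
    lo ≤ t → hi = t + ∑ i with 0 < a i, a i - 1 + m →
    (∃ X : HoTwist (weights a r), HasResolution X.as E ∧ (linesIn a r lo hi).triangulatedHull X) →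
    ∃ X : HoTwist (weights a r), HasResolution X.as E ∧
      (linesIn a r lo (t + ∑ i with 0 < a i, a i - 1)).triangulatedHull X := by
  induction m generalizing hi with
  | zero =>
    rintro - rfl ⟨X, h⟩
    exact ⟨X, by simpa using h⟩
  | succ m ih =>
    rintro hlo rfl ⟨X, hX, h⟩
    push_cast at h
    obtain ⟨Y, Z, f, g, u, hT, hY, hZ⟩ := lower_window (by lia) _ h
    exact ih hlo (hi := t + ∑ i with 0 < a i, a i - 1 + (m + 1 : ℤ) - 1) (by ring)
      ⟨Y, (hasResolution_iff_of_distTriang hT hZ E).mpr hX, hY⟩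

/-- Dual to the preceding induction with `raise_window`. The torsion object is now the first vertex,
so the triangle is rotated. -/
theorem exists_hasResolution_of_ge (E : EqBundle a r) {lo t : ℤ} (m : ℕ) :
    lo + m = t →
    (∃ X : HoTwist (weights a r), HasResolution X.as E ∧
      (linesIn a r lo (t + ∑ i with 0 < a i, a i - 1)).triangulatedHull X) →
    ∃ X : HoTwist (weights a r), HasResolution X.as E ∧
      (linesIn a r t (t + ∑ i with 0 < a i, a i - 1)).triangulatedHull X := by
  induction m generalizing lo with
  | zero =>
    rintro rfl ⟨X, h⟩
    exact ⟨X, by simpa using h⟩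
  | succ m ih =>
    rintro rfl ⟨X, hX, h⟩
    push_cast at h ih ⊢
    obtain ⟨Y, Z, f, g, u, hT, hY, hZ⟩ := raise_window (by lia) _ h
    exact ih (lo := lo + 1) (by ring)
      ⟨Z, (hasResolution_iff_of_distTriang (rot_of_distTriang _ hT)
        ((torsionComplexes a r).le_shift 1 _ hY) E).mp hX, hZ⟩

/-- Every bundle has a resolution by sums of twists in a given window. -/
theorem exists_hasResolution_window (E : EqBundle a r) (t : ℤ) :
    ∃ X : HoTwist (weights a r), HasResolution X.as E ∧
      (linesIn a r t (t + ∑ i with 0 < a i, a i - 1)).triangulatedHull X := by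
  obtain ⟨X, lo, hi, hX, h⟩ := exists_hasResolution E
  set e := ∑ i with 0 < a i, a i
  -- The interval is enlarged to contain the window; `m` and `k` count the weights to be removed
  -- below and above it.
  obtain ⟨m, hm⟩ := Int.eq_ofNat_of_zero_le (sub_nonneg.mpr (min_le_right lo t))
  obtain ⟨k, hk⟩ := Int.eq_ofNat_of_zero_le (sub_nonneg.mpr (le_max_right hi (t + e - 1)))
  refine exists_hasResolution_of_ge E (lo := min lo t) m (by lia)
    (exists_hasResolution_of_le E (hi := max hi (t + e - 1)) k (min_le_right _ _) (by lia)
      ⟨X, hX, ObjectProperty.triangulatedHull_mono (linesIn_mono (min_le_left _ _)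
        (le_max_left _ _)) _ h⟩)

end GaugedQuotient

/-! ### Explicit binary sums of formal direct sums -/

namespace CategoryTheory.Mat_

variable {C : Type*} [Category* C] [Preadditive C]

/-- The explicit sum of two families of objects. -/
def sum (A B : Mat_ C) : Mat_ C where
  ι := A.ι ⊕ B.ι
  X := Sum.elim A.X B.X

/-- The explicit sum is a biproduct. -/
noncomputable def biprodIsoSum (A B : Mat_ C) [Limits.HasBinaryBiproduct A B] : A ⊞ B ≅ sum A B := by
  let inl : A ⟶ sum A B := fun i => Sum.rec (fun j => (𝟙 A : Mat_.Hom A A) i j) (fun _ => 0)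
  let inr : B ⟶ sum A B := fun i => Sum.rec (fun _ => 0) (fun j => (𝟙 B : Mat_.Hom B B) i j)
  let fst : sum A B ⟶ A := Sum.rec (fun i j => (𝟙 A : Mat_.Hom A A) i j) (fun _ _ => 0)
  let snd : sum A B ⟶ B := Sum.rec (fun _ _ => 0) (fun i j => (𝟙 B : Mat_.Hom B B) i j)
  have hid : ∀ (D : Mat_ C) (i j : D.ι),
      ∑ k, (𝟙 D : Mat_.Hom D D) i k ≫ (𝟙 D : Mat_.Hom D D) k j = (𝟙 D : Mat_.Hom D D) i j :=
    fun D i j => congrFun₂ (Category.id_comp (𝟙 D)) i j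
  exact
    { hom := Limits.biprod.desc inl inr
      inv := Limits.biprod.lift fst snd
      hom_inv_id := by
        have h₁ : inl ≫ fst = 𝟙 A := by
          funext i j
          refine (Fintype.sum_sum_type _).trans ((congrArg₂ (· + ·) (hid A i j)
            (Finset.sum_eq_zero fun _ _ => Limits.zero_comp)).trans (add_zero _))
        have h₂ : inl ≫ snd = 0 := by
          funext i j
          refine (Fintype.sum_sum_type _).trans ((congrArg₂ (· + ·)
            (Finset.sum_eq_zero fun _ _ => Limits.comp_zero)
            (Finset.sum_eq_zero fun _ _ => Limits.zero_comp)).trans (add_zero _))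
        have h₃ : inr ≫ fst = 0 := by
          funext i j
          refine (Fintype.sum_sum_type _).trans ((congrArg₂ (· + ·)
            (Finset.sum_eq_zero fun _ _ => Limits.zero_comp)
            (Finset.sum_eq_zero fun _ _ => Limits.comp_zero)).trans (add_zero _))
        have h₄ : inr ≫ snd = 𝟙 B := by
          funext i j
          refine (Fintype.sum_sum_type _).trans ((congrArg₂ (· + ·)
            (Finset.sum_eq_zero fun _ _ => Limits.zero_comp) (hid B i j)).trans (zero_add _))
        apply Limits.biprod.hom_ext' <;> apply Limits.biprod.hom_ext <;> simp [h₁, h₂, h₃, h₄]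
      inv_hom_id := by
        rw [Limits.biprod.lift_desc]
        have hne : ∀ i j, i ≠ j → (𝟙 (sum A B) : Mat_.Hom _ _) i j = 0 := Mat_.id_apply_of_ne _
        have hl : ∀ i j, (𝟙 A : Mat_.Hom A A) i j =
            (𝟙 (sum A B) : Mat_.Hom _ _) (Sum.inl i) (Sum.inl j) := fun i j => by
          by_cases h : i = j
          · subst h; exact (Mat_.id_apply_self A i).trans (Mat_.id_apply_self (sum A B) (Sum.inl i)).symm
          · exact (Mat_.id_apply_of_ne A i j h).trans
              (hne (Sum.inl i) (Sum.inl j) fun h' => h (Sum.inl_injective h')).symm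
        have hr : ∀ i j, (𝟙 B : Mat_.Hom B B) i j =
            (𝟙 (sum A B) : Mat_.Hom _ _) (Sum.inr i) (Sum.inr j) := fun i j => by
          by_cases h : i = j
          · subst h; exact (Mat_.id_apply_self B i).trans (Mat_.id_apply_self (sum A B) (Sum.inr i)).symm
          · exact (Mat_.id_apply_of_ne B i j h).trans
              (hne (Sum.inr i) (Sum.inr j) fun h' => h (Sum.inr_injective h')).symm
        funext i j
        rcases i with i | i <;> rcases j with j | j
        · exact (congrArg₂ (· + ·) (hid A i j) (Finset.sum_eq_zero fun _ _ =>
            Limits.zero_comp)).trans ((add_zero _).trans (hl i j))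
        · exact (congrArg₂ (· + ·) (Finset.sum_eq_zero fun _ _ => Limits.comp_zero)
            (Finset.sum_eq_zero fun _ _ => Limits.zero_comp)).trans
              ((add_zero _).trans (hne (Sum.inl i) (Sum.inr j) Sum.inl_ne_inr).symm)
        · exact (congrArg₂ (· + ·) (Finset.sum_eq_zero fun _ _ => Limits.zero_comp)
            (Finset.sum_eq_zero fun _ _ => Limits.comp_zero)).trans
              ((add_zero _).trans (hne (Sum.inr i) (Sum.inl j) Sum.inr_ne_inl).symm)
        · exact (congrArg₂ (· + ·) (Finset.sum_eq_zero fun _ _ => Limits.zero_comp)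
            (hid B i j)).trans ((zero_add _).trans (hr i j)) }

end CategoryTheory.Mat_

/-! ### Bounded complexes with terms in a given class -/

namespace GaugedQuotient

open CategoryTheory CochainComplex Pretriangulated Limits

section

variable {C : Type*} [Category* C] [Preadditive C] [HasZeroObject C] [HasBinaryBiproducts C]

/-- The objects of the homotopy category that are represented by bounded complexes with terms in a
given class. -/
def boundedIn (S : ObjectProperty C) : ObjectProperty (HomotopyCategory C (ComplexShape.up ℤ)) :=
  fun X => ∃ W : CochainComplex C ℤ, (∃ N : ℤ, ∀ i, N < |i| → IsZero (W.X i)) ∧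
    (∀ i, S (W.X i)) ∧ Nonempty (X ≅ (HomotopyCategory.quotient _ _).obj W)

variable (S : ObjectProperty C)

instance : (boundedIn S).IsClosedUnderIsomorphisms where
  of_iso e := fun ⟨W, hN, hS, ⟨e'⟩⟩ => ⟨W, hN, hS, ⟨e.symm ≪≫ e'⟩⟩

variable {S} [S.IsClosedUnderIsomorphisms]

/-- The third vertex is represented by a mapping cone, whose term in degree `i` is the sum of the
terms of the source in degree `i + 1` and of the target in degree `i`; this is the reason for the
bound `N₁ + 1`. -/
theorem boundedIn_ext₃ (hS : ∀ {A B}, S A → S B → S (A ⊞ B))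
    {T : Triangle (HomotopyCategory C (ComplexShape.up ℤ))} (hT : T ∈ distTriang _)
    (h₁ : boundedIn S T.obj₁) (h₂ : boundedIn S T.obj₂) : boundedIn S T.obj₃ := by
  obtain ⟨W₁, ⟨N₁, hN₁⟩, hS₁, ⟨e₁⟩⟩ := h₁
  obtain ⟨W₂, ⟨N₂, hN₂⟩, hS₂, ⟨e₂⟩⟩ := h₂
  obtain ⟨φ, hφ⟩ := (HomotopyCategory.quotient _ _).map_surjective (e₁.inv ≫ T.mor₁ ≫ e₂.hom)
  refine ⟨mappingCone φ, ⟨max (N₁ + 1) N₂, fun i hi => ?_⟩, fun i => ?_, ⟨Triangle.π₃.mapIso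
    (isoTriangleOfIso₁₂ _ _ hT (HomotopyCategory.mappingCone_triangleh_distinguished φ) e₁ e₂ ?_)⟩⟩
  · rw [mappingCone.isZero_X_iff]
    exact ⟨hN₁ _ (by grind), hN₂ _ (by grind)⟩
  · exact S.prop_of_iso (HomologicalComplex.homotopyCofiber.XIsoBiprod φ i (i + 1) rfl).symm (hS (hS₁ _) (hS₂ _))
  · change T.mor₁ ≫ e₂.hom = e₁.hom ≫ (HomotopyCategory.quotient _ _).map φ
    rw [hφ, Iso.hom_inv_id_assoc]

theorem isTriangulated_boundedIn (hS : ∀ {A B}, S A → S B → S (A ⊞ B))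
    (h0 : ∀ {A}, IsZero A → S A) : (boundedIn S).IsTriangulated := by
  have hs : (boundedIn S).IsStableUnderShift ℤ := ⟨fun m => ⟨fun X hX => by
    obtain ⟨W, ⟨N, hN⟩, hS, ⟨e⟩⟩ := hX
    refine ⟨W⟦m⟧, ⟨N + |m|, fun i hi => hN _ ?_⟩, fun i => hS _,
      ⟨(CategoryTheory.shiftFunctor _ m).mapIso e ≪≫ 
        ((HomotopyCategory.quotient C (ComplexShape.up ℤ)).commShiftIso m).symm.app W⟩⟩
    · grind⟩⟩
  exact
    { exists_zero := ⟨_, (HomotopyCategory.quotient _ _).map_isZero HomologicalComplex.isZero_zero, HomologicalComplex.zero,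
        ⟨0, fun i _ => isZero_zero C⟩,
        fun i => h0 (isZero_zero C), ⟨Iso.refl _⟩⟩
      ext₂' := fun T hT h₁ h₃ => by
        rw [ObjectProperty.isoClosure_eq_self]
        exact boundedIn_ext₃ hS (inv_rot_of_distTriang _ hT) ((boundedIn S).le_shift _ _ h₃) h₁ }

omit [HasBinaryBiproducts C] in
theorem boundedIn_single (h0 : ∀ {A}, IsZero A → S A) {A : C} (hA : S A) :
    boundedIn S ((HomotopyCategory.quotient _ _).obj
      ((HomologicalComplex.single C (ComplexShape.up ℤ) 0).obj A)) := by
  have hz : ∀ i : ℤ, i ≠ 0 → IsZero (((HomologicalComplex.single C (ComplexShape.up ℤ) 0).obj A).X i) :=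
    fun i hi => HomologicalComplex.isZero_single_obj_X _ _ _ _ hi
  refine ⟨_, ⟨0, fun i hi => hz i (abs_pos.mp hi)⟩, fun i => ?_, ⟨Iso.refl _⟩⟩
  by_cases hi : i = 0
  · subst hi
    exact S.prop_of_iso (HomologicalComplex.singleObjXSelf (ComplexShape.up ℤ) 0 A).symm hA
  · exact h0 (hz i hi)

end

end GaugedQuotient

/-! ### From complexes of twists to complexes of bundles -/

namespace GaugedQuotient

open CategoryTheory CochainComplex Pretriangulated Limits

variable {n : ℕ} {a r : Fin n → ℤ}

/-- The sums of twists with `C*_G`-weights in an interval. -/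
def twistsIn (a r : Fin n → ℤ) (lo hi : ℤ) : ObjectProperty (Mat_ (Twist (weights a r))) := fun P =>
  ∃ B : Mat_ (Twist (weights a r)), (∀ i, lo ≤ (B.X i).deg.1 ∧ (B.X i).deg.1 ≤ hi) ∧ Nonempty (P ≅ B)

instance {lo hi : ℤ} : (twistsIn a r lo hi).IsClosedUnderIsomorphisms where
  of_iso e := fun ⟨B, hB, ⟨e'⟩⟩ => ⟨B, hB, ⟨e.symm ≪≫ e'⟩⟩

theorem twistsIn_biprod {lo hi : ℤ} {P Q : Mat_ (Twist (weights a r))} (hP : twistsIn a r lo hi P)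
    (hQ : twistsIn a r lo hi Q) : twistsIn a r lo hi (P ⊞ Q) := by
  obtain ⟨B, hB, ⟨e⟩⟩ := hP
  obtain ⟨B', hB', ⟨e'⟩⟩ := hQ
  refine ⟨B.sum B', ?_, ⟨biprod.mapIso e e' ≪≫ B.biprodIsoSum B'⟩⟩
  rintro (i | i)
  exacts [hB i, hB' i]

theorem twistsIn_of_isZero {lo hi : ℤ} {P : Mat_ (Twist (weights a r))} (hP : IsZero P) :
    twistsIn a r lo hi P := by
  refine ⟨⟨PEmpty, PEmpty.elim⟩, fun i => i.elim, ⟨hP.iso ?_⟩⟩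
  rw [IsZero.iff_id_eq_zero]
  funext i
  exact i.elim

/-- Complexes homotopy equivalent to bounded ones with terms in the window form a triangulated class
that contains the generating twists. -/
theorem triangulatedHull_linesIn_le (lo hi : ℤ) :
    (linesIn a r lo hi).triangulatedHull ≤ boundedIn (twistsIn a r lo hi) := by
  have := isTriangulated_boundedIn (S := twistsIn a r lo hi) twistsIn_biprod twistsIn_of_isZero
  refine ObjectProperty.triangulatedHull_le ?_
  rintro _ ⟨Z, h₁, h₂, rfl⟩
  exact boundedIn_single twistsIn_of_isZero ⟨_, fun _ => ⟨h₁, h₂⟩, ⟨Iso.refl _⟩⟩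

/-- An isomorphism in the homotopy category has zero cone, which is torsion. This allows replacing a
complex by a homotopy equivalent bounded one. -/
theorem HasResolution.of_iso {X Y : HoTwist (weights a r)} (e : X ≅ Y) {E : EqBundle a r}
    (h : HasResolution X.as E) : HasResolution Y.as E := by
  obtain ⟨Z, g, u, hT⟩ := distinguished_cocone_triangle e.hom
  have hZ : IsZero Z := Triangle.isZero₃_of_isIso₁ _ hT (inferInstanceAs (IsIso e.hom))
  exact (hasResolution_iff_of_distTriang hT ((torsionComplexes a r).prop_of_isZero hZ) E).mp h

theorem isWindowSum_toBundle {t e : ℤ} {P : Mat_ (Twist (weights a r))}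
    (hP : twistsIn a r t (t + e - 1) P) : ((toBundle a r).obj P).IsWindowSum t e := by
  obtain ⟨B, hB, ⟨i⟩⟩ := hP
  obtain ⟨m, k, j, hk, ⟨i'⟩⟩ := EqBundle.isWindowSum_free (a := a) (r := r) (fun b => (B.X b).deg) hB
  exact ⟨m, k, j, hk, ⟨(toBundle a r).mapIso i ≪≫ i'⟩⟩

/-- The augmentation relation is single-valued, because an element of `E` related to the cocycle `0`
is zero. Choosing the unique value for each cocycle therefore gives a linear and natural map. -/
theorem HasResolution.resolves {W : CochainComplex (Mat_ (Twist (weights a r))) ℤ}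
    {E : EqBundle a r} (h : HasResolution W E) (hW : ∃ N : ℤ, ∀ i, N < |i| → IsZero (W.X i)) :
    EqBundle.Resolves (((toBundle a r).mapHomologicalComplex _).obj W) E := by
  obtain ⟨hex, ρ, hρ⟩ := h
  obtain ⟨N, hN⟩ := hW
  have huniq : ∀ p z e e', (z, e) ∈ ρ p → (z, e') ∈ ρ p → e = e' := fun p z e e' h h' => by
    have h1 := (ρ p).sub_mem h h'
    rw [Prod.mk_sub_mk, sub_self] at h1
    exact sub_eq_zero.mp ((hρ.eq_zero_iff p _ _ h1).mpr ⟨0, map_zero _⟩)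
  have hker : ∀ p (z : LinearMap.ker (evalMat p.v (W.d 0 1))), ∃ e, ((z : (W.X 0).ι → p.R), e) ∈ ρ p :=
    fun p z => (hρ.exists_iff p z).mpr z.2
  choose π hπ using hker
  refine ⟨⟨N, fun i hi p => subsingleton_of_isZero (R := p.R) (hN i hi)⟩,
    fun i hi p => hex p (i - 1) i (i + 1) (by lia) rfl hi, fun p =>
      { toFun := π p
        map_add' := fun x y => huniq p _ _ _ (hπ p (x + y)) ((ρ p).add_mem (hπ p x) (hπ p y))
        map_smul' := fun c x => huniq p _ _ _ (hπ p (c • x)) ((ρ p).smul_mem c (hπ p x)) },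
    fun p q h z z' hz => ?_, fun p => ⟨fun e => ?_, fun z => ?_⟩⟩
  · refine huniq q z'.1 _ _ (hπ q z') ?_
    have h1 := hρ.naturality p q h z.1 _ (hπ p z)
    exact (congrArg (fun x => (x, E.map h (π p z)) ∈ ρ q) hz).mpr h1
  · obtain ⟨z, hz⟩ := hρ.surjective p e
    have hz' := (hρ.exists_iff p z).mp ⟨e, hz⟩
    exact ⟨⟨z, hz'⟩, huniq p z _ _ (hπ p ⟨z, hz'⟩) hz⟩
  · exact hρ.eq_zero_iff p z.1 _ (hπ p z)

/-- Every equivariant bundle has a finite resolution by sums of line bundles in a given window. -/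
theorem EqBundle.exists_resolves (E : EqBundle a r) (t : ℤ) :
    ∃ C : CochainComplex (EqBundle a r) ℤ,
      (∀ i, (C.X i).IsWindowSum t (∑ i with 0 < a i, a i)) ∧ Resolves C E := by
  obtain ⟨X, hX, hX'⟩ := exists_hasResolution_window E t
  obtain ⟨W, hb, hW, ⟨e⟩⟩ := triangulatedHull_linesIn_le _ _ _ hX'
  exact ⟨((toBundle a r).mapHomologicalComplex _).obj W, fun i => isWindowSum_toBundle (hW i),
    HasResolution.resolves (hX.of_iso e) hb⟩

end GaugedQuotient

theorem mainTheorem5 (n : ℕ) (a r : Fin n → ℤ) (ha : ∑ i, a i = 0) (t : ℤ)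
    (E : GaugedQuotient.EqBundle a r) :
    ∃ C : CochainComplex (GaugedQuotient.EqBundle a r) ℤ,
      (∀ i, (C.X i).IsWindowSum t (∑ i with 0 < a i, a i)) ∧
        GaugedQuotient.EqBundle.Resolves C E :=
  E.exists_resolves t
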